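/- An alternating Turing machine $\mathcal T=\langle A,Q=Q_\forall\cup Q_\exists,q_0,\delta,F\rangle$ has a finite alphabet $A$ containing a blank, universal and existential states, accepting states $F\subseteq Q$, and a transition function $\delta$ that assigns to each $(q,a)\in Q\times A$ an ordered pair of triples (new state, written symbol, head move left or right). On an input $w\in A^*$ with $|w|>1$ it works on exactly $2^{|w|}$ tape cells: initially the tape contains $w$ followed by blanks, the head is on the first cell and the state is $q_0$; each of the two triples yields one successor configuration, unless the head would leave the $2^{|w|}$ cells, in which case there is no such successor. Acceptance is the least predicate such that a configuration accepts if its state is in $F$, or its state is existential and one of its successors accepts, or its state is universal and both successors exist and accept. $\mathcal T$ accepts $w$ if the initial configuration accepts. An open pushdown system (OPD) $\mathcal S=\langle AP,Q,q_0,\Gamma,\flat,\Delta,\mu,Env\rangle$ consists of finite sets $AP$ of propositions, $Q\subseteq 2^{I\cup H}$ of control states and $\Gamma\subseteq 2^{I_\Gamma\cup H_\Gamma}$ of stack symbols, where $I,H$ (resp. $I_\Gamma,H_\Gamma$) are disjoint finite sets of visible and invisible variables; an initial control state $q_0\in Q$; a bottom symbol $\flat\notin\Gamma$; a finite set $\Delta$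 of internal, push and pop transitions (popping $\flat$ leaves it in place); a labelling $\mu:Q\times(\Gamma\cup\{\flat\})\to AP$; and $Env\subseteq Q\times(\Gamma\cup\{\flat\})$ such that membership in $Env$ depends only on the visible parts of the control state and of the symbol. Here the visible part of $q\in Q$ is $q\cap I$; the visible part of $\gamma\in\Gamma$ is the empty word if $\emptyset\ne\gamma\subseteq H_\Gamma$, and $\gamma\cap I_\Gamma$ otherwise; and $\flat$ is visible. The stack content is visible if $H_\Gamma=\emptyset$. Configurations $(q,\alpha)$ with $\alpha\in\Gamma^*\flat$ are the states of the induced transition system; $(q,\alpha)$ is labelled by $\mu(q,\mathrm{top}(\alpha))$, is an environment state iff $(q,\mathrm{top}(\alpha))\in Env$ and a system state otherwise, and two configurations are indistinguishable iff the visible parts of their control states and of their stack contents (taken symbol by symbol) agree. A strategy tree of $\mathcal S$ is obtained from the computation tree of $\mathcal S$ from $(q_0,\flat)$ by pruning subtrees rooted at children of environment nodes, such that each environment node that has children in the computation tree keeps at least one of them, and such that of any two nodes of the computation tree whose paths from the root are indistinguishable state by state, either both are kept or neither is. ACTL is the set of formulas generated by $\mathtt{true}$, $p$, $\neg p$ ($p$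 a proposition), $\vee$, $\wedge$, $\mathsf{AX}\varphi$, $\mathsf A(\varphi\,\mathsf U\,\psi)$ and $\mathsf A(\varphi\,\widetilde{\mathsf U}\,\psi)$, where $\widetilde{\mathsf U}$ is the dual of until $\mathsf U$, interpreted as usual over the full (infinite, or finite and maximal) paths of a labelled tree. **Theorem.** There are an ACTL formula $\varphi$, independent of machines and inputs, and an algorithm that, given an alternating Turing machine $\mathcal T$ as above and a word $w$ over its alphabet, constructs an OPD $\mathcal S_{\mathcal T,w}$ in time polynomial in the sizes of $\mathcal T$ and $w$, such that whenever $|w|>1$: $\mathcal S_{\mathcal T,w}$ has visible stack content, its set of propositions contains those of $\varphi$, and $\mathcal T$ accepts $w$ if and only if some strategy tree of $\mathcal S_{\mathcal T,w}$ satisfies $\varphi$ at its root. -/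

import Mathlib

namespace PMC

/-! ### Alternating Turing machines with binary branching -/

/-- Head moves. -/
inductive Move where
  | left
  | right

/-- An alternating Turing machine with binary branching degree.  The alphabet `A` is `Fin nA`, the
set of states is `Fin nQ`, partitioned into universal and existential states. -/
structure ATM where
  nA : ℕ
  nQ : ℕ
  blank : Fin nA
  q0 : Fin nQ
  /-- `isUniv q = true` iff `q` is universal; the other states are existential. -/
  isUniv : Fin nQ → Bool
  /-- The accepting states. -/
  isAcc : Fin nQ → Bool
  /-- The pair of the left and the right triple. -/
  δ : Fin nQ → Fin nA → (Fin nQ × Fin nA × Move) × (Fin nQ × Fin nA × Move)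

namespace ATM

/-- Configurations with exactly `m` tape cells. -/
structure Cfg (T : ATM) (m : ℕ) where
  tape : Fin m → Fin T.nA
  head : Fin m
  state : Fin T.nQ

variable {T : ATM} {m : ℕ}

/-- The head position after a move; `none` if the head would leave the `m` cells. -/
def moveHead (i : Fin m) : Move → Option (Fin m)
  | .left => if 0 < i.val then some ⟨i.val - 1, lt_of_le_of_lt (Nat.sub_le _ _) i.isLt⟩ else none
  | .right => if h : i.val + 1 < m then some ⟨i.val + 1, h⟩ else none

/-- Apply a triple (new state, symbol to write, move) to a configuration. -/
def Cfg.apply (C : T.Cfg m) (t : Fin T.nQ × Fin T.nA × Move) : Option (T.Cfg m) :=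
  (moveHead C.head t.2.2).map fun h =>
    { tape := Function.update C.tape C.head t.2.1, head := h, state := t.1 }

/-- The successor by the left triple. -/
def Cfg.succL (C : T.Cfg m) : Option (T.Cfg m) := C.apply (T.δ C.state (C.tape C.head)).1

/-- The successor by the right triple. -/
def Cfg.succR (C : T.Cfg m) : Option (T.Cfg m) := C.apply (T.δ C.state (C.tape C.head)).2

/-- Alternating acceptance from a configuration: there is a finite accepting computation tree. -/
inductive Cfg.Accepting : T.Cfg m → Prop
  | leaf {C : T.Cfg m} (h : T.isAcc C.state = true) : Accepting C
  | exL {C C' : T.Cfg m} (h : T.isUniv C.state = false) (hs : C.succL = some C')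
      (hC : Accepting C') : Accepting C
  | exR {C C' : T.Cfg m} (h : T.isUniv C.state = false) (hs : C.succR = some C')
      (hC : Accepting C') : Accepting C
  | univ {C C₁ C₂ : T.Cfg m} (h : T.isUniv C.state = true) (hL : C.succL = some C₁)
      (hR : C.succR = some C₂) (h₁ : Accepting C₁) (h₂ : Accepting C₂) : Accepting C

/-- The initial configuration on input `w`, with `2 ^ |w|` tape cells: the head is on the first
cell, and the input is followed by blanks. -/
def initCfg (T : ATM) (w : List (Fin T.nA)) : T.Cfg (2 ^ w.length) where
  tape i := w.getD i.val T.blank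
  head := ⟨0, Nat.two_pow_pos _⟩
  state := T.q0

/-- `T` accepts `w` (in space `2 ^ |w|`). -/
def Accepts (T : ATM) (w : List (Fin T.nA)) : Prop := (T.initCfg w).Accepting

end ATM

/-! ### CTL in positive normal form, over atomic propositions named by natural numbers -/

inductive CTL where
  | tt : CTL
  | prop : ℕ → CTL
  | nprop : ℕ → CTL
  | or : CTL → CTL → CTL
  | and : CTL → CTL → CTL
  | EX : CTL → CTL
  | AX : CTL → CTL
  | EU : CTL → CTL → CTL
  | AU : CTL → CTL → CTL
  /-- the dual of until, existentially quantified -/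
  | ER : CTL → CTL → CTL
  /-- the dual of until, universally quantified -/
  | AR : CTL → CTL → CTL

namespace CTL

/-- The universal fragment ACTL: no existential path quantifier. -/
def IsACTL : CTL → Prop
  | tt => True
  | prop _ => True
  | nprop _ => True
  | or φ ψ => φ.IsACTL ∧ ψ.IsACTL
  | and φ ψ => φ.IsACTL ∧ ψ.IsACTL
  | EX _ => False
  | AX φ => φ.IsACTL
  | EU _ _ => False
  | AU φ ψ => φ.IsACTL ∧ ψ.IsACTL
  | ER _ _ => False
  | AR φ ψ => φ.IsACTL ∧ ψ.IsACTL

/-- The atomic propositions that occur in a formula. -/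
def atoms : CTL → Set ℕ
  | tt => ∅
  | prop p => {p}
  | nprop p => {p}
  | or φ ψ => φ.atoms ∪ ψ.atoms
  | and φ ψ => φ.atoms ∪ ψ.atoms
  | EX φ => φ.atoms
  | AX φ => φ.atoms
  | EU φ ψ => φ.atoms ∪ ψ.atoms
  | AU φ ψ => φ.atoms ∪ ψ.atoms
  | ER φ ψ => φ.atoms ∪ ψ.atoms
  | AR φ ψ => φ.atoms ∪ ψ.atoms

/-- `π 0, π 1, …` restricted to the indices `< len` is a full (that is, maximal) path from `x`:
it is infinite, or it ends in a node without children. -/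
def IsFullPath {N : Type} (child : N → N → Prop) (x : N) (len : ℕ∞) (π : ℕ → N) : Prop :=
  0 < len ∧ π 0 = x ∧
  (∀ i : ℕ, ((i + 1 : ℕ) : ℕ∞) < len → child (π i) (π (i + 1))) ∧
  (∀ i : ℕ, len = ((i + 1 : ℕ) : ℕ∞) → ∀ y, ¬ child (π i) y)

/-- CTL semantics at the node `x` of a labelled tree with child relation `child` and
labelling `V`. -/
def Sat {N : Type} (child : N → N → Prop) (V : N → Set ℕ) : CTL → N → Prop
  | tt, _ => True
  | prop p, x => p ∈ V x
  | nprop p, x => p ∉ V x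
  | or φ ψ, x => Sat child V φ x ∨ Sat child V ψ x
  | and φ ψ, x => Sat child V φ x ∧ Sat child V ψ x
  | EX φ, x => ∃ y, child x y ∧ Sat child V φ y
  | AX φ, x => ∀ y, child x y → Sat child V φ y
  | EU φ ψ, x => ∃ (len : ℕ∞) (π : ℕ → N), IsFullPath child x len π ∧
      ∃ i : ℕ, (i : ℕ∞) < len ∧ Sat child V ψ (π i) ∧ ∀ j < i, Sat child V φ (π j)
  | AU φ ψ, x => ∀ (len : ℕ∞) (π : ℕ → N), IsFullPath child x len π →
      ∃ i : ℕ, (i : ℕ∞) < len ∧ Sat child V ψ (π i) ∧ ∀ j < i, Sat child V φ (π j)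
  | ER φ ψ, x => ∃ (len : ℕ∞) (π : ℕ → N), IsFullPath child x len π ∧
      ∀ i : ℕ, (i : ℕ∞) < len → Sat child V ψ (π i) ∨ ∃ j < i, Sat child V φ (π j)
  | AR φ ψ, x => ∀ (len : ℕ∞) (π : ℕ → N), IsFullPath child x len π →
      ∀ i : ℕ, (i : ℕ∞) < len → Sat child V ψ (π i) ∨ ∃ j < i, Sat child V φ (π j)

end CTL

/-! ### Open Kripke structures (modules) and strategy trees -/

/-- The data of an open Kripke structure.  The states outside `env` are the system states; the
requirement that `env` is a union of classes of `indist` is `EnvObservable`. -/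
structure OpenKripke where
  State : Type
  env : Set State
  init : State
  R : State → State → Prop
  L : State → Set ℕ
  /-- indistinguishability by the environment -/
  indist : Setoid State

namespace OpenKripke

variable (M : OpenKripke)

/-- The environment can tell environment states from system states. -/
def EnvObservable : Prop := ∀ s s' : M.State, M.indist s s' → (s ∈ M.env ↔ s' ∈ M.env)

/-- A node of an unwinding: its current state, and the list of the earlier states on the path from
the root, the most recent one first. -/
abbrev Node : Type := M.State × List M.State

/-- The nodes of the computation tree from `s`, i.e. the finite paths of `M` that start in `s`. -/
inductive IsNode (s : M.State) : M.Node → Prop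
  | root : IsNode s (s, [])
  | child {t t' : M.State} {h : List M.State} (hn : IsNode s (t, h)) (hR : M.R t t') :
      IsNode s (t', t :: h)

/-- The sequence of the visible parts (classes of `indist`) of the states leading to a node. -/
def visHist (x : M.Node) : List (Quotient M.indist) := (x.1 :: x.2).map (Quotient.mk M.indist)

/-- `ST` is (the set of nodes of) a strategy tree from `s`. -/
structure IsStrategyTree (s : M.State) (ST : Set M.Node) : Prop where
  root_mem : (s, []) ∈ ST
  contained : ∀ x ∈ ST, M.IsNode s x
  prefix_closed : ∀ (t t' : M.State) (h : List M.State), (t', t :: h) ∈ ST → (t, h) ∈ ST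
  /-- no child of a system node is pruned -/
  system : ∀ (t t' : M.State) (h : List M.State), (t, h) ∈ ST → t ∉ M.env → M.R t t' →
    (t', t :: h) ∈ ST
  /-- the environment does not block the system -/
  environment : ∀ (t : M.State) (h : List M.State), (t, h) ∈ ST → t ∈ M.env →
    (∃ t', M.R t t') → ∃ t', (t', t :: h) ∈ ST
  /-- pruning depends only on the visible part of the history -/
  uniform : ∀ x₁ x₂ : M.Node, M.IsNode s x₁ → M.IsNode s x₂ → M.visHist x₁ = M.visHist x₂ →
    (x₁ ∈ ST ↔ x₂ ∈ ST)

/-- The child relation of the tree `ST`. -/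
def childIn (ST : Set M.Node) (x y : M.Node) : Prop := x ∈ ST ∧ y ∈ ST ∧ y.2 = x.1 :: x.2

/-- The strategy tree `ST` from `s` satisfies `φ` (at its root). -/
def TreeSat (s : M.State) (ST : Set M.Node) (φ : CTL) : Prop :=
  CTL.Sat (M.childIn ST) (fun x => M.L x.1) φ (s, [])

end OpenKripke

/-! ### Open pushdown systems -/

/-- An open pushdown system in which each configuration is labelled by exactly one proposition.
Variables are named by natural numbers: the visible control variables are those `< nI`, the
invisible ones the next `nH`, and similarly for the stack content variables with `nIΓ`, `nHΓ`.  A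
control state or stack symbol is a set of variables.  Finite sets of states, symbols, propositions
and transitions are given by listing their elements.  The bottom symbol is `none`. -/
structure OPD where
  nI : ℕ
  nH : ℕ
  nIΓ : ℕ
  nHΓ : ℕ
  AP : List ℕ
  Q : List (Finset ℕ)
  q0 : Finset ℕ
  Γ : List (Finset ℕ)
  /-- internal transitions `(q, q')` -/
  int : List (Finset ℕ × Finset ℕ)
  /-- push transitions `(q, q', γ)` -/
  push : List (Finset ℕ × Finset ℕ × Finset ℕ)
  /-- pop transitions `(q, γ, q')`, where `γ` may be the bottom symbol -/
  pop : List (Finset ℕ × Option (Finset ℕ) × Finset ℕ)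
  /-- the labelling; only its values on `Q × (Γ ∪ {none})` matter -/
  μ : Finset ℕ → Option (Finset ℕ) → ℕ
  Env : List (Finset ℕ × Option (Finset ℕ))
  Q_sub : ∀ q ∈ Q, q ⊆ Finset.range (nI + nH)
  Γ_sub : ∀ γ ∈ Γ, γ ⊆ Finset.range (nIΓ + nHΓ)
  q0_mem : q0 ∈ Q
  int_mem : ∀ t ∈ int, t.1 ∈ Q ∧ t.2 ∈ Q
  push_mem : ∀ t ∈ push, t.1 ∈ Q ∧ t.2.1 ∈ Q ∧ t.2.2 ∈ Γ
  pop_mem : ∀ t ∈ pop, t.1 ∈ Q ∧ (∀ γ ∈ t.2.1, γ ∈ Γ) ∧ t.2.2 ∈ Q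
  μ_mem : ∀ q ∈ Q, ∀ g ∈ none :: Γ.map some, μ q g ∈ AP
  Env_mem : ∀ t ∈ Env, t.1 ∈ Q ∧ ∀ γ ∈ t.2, γ ∈ Γ
  /-- The designation as an environment configuration is determined by the visible parts of the
  control state and of the top of the stack, where the visible part of a symbol is: nothing, if the
  symbol is nonempty and has only invisible variables, and its set of visible variables otherwise;
  the bottom symbol is visible. -/
  Env_vis : ∀ q ∈ Q, ∀ q' ∈ Q, ∀ g ∈ none :: Γ.map some, ∀ g' ∈ none :: Γ.map some,
    q ∩ Finset.range nI = q' ∩ Finset.range nI →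
    g.map (fun γ => if γ ⊆ Finset.Ico nIΓ (nIΓ + nHΓ) ∧ γ ≠ ∅ then none
        else some (γ ∩ Finset.range nIΓ)) =
      g'.map (fun γ => if γ ⊆ Finset.Ico nIΓ (nIΓ + nHΓ) ∧ γ ≠ ∅ then none
        else some (γ ∩ Finset.range nIΓ)) →
    ((q, g) ∈ Env ↔ (q', g') ∈ Env)

namespace OPD

variable (S : OPD)

/-- The stack content is visible: there are no invisible stack content variables. -/
def VisibleStackContent : Prop := S.nHΓ = 0

/-- The visible part of a control state. -/
def visCtrl (q : Finset ℕ) : Finset ℕ := q ∩ Finset.range S.nI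

/-- The visible part of a stack symbol; `none` stands for the empty word. -/
def visSym (γ : Finset ℕ) : Option (Finset ℕ) :=
  if γ ⊆ Finset.Ico S.nIΓ (S.nIΓ + S.nHΓ) ∧ γ ≠ ∅ then none
  else some (γ ∩ Finset.range S.nIΓ)

/-- Configurations; the stack is listed from its top, and its bottom symbol is left out. -/
@[ext]
structure Config where
  ctrl : Finset ℕ
  stack : List (Finset ℕ)
  ctrl_mem : ctrl ∈ S.Q
  stack_mem : ∀ γ ∈ stack, γ ∈ S.Γ

variable {S}

/-- The top of the stack; `none` is the bottom symbol. -/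
def Config.top (c : S.Config) : Option (Finset ℕ) := c.stack.head?

/-- The visible part of a configuration. -/
def Config.vis (c : S.Config) : Finset ℕ × List (Finset ℕ) :=
  (S.visCtrl c.ctrl, c.stack.filterMap S.visSym)

/-- The transition relation on configurations.  Popping the bottom symbol leaves it in place. -/
inductive Step : S.Config → S.Config → Prop
  | int {c c' : S.Config} (h : (c.ctrl, c'.ctrl) ∈ S.int) (hs : c'.stack = c.stack) : Step c c'
  | push {c c' : S.Config} (γ : Finset ℕ) (h : (c.ctrl, c'.ctrl, γ) ∈ S.push)
      (hs : c'.stack = γ :: c.stack) : Step c c'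
  | popBot {c c' : S.Config} (h : (c.ctrl, none, c'.ctrl) ∈ S.pop)
      (hs : c.stack = []) (hs' : c'.stack = []) : Step c c'
  | pop {c c' : S.Config} (γ : Finset ℕ) (h : (c.ctrl, some γ, c'.ctrl) ∈ S.pop)
      (hs : c.stack = γ :: c'.stack) : Step c c'

variable (S)

/-- The open Kripke structure induced by an open pushdown system. -/
def toKripke : OpenKripke where
  State := S.Config
  env := {c | (c.ctrl, c.top) ∈ S.Env}
  init := ⟨S.q0, [], S.q0_mem, by simp⟩
  R := Step
  L c := {S.μ c.ctrl c.top}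
  indist := Setoid.ker Config.vis

/-- Some strategy tree of `S` satisfies `φ`. -/
def ExistsStrategyTree (φ : CTL) : Prop :=
  ∃ ST : Set S.toKripke.Node, S.toKripke.IsStrategyTree S.toKripke.init ST ∧
    S.toKripke.TreeSat S.toKripke.init ST φ

/-- With visible stack content the induced structure satisfies the requirement on environment
states. -/
theorem envObservable_toKripke (hS : S.VisibleStackContent) : S.toKripke.EnvObservable := by
  intro c c' h
  have h : Config.vis c = Config.vis c' := h
  have hv : ∀ γ : Finset ℕ, S.visSym γ = some (γ ∩ Finset.range S.nIΓ) := by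
    intro γ
    have hS : S.nHΓ = 0 := hS
    simp [visSym, hS]
  have mem_top : ∀ d : S.Config, d.top ∈ none :: S.Γ.map some := by
    intro d
    rcases hd : d.stack with _ | ⟨γ, l⟩
    · simp [Config.top, hd]
    · have := d.stack_mem γ (by simp [hd])
      simp [Config.top, hd, this]
  refine S.Env_vis _ c.ctrl_mem _ c'.ctrl_mem _ (mem_top c) _ (mem_top c')
    (congrArg Prod.fst h) ?_
  have h2 := congrArg Prod.snd h
  simp only [Config.vis] at h2
  change c.top.map S.visSym = c'.top.map S.visSym
  unfold Config.top
  cases hc : c.stack <;> cases hc' : c'.stack <;> simp_all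

end OPD

/-! ### Encodings as binary words

Numbers are written in unary; this changes the sizes below by at most a polynomial, since alphabets,
state sets and transition tables are listed explicitly. -/

def encNat (n : ℕ) : List Bool := List.replicate n true ++ [false]

/-- A list, each element preceded by `true`, ended by `false`. -/
def encList {α : Type} (e : α → List Bool) (l : List α) : List Bool :=
  l.flatMap (fun x => true :: e x) ++ [false]

/-- The characteristic word of a subset of `{0, …, k - 1}`. -/
def encSet (k : ℕ) (s : Finset ℕ) : List Bool := (List.range k).map fun i => decide (i ∈ s)

def encMove : Move → Bool
  | .left => false
  | .right => true

def ATM.encTriple (T : ATM) (t : Fin T.nQ × Fin T.nA × Move) : List Bool :=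
  encNat t.1 ++ encNat t.2.1 ++ [encMove t.2.2]

/-- Encoding of a machine: sizes of alphabet and state set, blank symbol, initial state, universal
states, accepting states, and the table of the transition function. -/
def ATM.encode (T : ATM) : List Bool :=
  encNat T.nA ++ encNat T.nQ ++ encNat T.blank ++ encNat T.q0 ++
  (List.finRange T.nQ).map T.isUniv ++
  (List.finRange T.nQ).map T.isAcc ++
  (List.finRange T.nQ).flatMap fun q => (List.finRange T.nA).flatMap fun a =>
    T.encTriple (T.δ q a).1 ++ T.encTriple (T.δ q a).2

/-- Encoding of a machine together with an input word. -/
def encodeInput (x : Σ T : ATM, List (Fin T.nA)) : List Bool :=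
  x.1.encode ++ encList (fun a => encNat a.val) x.2

namespace OPD

variable (S : OPD)

def encCtrl (q : Finset ℕ) : List Bool := encSet (S.nI + S.nH) q

def encSym (γ : Finset ℕ) : List Bool := encSet (S.nIΓ + S.nHΓ) γ

/-- A stack symbol or the bottom symbol. -/
def encTop : Option (Finset ℕ) → List Bool
  | none => [false]
  | some γ => true :: S.encSym γ

/-- Encoding of an open pushdown system. -/
def encode : List Bool :=
  encNat S.nI ++ encNat S.nH ++ encNat S.nIΓ ++ encNat S.nHΓ ++
  encList encNat S.AP ++
  encList S.encCtrl S.Q ++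
  S.encCtrl S.q0 ++
  encList S.encSym S.Γ ++
  encList (fun t => S.encCtrl t.1 ++ S.encCtrl t.2) S.int ++
  encList (fun t => S.encCtrl t.1 ++ S.encCtrl t.2.1 ++ S.encSym t.2.2) S.push ++
  encList (fun t => S.encCtrl t.1 ++ S.encTop t.2.1 ++ S.encCtrl t.2.2) S.pop ++
  (S.Q.flatMap fun q => (none :: S.Γ.map some).flatMap fun g => encNat (S.μ q g)) ++
  encList (fun t => S.encCtrl t.1 ++ S.encTop t.2) S.Env

end OPD

end PMC

/-!
The formula says that on all paths the proposition `1`, which labels the control state `good`, holds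
eventually.  In the open pushdown system of a machine and a word of length `n`, the environment
pushes a run of the machine onto the stack, block by block.  A block describes one step: it lists
the `2 ^ n` cells, each with its address in `n` bits, its letter before and after the step, and
whether the head departs from it, arrives at it, or neither; a mark ends the block.  Between two
blocks the triple for the next step is chosen, in existential states by the environment and in
universal states by the system.  A block has a cell from which the head departs and a neighbouring
one at which it arrives, so that no block can be completed if the head would leave the tape.

At an accepting state, the environment may end the run.  Then the system pops the stack and chooses
what to check: that the address of a cell is zero at the end of the block and one more than the
address of the next cell popped otherwise, that the first cell popped of a block has the largest
address, or that the letter and the head of a cell agree with the previous block.  The first two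
need one bit of memory and a counter up to `n`.  For the last one, the system remembers either the
letter of the cell and whether the head is there, or one bit of its address; this choice, and
what is remembered, are invisible.  In the previous block, the environment decides at which cell to
stop.  Pruning is uniform and the stack content is visible, so it stops at the same cell whatever is
remembered.  Hence that cell must agree with all bits of the address, and with the letter and the
head, that is, it must be the same cell of the tape (`found_of_safe`, `readOK_blockW`).

`OpenKripke.treeSat_iff_eventually` and `existsStrategyTree_iff_wins` replace satisfaction in a
strategy tree by an inductive predicate on the tree.  `winIn_of_wins` and `wins_of_winIn` replace
strategy trees by the game `WinIn`, which has perfect information and ends with the condition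
`CheckOK` on the stack content.  `exists_blockW_of_mark` and `checkOK_stackW` characterize the stack
contents that pass all checks, and `exists_winIn_iff_accepts` compares `WinIn` with acceptance, by
induction on each.

For the computation of the system in polynomial time, `Cmd` is a language of programs that read and
write binary words, with loops bounded by numbers that exceed the input length at most by a
constant.  As the nesting of loops is fixed by the program, these programs run in polynomial time on
a multi-stack machine (`Cmd.nonempty_computableInPolyTime`).  The control states, symbols and
transitions are given by families `Fam` of items in nested loops, which are interpreted both as
lists of items and as programs that write their codes (`Fam.reads_cmd`).
-/

namespace PMC

/-! ### Structured programs over finitely many binary stacks -/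

/-- Structured programs that act on a family of stacks of bits indexed by `K`. -/
inductive StackProg (K : Type) where
  | skip : StackProg K
  | push : K → Bool → StackProg K
  | seq : StackProg K → StackProg K → StackProg K
  /-- Pop a stack, and branch on the result: empty, `true`, `false`. -/
  | casePop : K → StackProg K → StackProg K → StackProg K → StackProg K
  /-- Pop a stack until it is empty, running one of two programs after each pop, according to the
  bit popped. -/
  | drain : K → StackProg K → StackProg K → StackProg K
  /-- Pop a stack and run the first program as long as the bit popped is `true`; leave the loop
  when the stack is empty, or, after the second program, when the bit popped is `false`. -/
  | whilePop : K → StackProg K → StackProg K → StackProg K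

namespace StackProg

variable {K : Type}

/-- The program points of a program, other than its exit. -/
def Label : StackProg K → Type
  | skip => Unit
  | push _ _ => Unit
  | seq p q => p.Label ⊕ q.Label
  | casePop _ p q r => Option (p.Label ⊕ q.Label ⊕ r.Label)
  | drain _ p q => Option (p.Label ⊕ q.Label)
  | whilePop _ p q => Option (p.Label ⊕ q.Label)

instance fintypeLabel : (p : StackProg K) → Fintype p.Label
  | skip => inferInstanceAs (Fintype Unit)
  | push _ _ => inferInstanceAs (Fintype Unit)
  | seq p q =>
    have := fintypeLabel p
    have := fintypeLabel q
    inferInstanceAs (Fintype (p.Label ⊕ q.Label))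
  | casePop _ p q r =>
    have := fintypeLabel p
    have := fintypeLabel q
    have := fintypeLabel r
    inferInstanceAs (Fintype (Option (p.Label ⊕ q.Label ⊕ r.Label)))
  | drain _ p q =>
    have := fintypeLabel p
    have := fintypeLabel q
    inferInstanceAs (Fintype (Option (p.Label ⊕ q.Label)))
  | whilePop _ p q =>
    have := fintypeLabel p
    have := fintypeLabel q
    inferInstanceAs (Fintype (Option (p.Label ⊕ q.Label)))

/-- The program point at which a program starts. -/
def entry : (p : StackProg K) → p.Label
  | skip => ()
  | push _ _ => ()
  | seq p _ => Sum.inl p.entry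
  | casePop _ _ _ _ => none
  | drain _ _ _ => none
  | whilePop _ _ _ => none

/-- Statements of stack machines with binary stacks, whose internal state holds the last result of
a pop. -/
abbrev BitStmt (K Λ : Type) : Type := Turing.TM2.Stmt (fun _ : K => Bool) Λ (Option Bool)

/-- Pop the stack `k` and go to one of three labels. -/
def popGoto {Λ : Type} (k : K) (lNone lTrue lFalse : Λ) : BitStmt K Λ :=
  .pop k (fun _ o => o) (.goto fun o => o.elim lNone fun b => cond b lTrue lFalse)

/-- The statement at each program point, when the program points are embedded into the labels `Λ`
of a machine by `emb`, and the exit of the program is the label `exit`. -/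
def code {Λ : Type} : (p : StackProg K) → (p.Label → Λ) → Λ → p.Label → BitStmt K Λ
  | skip, _, exit, _ => .goto fun _ => exit
  | push k b, _, exit, _ => .push k (fun _ => b) (.goto fun _ => exit)
  | seq p q, emb, exit, l =>
    match l with
    | Sum.inl l => p.code (fun l => emb (Sum.inl l)) (emb (Sum.inr q.entry)) l
    | Sum.inr l => q.code (fun l => emb (Sum.inr l)) exit l
  | casePop k p q r, emb, exit, l =>
    match l with
    | none => popGoto k (emb (some (Sum.inl p.entry))) (emb (some (Sum.inr (Sum.inl q.entry))))
        (emb (some (Sum.inr (Sum.inr r.entry))))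
    | some (Sum.inl l) => p.code (fun l => emb (some (Sum.inl l))) exit l
    | some (Sum.inr (Sum.inl l)) => q.code (fun l => emb (some (Sum.inr (Sum.inl l)))) exit l
    | some (Sum.inr (Sum.inr l)) => r.code (fun l => emb (some (Sum.inr (Sum.inr l)))) exit l
  | drain k p q, emb, exit, l =>
    match l with
    | none => popGoto k exit (emb (some (Sum.inl p.entry))) (emb (some (Sum.inr q.entry)))
    | some (Sum.inl l) => p.code (fun l => emb (some (Sum.inl l))) (emb none) l
    | some (Sum.inr l) => q.code (fun l => emb (some (Sum.inr l))) (emb none) l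
  | whilePop k p q, emb, exit, l =>
    match l with
    | none => popGoto k exit (emb (some (Sum.inl p.entry))) (emb (some (Sum.inr q.entry)))
    | some (Sum.inl l) => p.code (fun l => emb (some (Sum.inl l))) (emb none) l
    | some (Sum.inr l) => q.code (fun l => emb (some (Sum.inr l))) exit l

open Function (update)

variable [DecidableEq K]

/-- `Exec p s t n`: started on the stacks `s`, the program `p` ends with the stacks `t` after at
most `n` steps. -/
inductive Exec : StackProg K → (K → List Bool) → (K → List Bool) → ℕ → Prop
  | skip (s) : Exec skip s s 1
  | push (s k b) : Exec (push k b) s (update s k (b :: s k)) 1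
  | seq {p q s t u n m} (hp : Exec p s t n) (hq : Exec q t u m) : Exec (seq p q) s u (n + m)
  | caseNone {k p q r s t n} (h : s k = []) (hp : Exec p s t n) :
      Exec (casePop k p q r) s t (n + 1)
  | caseTrue {k p q r s t n l} (h : s k = true :: l) (hq : Exec q (update s k l) t n) :
      Exec (casePop k p q r) s t (n + 1)
  | caseFalse {k p q r s t n l} (h : s k = false :: l) (hr : Exec r (update s k l) t n) :
      Exec (casePop k p q r) s t (n + 1)
  | drainNil {k p q s} (h : s k = []) : Exec (drain k p q) s s 1
  | drainTrue {k p q s t u n m l} (h : s k = true :: l) (hp : Exec p (update s k l) t n)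
      (hd : Exec (drain k p q) t u m) : Exec (drain k p q) s u (n + m + 1)
  | drainFalse {k p q s t u n m l} (h : s k = false :: l) (hq : Exec q (update s k l) t n)
      (hd : Exec (drain k p q) t u m) : Exec (drain k p q) s u (n + m + 1)
  | whileNil {k p q s} (h : s k = []) : Exec (whilePop k p q) s s 1
  | whileTrue {k p q s t u n m l} (h : s k = true :: l) (hp : Exec p (update s k l) t n)
      (hd : Exec (whilePop k p q) t u m) : Exec (whilePop k p q) s u (n + m + 1)
  | whileFalse {k p q s t n l} (h : s k = false :: l) (hq : Exec q (update s k l) t n) :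
      Exec (whilePop k p q) s t (n + 1)
  | mono {p s t n m} (h : Exec p s t n) (hnm : n ≤ m) : Exec p s t m

/-- `RunsWithin M l s l' t n`: the machine `M` gets from label `l` and stacks `s` to label `l'` and
stacks `t` in at most `n` steps, whatever its internal state is at the start. -/
def RunsWithin {Λ : Type} (M : Λ → BitStmt K Λ) (l : Λ) (s : K → List Bool) (l' : Λ)
    (t : K → List Bool) (n : ℕ) : Prop :=
  ∀ v, ∃ v', ∃ m ≤ n,
    (flip bind (Turing.TM2.step M))^[m] (some ⟨some l, v, s⟩) = some ⟨some l', v', t⟩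

section

variable {Λ : Type} {M : Λ → BitStmt K Λ}

theorem RunsWithin.trans {l₁ l₂ l₃ : Λ} {s₁ s₂ s₃ : K → List Bool} {n m : ℕ}
    (h₁ : RunsWithin M l₁ s₁ l₂ s₂ n) (h₂ : RunsWithin M l₂ s₂ l₃ s₃ m) :
    RunsWithin M l₁ s₁ l₃ s₃ (n + m) := by
  intro v
  obtain ⟨v₁, a, ha, e₁⟩ := h₁ v
  obtain ⟨v₂, b, hb, e₂⟩ := h₂ v₁
  exact ⟨v₂, b + a, by omega, by rw [Function.iterate_add_apply, e₁, e₂]⟩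

theorem RunsWithin.mono {l l' : Λ} {s t : K → List Bool} {n m : ℕ}
    (h : RunsWithin M l s l' t n) (hnm : n ≤ m) : RunsWithin M l s l' t m := by
  intro v
  obtain ⟨v', a, ha, e⟩ := h v
  exact ⟨v', a, ha.trans hnm, e⟩

theorem RunsWithin.of_step {l l' : Λ} {s t : K → List Bool}
    (h : ∀ v, ∃ v', Turing.TM2.stepAux (M l) v s = ⟨some l', v', t⟩) :
    RunsWithin M l s l' t 1 := by
  intro v
  obtain ⟨v', e⟩ := h v
  exact ⟨v', 1, le_rfl, by simp [flip, e]⟩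

theorem runsWithin_popGoto_none {l l₁ l₂ l₃ : Λ} {k : K} {s : K → List Bool}
    (hM : M l = popGoto k l₁ l₂ l₃) (h : s k = []) : RunsWithin M l s l₁ s 1 := by
  refine RunsWithin.of_step fun v => ⟨none, ?_⟩
  have : update s k [] = s := by rw [← h]; exact Function.update_eq_self k s
  simp [hM, popGoto, h, this]

theorem runsWithin_popGoto_true {l l₁ l₂ l₃ : Λ} {k : K} {s : K → List Bool} {r : List Bool}
    (hM : M l = popGoto k l₁ l₂ l₃) (h : s k = true :: r) :
    RunsWithin M l s l₂ (update s k r) 1 :=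
  RunsWithin.of_step fun v => ⟨some true, by simp [hM, popGoto, h]⟩

theorem runsWithin_popGoto_false {l l₁ l₂ l₃ : Λ} {k : K} {s : K → List Bool} {r : List Bool}
    (hM : M l = popGoto k l₁ l₂ l₃) (h : s k = false :: r) :
    RunsWithin M l s l₃ (update s k r) 1 :=
  RunsWithin.of_step fun v => ⟨some false, by simp [hM, popGoto, h]⟩

/-- A machine that contains the code of a program executes the program. -/
theorem Exec.runsWithin {p : StackProg K} {s t : K → List Bool} {n : ℕ} (h : Exec p s t n)
    (emb : p.Label → Λ) (exit : Λ) (hM : ∀ l, M (emb l) = p.code emb exit l) :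
    RunsWithin M (emb p.entry) s exit t n := by
  induction h generalizing exit with
  | skip s => exact RunsWithin.of_step fun v => ⟨v, by rw [hM]; simp [code]⟩
  | push s k b => exact RunsWithin.of_step fun v => ⟨v, by rw [hM]; simp [code]⟩
  | seq _ _ ihp ihq =>
    exact (ihp (fun l => emb (Sum.inl l)) _ fun l => hM (Sum.inl l)).trans
      (ihq (fun l => emb (Sum.inr l)) _ fun l => hM (Sum.inr l))
  | caseNone h _ ih =>
    rw [Nat.add_comm]
    exact (runsWithin_popGoto_none (hM none) h).trans
      (ih (fun l => emb (some (Sum.inl l))) _ fun l => hM (some (Sum.inl l)))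
  | caseTrue h _ ih =>
    rw [Nat.add_comm]
    exact (runsWithin_popGoto_true (hM none) h).trans
      (ih (fun l => emb (some (Sum.inr (Sum.inl l)))) _ fun l => hM (some (Sum.inr (Sum.inl l))))
  | caseFalse h _ ih =>
    rw [Nat.add_comm]
    exact (runsWithin_popGoto_false (hM none) h).trans
      (ih (fun l => emb (some (Sum.inr (Sum.inr l)))) _ fun l => hM (some (Sum.inr (Sum.inr l))))
  | drainNil h => exact runsWithin_popGoto_none (hM none) h
  | drainTrue h _ _ ihp ihd =>
    rw [Nat.add_comm]
    exact (runsWithin_popGoto_true (hM none) h).trans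
      ((ihp (fun l => emb (some (Sum.inl l))) _ fun l => hM (some (Sum.inl l))).trans
        (ihd emb exit hM))
  | drainFalse h _ _ ihp ihd =>
    rw [Nat.add_comm]
    exact (runsWithin_popGoto_false (hM none) h).trans
      ((ihp (fun l => emb (some (Sum.inr l))) _ fun l => hM (some (Sum.inr l))).trans
        (ihd emb exit hM))
  | whileNil h => exact runsWithin_popGoto_none (hM none) h
  | whileTrue h _ _ ihp ihd =>
    rw [Nat.add_comm]
    exact (runsWithin_popGoto_true (hM none) h).trans
      ((ihp (fun l => emb (some (Sum.inl l))) _ fun l => hM (some (Sum.inl l))).trans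
        (ihd emb exit hM))
  | whileFalse h _ ih =>
    rw [Nat.add_comm]
    exact (runsWithin_popGoto_false (hM none) h).trans
      (ih (fun l => emb (some (Sum.inr l))) _ fun l => hM (some (Sum.inr l)))
  | mono _ hnm ih => exact (ih emb exit hM).mono hnm

end

/-- The machine that executes a program and halts. -/
def toTM [Fintype K] (p : StackProg K) (kIn kOut : K) : Turing.FinTM2 where
  K := K
  k₀ := kIn
  k₁ := kOut
  Γ _ := Bool
  Λ := Option p.Label
  main := some p.entry
  σ := Option Bool
  initialState := none
  m l :=
    match l with
    | some l => p.code some none l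
    | none => .load (fun _ => none) .halt

/-- The stacks of the initial and of the final configuration of a machine. -/
theorem dite_mpr_eq_update (k₀ : K) (s : List Bool)
    (h : ∀ k, k = k₀ → List Bool = List Bool) :
    (fun k => if e : k = k₀ then Eq.mpr (h k e) s else []) = update (fun _ => []) k₀ s := by
  funext k
  by_cases e : k = k₀
  · subst e
    rw [Function.update_self, dif_pos rfl]
    rfl
  · rw [Function.update_of_ne e, dif_neg e]

/-- A program that turns an input stack holding `ea a` into an output stack holding `eb (f a)`,
and leaves all other stacks empty, in polynomial time, yields a polynomial time machine. -/
theorem nonempty_computableInPolyTime [Fintype K] {α β : Type} {ea : α → List Bool}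
    {eb : β → List Bool} {f : α → β} (p : StackProg K) (kIn kOut : K) (T : Polynomial ℕ)
    (h : ∀ a, Exec p (update (fun _ => []) kIn (ea a)) (update (fun _ => []) kOut (eb (f a)))
      (T.eval (ea a).length)) :
    Nonempty (Turing.TM2ComputableInPolyTime ea eb f) := by
  refine ⟨{ tm := p.toTM kIn kOut
            inputAlphabet := Equiv.refl Bool
            outputAlphabet := Equiv.refl Bool
            time := T + 1
            outputsFun := fun a => Classical.choice ?_ }⟩
  have hrun := (h a).runsWithin (M := (p.toTM kIn kOut).m) some none (fun l => rfl)
  obtain ⟨v', m, hm, e⟩ := hrun none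
  have hmap : ∀ l : List Bool, List.map (Equiv.refl Bool).invFun l = l := fun l => by
    simp [Equiv.refl]
  refine ⟨⟨⟨m + 1, ?_⟩, ?_⟩⟩
  · have e1 : Turing.initList (p.toTM kIn kOut) (ea a) =
        (⟨some (some p.entry), none, update (fun _ => []) kIn (ea a)⟩ :
          Turing.TM2.Cfg (fun _ : K => Bool) (Option p.Label) (Option Bool)) :=
      congrArg (Turing.TM2.Cfg.mk _ _) (dite_mpr_eq_update kIn (ea a) fun _ _ => rfl)
    have e2 : Turing.haltList (p.toTM kIn kOut) (eb (f a)) =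
        (⟨none, none, update (fun _ => []) kOut (eb (f a))⟩ :
          Turing.TM2.Cfg (fun _ : K => Bool) (Option p.Label) (Option Bool)) :=
      congrArg (Turing.TM2.Cfg.mk _ _) (dite_mpr_eq_update kOut (eb (f a)) fun _ _ => rfl)
    have e3 : (flip bind (p.toTM kIn kOut).step)^[m + 1]
        (some (Turing.initList (p.toTM kIn kOut) (ea a))) =
        some (Turing.haltList (p.toTM kIn kOut) (eb (f a))) := by
      refine (congrArg _ (congrArg some e1)).trans ?_
      rw [Function.iterate_succ_apply']
      refine (congrArg _ e).trans ?_
      exact congrArg some e2.symm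
    rw [← hmap (ea a), ← hmap (eb (f a))] at e3
    exact e3
  · simp only [Polynomial.eval_add, Polynomial.eval_one]
    omega

end StackProg
end PMC

namespace PMC

open Function (update)

/-! ### A language of binary word transducers -/

/-- Programs that read a binary word and write a binary word, with variables in `R` that hold
natural numbers.  All variables are lexically scoped: a construct that sets a variable does so for
its body only. -/
inductive Cmd (R : Type) where
  | nil : Cmd R
  /-- Write one bit. -/
  | lit : Bool → Cmd R
  | seq : Cmd R → Cmd R → Cmd R
  /-- `oneHot N x` writes `N` bits, all `false` except the one at position `x`. -/
  | oneHot : R → R → Cmd R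
  /-- `loop v r c` runs `c` for `v = 0, …, r - 1`. -/
  | loop : R → R → Cmd R → Cmd R
  /-- Read a number in unary. -/
  | readNat : R → Cmd R → Cmd R
  /-- Read a bit and branch. -/
  | readBit : Cmd R → Cmd R → Cmd R
  /-- `succ x y c` runs `c` with `x = y + 1`. -/
  | succ : R → R → Cmd R → Cmd R
  /-- Read the rest of the input, and run the body with the number of `false` in it, minus one. -/
  | countFalse : R → Cmd R → Cmd R
  /-- Go back to the start of the input. -/
  | rewind : Cmd R

namespace Cmd

variable {R : Type} [DecidableEq R]

/-- The meaning of a program: given the values of the variables, the whole input `full` and the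
part `i` of it that is still to be read, the word written and the part of the input left. -/
def run : Cmd R → (R → ℕ) → List Bool → List Bool → List Bool × List Bool
  | nil, _, _, i => ([], i)
  | lit b, _, _, i => ([b], i)
  | seq c d, ρ, full, i =>
    ((c.run ρ full i).1 ++ (d.run ρ full (c.run ρ full i).2).1,
      (d.run ρ full (c.run ρ full i).2).2)
  | oneHot N x, ρ, _, i => ((List.range (ρ N)).map fun k => decide (k = ρ x), i)
  | loop v r c, ρ, full, i =>
    Nat.rec ([], i)
      (fun k p => (p.1 ++ (c.run (update ρ v k) full p.2).1, (c.run (update ρ v k) full p.2).2))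
      (update ρ v 0 r)
  | readNat x c, ρ, full, i =>
    c.run (update ρ x (i.takeWhile id).length) full (i.dropWhile id).tail
  | readBit c d, ρ, full, i =>
    match i with
    | [] => d.run ρ full []
    | true :: i => c.run ρ full i
    | false :: i => d.run ρ full i
  | succ x y c, ρ, full, i => c.run (update ρ x (update ρ x 0 y + 1)) full i
  | countFalse x c, ρ, full, i => c.run (update ρ x (i.count false - 1)) full []
  | rewind, _, full, _ => ([], full)

end Cmd

/-- The stacks used to execute a transducer: one for each variable, with its value in unary, the
unread and the read part of the input, the output, a stack for loop counters and for saved values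
of variables, and three auxiliary stacks. -/
inductive Stk (R : Type) where
  | reg : R → Stk R
  | inp : Stk R
  | used : Stk R
  | out : Stk R
  | cnt : Stk R
  | tmp : Stk R
  | aux : Stk R
  | res : Stk R
  deriving DecidableEq

instance Stk.fintype {R : Type} [Fintype R] [DecidableEq R] : Fintype (Stk R) :=
  ⟨Finset.univ.image Stk.reg ∪ {.inp, .used, .out, .cnt, .tmp, .aux, .res}, fun k => by
    cases k <;> simp⟩

/-- The stacks with given contents; the stack of the final result is empty. -/
def store {R : Type} (ρ : R → ℕ) (i u o c t a : List Bool) : Stk R → List Bool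
  | .reg r => List.replicate (ρ r) true
  | .inp => i
  | .used => u
  | .out => o
  | .cnt => c
  | .tmp => t
  | .aux => a
  | .res => []

section store

variable {R : Type} [DecidableEq R] (ρ : R → ℕ) (i u o c t a l : List Bool)

theorem update_store_reg (r : R) (k : ℕ) :
    update (store ρ i u o c t a) (.reg r) (List.replicate k true) =
      store (update ρ r k) i u o c t a := by
  funext s
  cases s with
  | reg s =>
    by_cases h : s = r
    · subst h; simp [store]
    · rw [Function.update_of_ne (by simpa using h)]; simp [store, h]
  | _ => rfl

theorem update_store_inp :
    update (store ρ i u o c t a) .inp l = store ρ l u o c t a := by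
  funext s; cases s <;> rfl

theorem update_store_used :
    update (store ρ i u o c t a) .used l = store ρ i l o c t a := by
  funext s; cases s <;> rfl

theorem update_store_out :
    update (store ρ i u o c t a) .out l = store ρ i u l c t a := by
  funext s; cases s <;> rfl

theorem update_store_cnt :
    update (store ρ i u o c t a) .cnt l = store ρ i u o l t a := by
  funext s; cases s <;> rfl

theorem update_store_tmp :
    update (store ρ i u o c t a) .tmp l = store ρ i u o c l a := by
  funext s; cases s <;> rfl

theorem update_store_aux :
    update (store ρ i u o c t a) .aux l = store ρ i u o c t l := by
  funext s; cases s <;> rfl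

end store

namespace StackProg

variable {R : Type} [DecidableEq R] {ρ : R → ℕ} {i u o c t a : List Bool} {b : Bool}

theorem exec_push_reg (r : R) :
    Exec (push (.reg r) true) (store ρ i u o c t a)
      (store (update ρ r (ρ r + 1)) i u o c t a) 1 := by
  have := Exec.push (store ρ i u o c t a) (.reg r) true
  rwa [show true :: store ρ i u o c t a (.reg r) = List.replicate (ρ r + 1) true from rfl,
    update_store_reg] at this

theorem exec_push_inp : Exec (push .inp b) (store ρ i u o c t a)
    (store ρ (b :: i) u o c t a) 1 := by
  have := Exec.push (store ρ i u o c t a) .inp b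
  rwa [update_store_inp] at this

theorem exec_push_used : Exec (push .used b) (store ρ i u o c t a)
    (store ρ i (b :: u) o c t a) 1 := by
  have := Exec.push (store ρ i u o c t a) .used b
  rwa [update_store_used] at this

theorem exec_push_out : Exec (push .out b) (store ρ i u o c t a)
    (store ρ i u (b :: o) c t a) 1 := by
  have := Exec.push (store ρ i u o c t a) .out b
  rwa [update_store_out] at this

theorem exec_push_cnt : Exec (push .cnt b) (store ρ i u o c t a)
    (store ρ i u o (b :: c) t a) 1 := by
  have := Exec.push (store ρ i u o c t a) .cnt b
  rwa [update_store_cnt] at this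

theorem exec_push_tmp : Exec (push .tmp b) (store ρ i u o c t a)
    (store ρ i u o c (b :: t) a) 1 := by
  have := Exec.push (store ρ i u o c t a) .tmp b
  rwa [update_store_tmp] at this

theorem exec_push_aux : Exec (push .aux b) (store ρ i u o c t a)
    (store ρ i u o c t (b :: a)) 1 := by
  have := Exec.push (store ρ i u o c t a) .aux b
  rwa [update_store_aux] at this

theorem exec_drain_reg_zero {p q : StackProg (Stk R)} {v : R} (h : ρ v = 0) :
    Exec (drain (.reg v) p q) (store ρ i u o c t a) (store ρ i u o c t a) 1 :=
  Exec.drainNil (by simp [store, h])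

theorem exec_drain_reg_succ {p q : StackProg (Stk R)} {v : R} {m n k : ℕ}
    {s s' : Stk R → List Bool} (h : ρ v = m + 1)
    (hp : Exec p (store (update ρ v m) i u o c t a) s n) (hd : Exec (drain (.reg v) p q) s s' k) :
    Exec (drain (.reg v) p q) (store ρ i u o c t a) s' (n + k + 1) := by
  refine Exec.drainTrue (l := List.replicate m true) (by simp [store, h, List.replicate_succ]) ?_ hd
  rwa [update_store_reg]

theorem replicate_append_cons (m : ℕ) (l : List Bool) :
    List.replicate m true ++ true :: l = List.replicate (m + 1) true ++ l := by
  rw [List.replicate_succ', List.append_assoc, List.singleton_append]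

theorem exec_drain_reg_cnt (v : R) (m : ℕ) (hm : ρ v = m) :
    Exec (drain (.reg v) (push .cnt true) skip) (store ρ i u o c t a)
      (store (update ρ v 0) i u o (List.replicate m true ++ c) t a) (2 * m + 1) := by
  induction m generalizing ρ c with
  | zero =>
    rw [show update ρ v 0 = ρ by rw [← hm, Function.update_eq_self]]
    exact exec_drain_reg_zero hm
  | succ m ih =>
    have := exec_drain_reg_succ hm exec_push_cnt
      (ih (ρ := update ρ v m) (c := true :: c) (by simp))
    rw [Function.update_idem, replicate_append_cons] at this
    exact this.mono (by omega)

theorem exec_drain_reg_tmp (v : R) (m : ℕ) (hm : ρ v = m) :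
    Exec (drain (.reg v) (push .tmp true) skip) (store ρ i u o c t a)
      (store (update ρ v 0) i u o c (List.replicate m true ++ t) a) (2 * m + 1) := by
  induction m generalizing ρ t with
  | zero =>
    rw [show update ρ v 0 = ρ by rw [← hm, Function.update_eq_self]]
    exact exec_drain_reg_zero hm
  | succ m ih =>
    have := exec_drain_reg_succ hm exec_push_tmp
      (ih (ρ := update ρ v m) (t := true :: t) (by simp))
    rw [Function.update_idem, replicate_append_cons] at this
    exact this.mono (by omega)

/-- Setting a variable to zero. -/
def clearReg (v : R) : StackProg (Stk R) := drain (.reg v) skip skip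

theorem exec_clearReg (v : R) (m : ℕ) (hm : ρ v = m) :
    Exec (clearReg v) (store ρ i u o c t a) (store (update ρ v 0) i u o c t a) (2 * m + 1) := by
  induction m generalizing ρ with
  | zero =>
    rw [show update ρ v 0 = ρ by rw [← hm, Function.update_eq_self]]
    exact exec_drain_reg_zero hm
  | succ m ih =>
    have := exec_drain_reg_succ hm (Exec.skip _) (ih (ρ := update ρ v m) (by simp))
    rw [Function.update_idem] at this
    exact this.mono (by omega)

/-- Moving the value of a variable to the stack of counters. -/
def saveReg (v : R) : StackProg (Stk R) :=
  seq (push .cnt false) (drain (.reg v) (push .cnt true) skip)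

theorem exec_saveReg (v : R) : Exec (saveReg v) (store ρ i u o c t a)
    (store (update ρ v 0) i u o (List.replicate (ρ v) true ++ false :: c) t a)
    (2 * ρ v + 2) :=
  (Exec.seq exec_push_cnt (exec_drain_reg_cnt v _ rfl)).mono (by omega)

theorem exec_while_cnt_reg (v : R) (m : ℕ) :
    Exec (whilePop .cnt (push (.reg v) true) skip)
      (store ρ i u o (List.replicate m true ++ false :: c) t a)
      (store (update ρ v (ρ v + m)) i u o c t a) (2 * m + 2) := by
  induction m generalizing ρ with
  | zero =>
    refine Exec.whileFalse (l := c) rfl ?_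
    rw [update_store_cnt, Nat.add_zero, Function.update_eq_self]
    exact Exec.skip _
  | succ m ih =>
    refine (Exec.whileTrue (l := List.replicate m true ++ false :: c) rfl
      (t := store (update ρ v (ρ v + 1)) i u o (List.replicate m true ++ false :: c) t a)
      (n := 1) (m := 2 * m + 2) ?_ ?_).mono (by omega)
    · rw [update_store_cnt]
      exact exec_push_reg v
    · have := ih (ρ := update ρ v (ρ v + 1))
      rwa [Function.update_idem, Function.update_self, Nat.add_assoc, Nat.add_comm 1 m] at this

/-- Giving a variable the value saved on the stack of counters. -/
def restoreReg (v : R) : StackProg (Stk R) :=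
  seq (clearReg v) (whilePop .cnt (push (.reg v) true) skip)

theorem exec_restoreReg (v : R) (k : ℕ) :
    Exec (restoreReg v) (store ρ i u o (List.replicate k true ++ false :: c) t a)
      (store (update ρ v k) i u o c t a) (2 * ρ v + 2 * k + 3) := by
  have := Exec.seq (exec_clearReg v _ rfl)
    (exec_while_cnt_reg (ρ := update ρ v 0) (i := i) (u := u) (o := o) (c := c) (t := t)
      (a := a) v k)
  rw [Function.update_idem, Function.update_self, Nat.zero_add] at this
  exact this.mono (by omega)

/-- Copying the value of a variable to the stack of counters. -/
def copyCnt (v : R) : StackProg (Stk R) :=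
  seq (drain (.reg v) (push .tmp true) skip)
    (drain .tmp (seq (push (.reg v) true) (push .cnt true)) skip)

theorem exec_drain_tmp_cnt (v : R) (m : ℕ) :
    Exec (drain .tmp (seq (push (.reg v) true) (push .cnt true)) skip)
      (store ρ i u o c (List.replicate m true) a)
      (store (update ρ v (ρ v + m)) i u o (List.replicate m true ++ c) [] a) (3 * m + 1) := by
  induction m generalizing ρ c with
  | zero =>
    rw [Nat.add_zero, Function.update_eq_self]
    exact Exec.drainNil rfl
  | succ m ih =>
    refine (Exec.drainTrue (l := List.replicate m true) rfl
      (t := store (update ρ v (ρ v + 1)) i u o (true :: c) (List.replicate m true) a)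
      (n := 1 + 1) (m := 3 * m + 1) ?_ ?_).mono (by omega)
    · rw [update_store_tmp]
      exact Exec.seq (exec_push_reg v) exec_push_cnt
    · have := ih (ρ := update ρ v (ρ v + 1)) (c := true :: c)
      rwa [Function.update_idem, Function.update_self, Nat.add_assoc, Nat.add_comm 1 m,
        replicate_append_cons] at this

theorem exec_copyCnt (v : R) : Exec (copyCnt v) (store ρ i u o c [] a)
    (store ρ i u o (List.replicate (ρ v) true ++ c) [] a) (5 * ρ v + 2) := by
  have := Exec.seq (exec_drain_reg_tmp (ρ := ρ) (i := i) (u := u) (o := o) (c := c) (t := [])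
    (a := a) v _ rfl) (by rw [List.append_nil]; exact exec_drain_tmp_cnt v _)
  rw [Function.update_idem, Function.update_self, Nat.zero_add, Function.update_eq_self] at this
  exact this.mono (by omega)

/-- Copying the value of a variable to the auxiliary stack. -/
def copyAux (v : R) : StackProg (Stk R) :=
  seq (drain (.reg v) (push .tmp true) skip)
    (drain .tmp (seq (push (.reg v) true) (push .aux true)) skip)

theorem exec_drain_tmp_aux (v : R) (m : ℕ) :
    Exec (drain .tmp (seq (push (.reg v) true) (push .aux true)) skip)
      (store ρ i u o c (List.replicate m true) a)
      (store (update ρ v (ρ v + m)) i u o c [] (List.replicate m true ++ a)) (3 * m + 1) := by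
  induction m generalizing ρ a with
  | zero =>
    rw [Nat.add_zero, Function.update_eq_self]
    exact Exec.drainNil rfl
  | succ m ih =>
    refine (Exec.drainTrue (l := List.replicate m true) rfl
      (t := store (update ρ v (ρ v + 1)) i u o c (List.replicate m true) (true :: a))
      (n := 1 + 1) (m := 3 * m + 1) ?_ ?_).mono (by omega)
    · rw [update_store_tmp]
      exact Exec.seq (exec_push_reg v) exec_push_aux
    · have := ih (ρ := update ρ v (ρ v + 1)) (a := true :: a)
      rwa [Function.update_idem, Function.update_self, Nat.add_assoc, Nat.add_comm 1 m,
        replicate_append_cons] at this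

theorem exec_copyAux (v : R) : Exec (copyAux v) (store ρ i u o c [] a)
    (store ρ i u o c [] (List.replicate (ρ v) true ++ a)) (5 * ρ v + 2) := by
  have := Exec.seq (exec_drain_reg_tmp (ρ := ρ) (i := i) (u := u) (o := o) (c := c) (t := [])
    (a := a) v _ rfl) (by rw [List.append_nil]; exact exec_drain_tmp_aux v _)
  rw [Function.update_idem, Function.update_self, Nat.zero_add, Function.update_eq_self] at this
  exact this.mono (by omega)

/-- Repeating a program as often as the counter on the stack of counters says. -/
theorem exec_while_cnt {p : StackProg (Stk R)} {C m : ℕ} (ρ' : ℕ → R → ℕ)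
    (i' u' o' a' : ℕ → List Bool)
    (hp : ∀ k < m, ∀ c, Exec p (store (ρ' k) (i' k) (u' k) (o' k) c [] (a' k))
      (store (ρ' (k + 1)) (i' (k + 1)) (u' (k + 1)) (o' (k + 1)) c [] (a' (k + 1))) C) (c) :
    Exec (whilePop .cnt p skip)
      (store (ρ' 0) (i' 0) (u' 0) (o' 0) (List.replicate m true ++ false :: c) [] (a' 0))
      (store (ρ' m) (i' m) (u' m) (o' m) c [] (a' m)) ((C + 1) * m + 2) := by
  induction m generalizing ρ' i' u' o' a' with
  | zero =>
    refine Exec.whileFalse (l := c) rfl ?_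
    rw [update_store_cnt]
    exact Exec.skip _
  | succ m ih =>
    refine (Exec.whileTrue (k := Stk.cnt) (l := List.replicate m true ++ false :: c) rfl ?_
      (ih (fun k => ρ' (k + 1)) (fun k => i' (k + 1)) (fun k => u' (k + 1))
        (fun k => o' (k + 1)) (fun k => a' (k + 1))
        fun k hk c => hp (k + 1) (by omega) c)).mono
      (by ring_nf; omega)
    rw [update_store_cnt]
    exact hp 0 (by omega) _

end StackProg

namespace Cmd

open StackProg

variable {R : Type} [DecidableEq R]

/-- The stack program that executes a transducer.  The part of the input that has been read is
kept, and the output is written in reverse. -/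
def toStackProg : Cmd R → StackProg (Stk R)
  | nil => skip
  | lit b => push .out b
  | seq c d => .seq c.toStackProg d.toStackProg
  | oneHot N x =>
    .seq (push .aux false) <| .seq (copyAux x) <| .seq (push .cnt false) <| .seq (copyCnt N) <|
    .seq (whilePop .cnt (casePop .aux (push .out false) (push .out false) (push .out true)) skip)
      (drain .aux skip skip)
  | loop v r c =>
    .seq (saveReg v) <| .seq (push .cnt false) <| .seq (copyCnt r) <|
    .seq (whilePop .cnt (.seq c.toStackProg (push (.reg v) true)) skip) (restoreReg v)
  | readNat x c =>
    .seq (saveReg x) <|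
    .seq (whilePop .inp (.seq (push .used true) (push (.reg x) true)) (push .used false)) <|
    .seq c.toStackProg (restoreReg x)
  | readBit c d =>
    casePop .inp d.toStackProg (.seq (push .used true) c.toStackProg)
      (.seq (push .used false) d.toStackProg)
  | succ x y c =>
    .seq (saveReg x) <| .seq (push .cnt false) <| .seq (copyCnt y) <|
    .seq (whilePop .cnt (push (.reg x) true) skip) <| .seq (push (.reg x) true) <|
    .seq c.toStackProg (restoreReg x)
  | countFalse x c =>
    .seq (saveReg x) <|
    .seq (drain .inp (push .used true) (.seq (push .used false) (push (.reg x) true))) <|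
    .seq (casePop (.reg x) skip skip skip) <|
    .seq c.toStackProg (restoreReg x)
  | rewind => drain .used (push .inp true) (push .inp false)

/-- The part of the input `full` that has been read when `i` is left, last bit first. -/
def readPart (full i : List Bool) : List Bool := (full.take (full.length - i.length)).reverse

theorem readPart_self (full : List Bool) : readPart full full = [] := by simp [readPart]

theorem readPart_cons {full i : List Bool} {b : Bool} (h : b :: i <:+ full) :
    readPart full i = b :: readPart full (b :: i) := by
  obtain ⟨p, rfl⟩ := h
  simp only [readPart, List.length_append, List.length_cons]
  rw [show p.length + (i.length + 1) - i.length = p.length + 1 by omega,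
    show p.length + (i.length + 1) - (i.length + 1) = p.length by omega]
  simp [List.take_append]

theorem reverse_readPart {full i : List Bool} (h : i <:+ full) :
    (readPart full i).reverse ++ i = full := by
  obtain ⟨p, rfl⟩ := h
  simp [readPart]

theorem suffix_of_cons {full i : List Bool} {b : Bool} (h : b :: i <:+ full) : i <:+ full :=
  (List.suffix_cons b i).trans h

theorem exec_readNat_loop {ρ : R → ℕ} {full i o c : List Bool} (x : R) (hi : i <:+ full) :
    (i.dropWhile id).tail <:+ full ∧
    Exec (whilePop .inp (.seq (push .used true) (push (.reg x) true)) (push .used false))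
      (store ρ i (readPart full i) o c [] [])
      (store (update ρ x (ρ x + (i.takeWhile id).length)) (i.dropWhile id).tail
        (readPart full (i.dropWhile id).tail) o c [] []) (3 * i.length + 2) := by
  induction i generalizing ρ with
  | nil =>
    refine ⟨hi, ?_⟩
    simp only [List.takeWhile_nil, List.length_nil, Nat.add_zero, Function.update_eq_self,
      List.dropWhile_nil, List.tail_nil]
    exact (Exec.whileNil rfl).mono (by omega)
  | cons b i ih =>
    have hi' := suffix_of_cons hi
    cases b with
    | false =>
      refine ⟨hi', ?_⟩
      simp only [List.takeWhile_cons, id, Bool.false_eq_true, if_false, List.length_nil,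
        Nat.add_zero, Function.update_eq_self, List.dropWhile_cons, List.tail_cons]
      refine (Exec.whileFalse (k := Stk.inp) (l := i) rfl ?_).mono (n := 1 + 1) (by omega)
      rw [update_store_inp, readPart_cons hi]
      exact exec_push_used
    | true =>
      obtain ⟨h1, h2⟩ := ih (ρ := update ρ x (ρ x + 1)) hi'
      refine ⟨h1, ?_⟩
      rw [Function.update_idem, Function.update_self, Nat.add_assoc, Nat.add_comm 1] at h2
      refine (Exec.whileTrue (k := Stk.inp) (l := i) rfl (n := 2) ?_ h2).mono
        (by simp only [List.length_cons]; omega)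
      rw [update_store_inp, readPart_cons hi]
      exact Exec.seq exec_push_used (exec_push_reg x)

theorem exec_countFalse_loop {ρ : R → ℕ} {full i o c : List Bool} (x : R) (hi : i <:+ full) :
    Exec (drain .inp (push .used true) (.seq (push .used false) (push (.reg x) true)))
      (store ρ i (readPart full i) o c [] [])
      (store (update ρ x (ρ x + i.count false)) [] (readPart full []) o c [] [])
      (3 * i.length + 1) := by
  induction i generalizing ρ with
  | nil =>
    rw [List.count_nil, Nat.add_zero, Function.update_eq_self]
    exact Exec.drainNil rfl
  | cons b i ih =>
    have hi' := suffix_of_cons hi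
    cases b with
    | false =>
      have h2 := ih (ρ := update ρ x (ρ x + 1)) hi'
      rw [Function.update_idem, Function.update_self, Nat.add_assoc, Nat.add_comm 1] at h2
      rw [List.count_cons_self]
      refine (Exec.drainFalse (k := Stk.inp) (l := i) rfl (n := 2) ?_ h2).mono
        (by simp only [List.length_cons]; omega)
      rw [update_store_inp, readPart_cons hi]
      exact Exec.seq exec_push_used (exec_push_reg x)
    | true =>
      rw [List.count_cons_of_ne (by simp)]
      refine (Exec.drainTrue (k := Stk.inp) (l := i) rfl (n := 1) ?_ (ih hi')).mono
        (by simp only [List.length_cons]; omega)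
      rw [update_store_inp, readPart_cons hi]
      exact exec_push_used

theorem exec_decReg {ρ : R → ℕ} {i u o c t a : List Bool} (x : R) :
    Exec (casePop (.reg x) skip skip skip) (store ρ i u o c t a)
      (store (update ρ x (ρ x - 1)) i u o c t a) 2 := by
  rcases h : ρ x with _ | m
  · rw [Nat.zero_sub, ← h, Function.update_eq_self]
    exact Exec.caseNone (by simp [store, h]) (Exec.skip _)
  · refine Exec.caseTrue (l := List.replicate m true) (by simp [store, h, List.replicate_succ]) ?_
    rw [update_store_reg]
    exact Exec.skip _

theorem exec_rewind {ρ : R → ℕ} (u i o c : List Bool) :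
    Exec (drain .used (push .inp true) (push .inp false)) (store ρ i u o c [] [])
      (store ρ (u.reverse ++ i) [] o c [] []) (2 * u.length + 1) := by
  induction u generalizing i with
  | nil => exact Exec.drainNil rfl
  | cons b u ih =>
    have h := ih (b :: i)
    rw [show u.reverse ++ b :: i = (b :: u).reverse ++ i by simp] at h
    cases b with
    | true =>
      refine (Exec.drainTrue (k := Stk.used) (l := u) rfl (n := 1) ?_ h).mono
        (by simp only [List.length_cons]; omega)
      rw [update_store_used]
      exact exec_push_inp
    | false =>
      refine (Exec.drainFalse (k := Stk.used) (l := u) rfl (n := 1) ?_ h).mono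
        (by simp only [List.length_cons]; omega)
      rw [update_store_used]
      exact exec_push_inp

theorem exec_drain_aux {ρ : R → ℕ} {i u o c a : List Bool} :
    Exec (drain .aux skip skip) (store ρ i u o c [] a) (store ρ i u o c [] [])
      (2 * a.length + 1) := by
  induction a with
  | nil => exact Exec.drainNil rfl
  | cons b a ih =>
    cases b with
    | true =>
      refine (Exec.drainTrue (k := Stk.aux) (l := a) rfl (n := 1) ?_ ih).mono
        (by simp only [List.length_cons]; omega)
      rw [update_store_aux]
      exact Exec.skip _
    | false =>
      refine (Exec.drainFalse (k := Stk.aux) (l := a) rfl (n := 1) ?_ ih).mono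
        (by simp only [List.length_cons]; omega)
      rw [update_store_aux]
      exact Exec.skip _

/-- The loop of `oneHot`: the auxiliary stack holds `x` bits `true` above one bit `false`, so that
its top is `false` exactly in step `x`. -/
theorem exec_oneHot_loop {ρ : R → ℕ} {i u o c : List Bool} (x m : ℕ) :
    Exec (whilePop .cnt (casePop .aux (push .out false) (push .out false) (push .out true)) skip)
      (store ρ i u o (List.replicate m true ++ false :: c) [] (List.replicate x true ++ [false]))
      (store ρ i u (((List.range m).map fun k => decide (k = x)).reverse ++ o) c []
        ((List.replicate x true ++ [false]).drop m)) (3 * m + 2) := by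
  have h := exec_while_cnt
    (p := casePop .aux (push .out false) (push .out false) (push .out true)) (C := 2) (m := m)
    (fun _ => ρ) (fun _ => i) (fun _ => u)
    (fun k => ((List.range k).map fun k => decide (k = x)).reverse ++ o)
    (fun k => (List.replicate x true ++ [false]).drop k) (fun k _ c => ?_) c
  · simpa using h
  · simp only [List.range_succ, List.map_append, List.reverse_append, List.map_cons, List.map_nil,
      List.reverse_cons, List.reverse_nil, List.nil_append, List.cons_append]
    rcases lt_trichotomy k x with hk | hk | hk
    · have e : (List.replicate x true ++ [false]).drop k =
          true :: (List.replicate x true ++ [false]).drop (k + 1) := by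
        rw [List.drop_append_of_le_length (by simp; omega),
          List.drop_append_of_le_length (by simp; omega)]
        simp only [List.drop_replicate]
        rw [show x - k = (x - (k + 1)) + 1 by omega, List.replicate_succ]
        rfl
      refine Exec.caseTrue (l := (List.replicate x true ++ [false]).drop (k + 1)) e ?_
      rw [update_store_aux, show decide (k = x) = false by simp; omega]
      exact exec_push_out
    · subst hk
      have e : (List.replicate k true ++ [false]).drop k = [false] := by
        rw [List.drop_append_of_le_length (by simp)]
        simp
      have e' : (List.replicate k true ++ [false]).drop (k + 1) = [] := by simp
      refine Exec.caseFalse (l := []) e ?_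
      rw [update_store_aux, show decide (k = k) = true by simp, e']
      exact exec_push_out
    · have e : (List.replicate x true ++ [false]).drop k = [] := by simp; omega
      have e' : (List.replicate x true ++ [false]).drop (k + 1) = [] := by simp; omega
      refine Exec.caseNone e ?_
      rw [show decide (k = x) = false by simp; omega, e', e]
      exact exec_push_out

end Cmd
end PMC

namespace PMC
open Function (update)
/-! ### Polynomial time bounds -/

namespace Cmd

open StackProg

variable {R : Type} [DecidableEq R]

/-- `Bounded c P`: if all variables and the length of the input are at most `B`, then the stack
program of `c` computes `c.run` in at most `P.eval B` steps, and `c` writes at most `P.eval B`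
bits. -/
def Bounded (c : Cmd R) (P : Polynomial ℕ) : Prop :=
  ∀ (B : ℕ) (ρ : R → ℕ) (full i o k : List Bool), (∀ r, ρ r ≤ B) → full.length ≤ B → i <:+ full →
    (c.run ρ full i).2 <:+ full ∧ (c.run ρ full i).1.length ≤ P.eval B ∧
    Exec c.toStackProg (store ρ i (readPart full i) o k [] [])
      (store ρ (c.run ρ full i).2 (readPart full (c.run ρ full i).2)
        ((c.run ρ full i).1.reverse ++ o) k [] []) (P.eval B)

theorem le_update {ρ : R → ℕ} {B k : ℕ} (h : ∀ r, ρ r ≤ B) (hk : k ≤ B) (x : R) :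
    ∀ r, update ρ x k r ≤ B := by
  intro r
  by_cases hr : r = x
  · subst hr; simpa using hk
  · simpa [hr] using h r

theorem exists_bounded (c : Cmd R) : ∃ P, Bounded c P := by
  induction c with
  | nil =>
    refine ⟨1, fun B ρ full i o k hρ hfull hi => ⟨hi, by simp [run], ?_⟩⟩
    simpa [run, toStackProg] using Exec.skip _
  | lit b =>
    refine ⟨1, fun B ρ full i o k hρ hfull hi => ⟨hi, by simp [run], ?_⟩⟩
    simpa [run, toStackProg] using exec_push_out
  | seq c d ihc ihd =>
    obtain ⟨P, hP⟩ := ihc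
    obtain ⟨Q, hQ⟩ := ihd
    refine ⟨P + Q, fun B ρ full i o k hρ hfull hi => ?_⟩
    obtain ⟨h1, h2, h3⟩ := hP B ρ full i o k hρ hfull hi
    obtain ⟨h4, h5, h6⟩ := hQ B ρ full _ ((c.run ρ full i).1.reverse ++ o) k hρ hfull h1
    refine ⟨h4, ?_, ?_⟩
    · simp only [run, List.length_append, Polynomial.eval_add]; omega
    · have := Exec.seq h3 h6
      simpa [run, toStackProg] using this
  | oneHot N x =>
    refine ⟨15 * Polynomial.X + 15, fun B ρ full i o k hρ hfull hi => ⟨hi, ?_, ?_⟩⟩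
    · have := hρ N
      simp [run]; omega
    · have h1 : Exec (push .aux false) (store ρ i (readPart full i) o k [] []) _ 1 := exec_push_aux
      have h2 := exec_copyAux (ρ := ρ) (i := i) (u := readPart full i) (o := o) (c := k)
        (a := [false]) x
      have h3 : Exec (push .cnt false) (store ρ i (readPart full i) o k []
        (List.replicate (ρ x) true ++ [false])) _ 1 := exec_push_cnt
      have h4 := exec_copyCnt (ρ := ρ) (i := i) (u := readPart full i) (o := o) (c := false :: k)
        (a := List.replicate (ρ x) true ++ [false]) N
      have h5 := exec_oneHot_loop (ρ := ρ) (i := i) (u := readPart full i) (o := o) (c := k)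
        (ρ x) (ρ N)
      have h6 := exec_drain_aux (ρ := ρ) (i := i) (u := readPart full i)
        (o := ((List.range (ρ N)).map fun k => decide (k = ρ x)).reverse ++ o) (c := k)
        (a := (List.replicate (ρ x) true ++ [false]).drop (ρ N))
      refine (h1.seq <| h2.seq <| h3.seq <| h4.seq <| h5.seq h6).mono ?_
      have := hρ N
      have := hρ x
      simp
      omega
  | loop v r c ih =>
    obtain ⟨P, hP⟩ := ih
    refine ⟨(P + 20) * (Polynomial.X + 1), fun B ρ full i o k hρ hfull hi => ?_⟩
    set q : ℕ → List Bool × List Bool := fun m => Nat.rec ([], i)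
      (fun k p => (p.1 ++ (c.run (update ρ v k) full p.2).1, (c.run (update ρ v k) full p.2).2)) m
      with hq
    set m := update ρ v 0 r with hm
    have hmB : m ≤ B := le_update hρ (Nat.zero_le _) v r
    have hrun : (loop v r c).run ρ full i = q m := rfl
    have hq0 : q 0 = ([], i) := rfl
    have hqs : ∀ k, q (k + 1) = ((q k).1 ++ (c.run (update ρ v k) full (q k).2).1,
        (c.run (update ρ v k) full (q k).2).2) := fun k => rfl
    have hsuf : ∀ k ≤ m, (q k).2 <:+ full ∧ (q k).1.length ≤ P.eval B * k := by
      intro k hk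
      induction k with
      | zero => simpa [hq0] using hi
      | succ k ih =>
        obtain ⟨h1, h2⟩ := ih (by omega)
        obtain ⟨h3, h4, -⟩ := hP B (update ρ v k) full (q k).2 [] []
          (le_update hρ (by omega) v) hfull h1
        rw [hqs]
        refine ⟨h3, ?_⟩
        rw [List.length_append, Nat.mul_succ]
        omega
    rw [hrun]
    refine ⟨(hsuf m le_rfl).1, (hsuf m le_rfl).2.trans ?_, ?_⟩
    · simp only [Polynomial.eval_add, Polynomial.eval_mul, Polynomial.eval_X, Polynomial.eval_one,
        Polynomial.eval_ofNat]
      gcongr <;> omega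
    · have h1 := exec_saveReg (ρ := ρ) (i := i) (u := readPart full i) (o := o) (c := k)
        (t := []) (a := []) v
      have h2 : Exec (push .cnt false) (store (update ρ v 0) i (readPart full i) o
        (List.replicate (ρ v) true ++ false :: k) [] []) _ 1 := exec_push_cnt
      have h3 := exec_copyCnt (ρ := update ρ v 0) (i := i) (u := readPart full i) (o := o)
        (c := false :: (List.replicate (ρ v) true ++ false :: k)) (a := []) r
      have h4 := exec_while_cnt (p := .seq c.toStackProg (push (.reg v) true)) (C := P.eval B + 1)
        (m := m) (fun k => update ρ v k) (fun k => (q k).2) (fun k => readPart full (q k).2)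
        (fun k => (q k).1.reverse ++ o) (fun k => []) (fun k hk c' => ?_)
        (List.replicate (ρ v) true ++ false :: k)
      · have h5 := exec_restoreReg (ρ := update ρ v m) (i := (q m).2)
          (u := readPart full (q m).2) (o := (q m).1.reverse ++ o) (c := k) (t := []) (a := [])
          v (ρ v)
        rw [Function.update_idem, Function.update_eq_self, Function.update_self] at h5
        refine (h1.seq <| h2.seq <| h3.seq <| h4.seq h5).mono ?_
        rw [← hm]
        have hv := hρ v
        have : (P.eval B + 1 + 1) * m ≤ (P.eval B + 2) * B := by gcongr
        simp only [Polynomial.eval_add, Polynomial.eval_mul, Polynomial.eval_X,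
          Polynomial.eval_one, Polynomial.eval_ofNat]
        nlinarith
      · obtain ⟨-, -, h⟩ := hP B (update ρ v k) full (q k).2 ((q k).1.reverse ++ o) c'
          (le_update hρ (by omega) v) hfull (hsuf k hk.le).1
        have := h.seq (exec_push_reg v)
        rw [Function.update_idem, Function.update_self] at this
        rw [hqs]
        simpa using this
  | readNat x c ih =>
    obtain ⟨P, hP⟩ := ih
    refine ⟨P + 10 * Polynomial.X + 10, fun B ρ full i o k hρ hfull hi => ?_⟩
    have hiB : i.length ≤ B := hi.length_le.trans hfull
    have hkB : (i.takeWhile id).length ≤ B := (List.takeWhile_prefix _).length_le.trans hiB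
    obtain ⟨hs, hl⟩ := exec_readNat_loop (ρ := update ρ x 0) (o := o)
      (c := List.replicate (ρ x) true ++ false :: k) x hi
    rw [Function.update_idem, Function.update_self, Nat.zero_add] at hl
    obtain ⟨h1, h2, h3⟩ := hP B (update ρ x (i.takeWhile id).length) full (i.dropWhile id).tail
      o (List.replicate (ρ x) true ++ false :: k) (le_update hρ hkB x) hfull hs
    refine ⟨h1, h2.trans (by simp; omega), ?_⟩
    have h5 := exec_restoreReg (ρ := update ρ x (i.takeWhile id).length)
      (i := (c.run (update ρ x (i.takeWhile id).length) full (i.dropWhile id).tail).2)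
      (u := readPart full (c.run (update ρ x (i.takeWhile id).length) full
        (i.dropWhile id).tail).2)
      (o := (c.run (update ρ x (i.takeWhile id).length) full (i.dropWhile id).tail).1.reverse ++ o)
      (c := k) (t := []) (a := []) x (ρ x)
    rw [Function.update_idem, Function.update_eq_self, Function.update_self] at h5
    refine ((exec_saveReg x).seq <| hl.seq <| h3.seq h5).mono ?_
    have := hρ x
    simp
    omega
  | readBit c d ihc ihd =>
    obtain ⟨P, hP⟩ := ihc
    obtain ⟨Q, hQ⟩ := ihd
    refine ⟨P + Q + 2, fun B ρ full i o k hρ hfull hi => ?_⟩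
    match i with
    | [] =>
      obtain ⟨h1, h2, h3⟩ := hQ B ρ full [] o k hρ hfull hi
      exact ⟨h1, h2.trans (by simp; omega), (Exec.caseNone rfl h3).mono (by simp; omega)⟩
    | true :: i =>
      obtain ⟨h1, h2, h3⟩ := hP B ρ full i o k hρ hfull (suffix_of_cons hi)
      refine ⟨h1, h2.trans (by simp; omega), ?_⟩
      refine (Exec.caseTrue (k := Stk.inp) (l := i) rfl (n := 1 + P.eval B) ?_).mono
        (by simp; omega)
      rw [update_store_inp]
      rw [readPart_cons hi] at h3
      exact exec_push_used.seq h3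
    | false :: i =>
      obtain ⟨h1, h2, h3⟩ := hQ B ρ full i o k hρ hfull (suffix_of_cons hi)
      refine ⟨h1, h2.trans (by simp; omega), ?_⟩
      refine (Exec.caseFalse (k := Stk.inp) (l := i) rfl (n := 1 + Q.eval B) ?_).mono
        (by simp; omega)
      rw [update_store_inp]
      rw [readPart_cons hi] at h3
      exact exec_push_used.seq h3
  | succ x y c ih =>
    obtain ⟨P, hP⟩ := ih
    refine ⟨P.comp (Polynomial.X + 1) + 20 * Polynomial.X + 20,
      fun B ρ full i o k hρ hfull hi => ?_⟩
    set m := update ρ x 0 y with hm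
    have hmB : m ≤ B := le_update hρ (Nat.zero_le _) x y
    obtain ⟨h1, h2, h3⟩ := hP (B + 1) (update ρ x (m + 1)) full i
      o (List.replicate (ρ x) true ++ false :: k)
      (le_update (fun r => (hρ r).trans (Nat.le_succ B)) (by omega) x) (by omega) hi
    refine ⟨h1, h2.trans (by simp; omega), ?_⟩
    have hw := exec_while_cnt_reg (ρ := update ρ x 0) (i := i) (u := readPart full i) (o := o)
      (c := List.replicate (ρ x) true ++ false :: k) (t := []) (a := []) x m
    rw [Function.update_idem, Function.update_self, Nat.zero_add] at hw
    have hp := exec_push_reg (ρ := update ρ x m) (i := i) (u := readPart full i) (o := o)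
      (c := List.replicate (ρ x) true ++ false :: k) (t := []) (a := []) x
    rw [Function.update_idem, Function.update_self] at hp
    have h5 := exec_restoreReg (ρ := update ρ x (m + 1))
      (i := (c.run (update ρ x (m + 1)) full i).2)
      (u := readPart full (c.run (update ρ x (m + 1)) full i).2)
      (o := (c.run (update ρ x (m + 1)) full i).1.reverse ++ o)
      (c := k) (t := []) (a := []) x (ρ x)
    rw [Function.update_idem, Function.update_eq_self, Function.update_self] at h5
    refine ((exec_saveReg x).seq <| exec_push_cnt.seq <| (exec_copyCnt y).seq <|
      hw.seq <| hp.seq <| h3.seq h5).mono ?_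
    have := hρ x
    rw [← hm]
    simp
    omega
  | countFalse x c ih =>
    obtain ⟨P, hP⟩ := ih
    refine ⟨P + 20 * Polynomial.X + 20, fun B ρ full i o k hρ hfull hi => ?_⟩
    have hiB : i.length ≤ B := hi.length_le.trans hfull
    have hkB : i.count false ≤ B := List.count_le_length.trans hiB
    have hl := exec_countFalse_loop (ρ := update ρ x 0) (o := o)
      (c := List.replicate (ρ x) true ++ false :: k) x hi
    rw [Function.update_idem, Function.update_self, Nat.zero_add] at hl
    have hd := exec_decReg (ρ := update ρ x (i.count false)) (i := []) (u := readPart full [])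
      (o := o) (c := List.replicate (ρ x) true ++ false :: k) (t := []) (a := []) x
    rw [Function.update_idem, Function.update_self] at hd
    obtain ⟨h1, h2, h3⟩ := hP B (update ρ x (i.count false - 1)) full []
      o (List.replicate (ρ x) true ++ false :: k) (le_update hρ (by omega) x) hfull
      List.nil_suffix
    refine ⟨h1, h2.trans (by simp; omega), ?_⟩
    have h5 := exec_restoreReg (ρ := update ρ x (i.count false - 1))
      (i := (c.run (update ρ x (i.count false - 1)) full []).2)
      (u := readPart full (c.run (update ρ x (i.count false - 1)) full []).2)
      (o := (c.run (update ρ x (i.count false - 1)) full []).1.reverse ++ o)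
      (c := k) (t := []) (a := []) x (ρ x)
    rw [Function.update_idem, Function.update_eq_self, Function.update_self] at h5
    refine ((exec_saveReg x).seq <| hl.seq <| hd.seq <| h3.seq h5).mono ?_
    have := hρ x
    simp
    omega
  | rewind =>
    refine ⟨2 * Polynomial.X + 2, fun B ρ full i o k hρ hfull hi =>
      ⟨List.suffix_rfl, by simp [run], ?_⟩⟩
    have h := exec_rewind (ρ := ρ) (readPart full i) i o k
    rw [reverse_readPart hi] at h
    simp only [run, readPart_self, List.reverse_nil, List.nil_append]
    refine h.mono ?_
    have : (readPart full i).length ≤ full.length := by simp [readPart]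
    simp
    omega

/-- Moving the output to the result stack, in the right order, and emptying the input. -/
def finish : StackProg (Stk R) :=
  .seq (drain .inp skip skip) <| .seq (drain .used skip skip) <|
    drain .out (push .res true) (push .res false)

theorem exec_drain_skip {K : Type} [DecidableEq K] (k : K) (l : List Bool) (s : K → List Bool)
    (h : s k = l) : Exec (drain k skip skip) s (update s k []) (2 * l.length + 1) := by
  induction l generalizing s with
  | nil =>
    rw [show update s k [] = s by rw [← h, Function.update_eq_self]]
    exact Exec.drainNil h
  | cons b l ih =>
    have := ih (update s k l) (by simp)
    rw [Function.update_idem] at this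
    cases b with
    | true =>
      exact (Exec.drainTrue h (Exec.skip _) this).mono (by simp only [List.length_cons]; omega)
    | false =>
      exact (Exec.drainFalse h (Exec.skip _) this).mono (by simp only [List.length_cons]; omega)

theorem exec_drain_push {K : Type} [DecidableEq K] (k k' : K) (hk : k ≠ k') (l : List Bool)
    (s : K → List Bool) (h : s k = l) :
    Exec (drain k (push k' true) (push k' false)) s
      (update (update s k []) k' (l.reverse ++ s k')) (2 * l.length + 1) := by
  induction l generalizing s with
  | nil =>
    rw [show update s k [] = s by rw [← h, Function.update_eq_self], List.reverse_nil,
      List.nil_append, Function.update_eq_self]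
    exact Exec.drainNil h
  | cons b l ih =>
    have := ih (update (update s k l) k' (b :: s k')) (by simp [hk])
    have e : update (update (update (update s k l) k' (b :: s k')) k []) k'
        (l.reverse ++ update (update s k l) k' (b :: s k') k') =
        update (update s k []) k' ((b :: l).reverse ++ s k') := by
      rw [Function.update_self, Function.update_comm hk.symm, Function.update_idem,
        Function.update_idem]
      simp
    rw [e] at this
    have hp : Exec (push k' b) (update s k l) (update (update s k l) k' (b :: s k')) 1 := by
      have := Exec.push (update s k l) k' b
      rwa [Function.update_of_ne hk.symm] at this
    cases b with
    | true => exact (Exec.drainTrue h hp this).mono (by simp only [List.length_cons]; omega)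
    | false => exact (Exec.drainFalse h hp this).mono (by simp only [List.length_cons]; omega)

/-- A function that is computed on encodings by a transducer is computable in polynomial time. -/
theorem nonempty_computableInPolyTime [Fintype R] {α β : Type} {ea : α → List Bool}
    {eb : β → List Bool} {f : α → β} (c : Cmd R)
    (h : ∀ a, (c.run (fun _ => 0) (ea a) (ea a)).1 = eb (f a)) :
    Nonempty (Turing.TM2ComputableInPolyTime ea eb f) := by
  obtain ⟨P, hP⟩ := c.exists_bounded
  refine StackProg.nonempty_computableInPolyTime (K := Stk R)
    (.seq c.toStackProg finish) .inp .res (3 * P + 4 * Polynomial.X + 10) fun a => ?_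
  obtain ⟨h1, h2, h3⟩ := hP (ea a).length (fun _ => 0) (ea a) (ea a) [] []
    (fun _ => Nat.zero_le _) le_rfl List.suffix_rfl
  rw [readPart_self, h a, List.append_nil] at h3
  have e1 : update (fun _ => []) (Stk.inp : Stk R) (ea a) =
      store (fun _ => 0) (ea a) [] [] [] [] [] := by
    funext k; cases k <;> rfl
  rw [e1]
  set i := (c.run (fun _ => 0) (ea a) (ea a)).2
  have h4 := exec_drain_skip (Stk.inp : Stk R) i
    (store (fun _ => 0) i (readPart (ea a) i) (eb (f a)).reverse [] [] []) rfl
  rw [update_store_inp] at h4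
  have h5 := exec_drain_skip (Stk.used : Stk R) (readPart (ea a) i)
    (store (fun _ => 0) [] (readPart (ea a) i) (eb (f a)).reverse [] [] []) rfl
  rw [update_store_used] at h5
  have h6 := exec_drain_push (Stk.out : Stk R) .res (by simp) (eb (f a)).reverse
    (store (fun _ => 0) [] [] (eb (f a)).reverse [] [] []) rfl
  have e2 : update (update (store (fun _ => 0) [] [] (eb (f a)).reverse [] [] []) Stk.out [])
      (Stk.res : Stk R) ((eb (f a)).reverse.reverse ++
        store (fun _ => 0) [] [] (eb (f a)).reverse [] [] [] (Stk.res : Stk R)) =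
      update (fun _ => []) Stk.res (eb (f a)) := by
    funext k; cases k <;> simp [store]
  rw [e2] at h6
  refine (h3.seq (h4.seq (h5.seq h6))).mono ?_
  have l1 : i.length ≤ (ea a).length := h1.length_le
  have l2 : (readPart (ea a) i).length ≤ (ea a).length := by simp [readPart]
  rw [h a] at h2
  simp only [List.length_reverse, Polynomial.eval_add, Polynomial.eval_mul, Polynomial.eval_X,
    Polynomial.eval_ofNat]
  omega

end Cmd
end PMC

namespace PMC
open Function (update)

/-! ### Stack symbols and control states of the reduction -/

/-- The part of a tape cell in one step: the head is elsewhere before and after it, it arrives at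
the cell, or it departs from the cell. -/
inductive Kind where
  | stay
  | arrive
  | depart

/-- Stack symbols: the bit `b` at position `j` of the address of a cell, the mark that ends a
block, and the content `cell k a b` of a cell in which the letter `a` is replaced by `b`. -/
inductive Sym (α : Type) where
  | bit : Bool → α → Sym α
  | mark : Sym α
  | cell : Kind → α → α → Sym α

/-- What an invisible check remembers of a cell: one bit of its address, or its letter and whether
the head is there. -/
inductive Memo (α : Type) where
  | addr : α → Bool → Memo α
  | cont : α → Bool → Memo α

/-- Control states.  The states up to `post` generate the stack content, the others check it. -/
inductive Ctl (α : Type) where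
  /-- `init first i`: the `i`-th letter of the input comes next; `first` holds before the first
  cell. -/
  | init : Bool → α → Ctl α
  /-- A block has been completed, and `q` is the state of the machine. -/
  | header : α → Ctl α
  /-- A triple for the state `q` and the letter `a` is to be chosen. -/
  | select : Bool → α → α → Ctl α
  /-- `pre right q a b`: the step replaces `a` by `b`, moves in the given direction and leads to
  the state `q`; neither of the two cells that the head leaves and enters has been reached. -/
  | pre : Bool → α → α → α → Ctl α
  /-- In a left move, the cell that the head enters has been pushed. -/
  | midL : α → α → α → Ctl α
  /-- In a right move, the cell that the head leaves has been pushed. -/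
  | midR : α → Ctl α
  /-- Both cells have been pushed. -/
  | post : α → Ctl α
  /-- The position of a check is to be chosen. -/
  | chk : Ctl α
  /-- `incr nonzero j`: the address of a cell is being read, its bit `j` comes next, and `nonzero`
  tells whether one of the bits read is `true`. -/
  | incr : Bool → α → Ctl α
  /-- The bit `j` of the address of the next cell should be `e`. -/
  | skip : α → Bool → Ctl α
  /-- The bit `j` of the address that comes next should be `e`. -/
  | comp : α → Bool → Ctl α
  /-- A mark has been read. -/
  | last : Ctl α
  /-- The address that comes next should have no bit `false`. -/
  | ones : Ctl α
  /-- The contents of a cell have been read, and one bit of its address is to be remembered. -/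
  | undecided : Ctl α
  /-- The rest of the block is skipped. -/
  | toMark : Memo α → Ctl α
  /-- A cell of the previous block is searched. -/
  | search : Memo α → Ctl α
  /-- The check has succeeded; the labelling of these states is the proposition `1`. -/
  | good : Ctl α
  /-- A comparison has failed. -/
  | bad : Ctl α

variable {α β : Type}

/-- Replace the indices and letters in a stack symbol. -/
def Sym.map (f : α → β) : Sym α → Sym β
  | .bit b j => .bit b (f j)
  | .mark => .mark
  | .cell k a b => .cell k (f a) (f b)

/-- Replace the index or the letter that is remembered. -/
def Memo.map (f : α → β) : Memo α → Memo β
  | .addr j b => .addr (f j) b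
  | .cont c h => .cont (f c) h

/-- Replace the indices, letters and states in a control state. -/
def Ctl.map (f : α → β) : Ctl α → Ctl β
  | .init u i => .init u (f i)
  | .header q => .header (f q)
  | .select u q a => .select u (f q) (f a)
  | .pre m q a b => .pre m (f q) (f a) (f b)
  | .midL q a b => .midL (f q) (f a) (f b)
  | .midR q => .midR (f q)
  | .post q => .post (f q)
  | .chk => .chk
  | .incr u j => .incr u (f j)
  | .skip j e => .skip (f j) e
  | .comp j e => .comp (f j) e
  | .last => .last
  | .ones => .ones
  | .undecided => .undecided
  | .toMark I => .toMark (I.map f)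
  | .search I => .search (I.map f)
  | .good => .good
  | .bad => .bad

/-- The control states in which the environment moves. -/
def Ctl.isEnv : Ctl α → Bool
  | .init _ _ => true
  | .header _ => true
  | .select u _ _ => !u
  | .pre _ _ _ _ => true
  | .midL _ _ _ => true
  | .midR _ => true
  | .post _ => true
  | .search _ => true
  | _ => false

/-! ### Binary codes of symbols and states -/

/-- `N` bits, `true` exactly at the position `o`, if any. -/
def field (N : ℕ) (o : Option ℕ) : List Bool := (List.range N).map fun k => decide (some k = o)

/-- A number that tells the shapes of stack symbols apart. -/
def Sym.tag : Sym α → ℕ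
  | .bit false _ => 0
  | .bit true _ => 1
  | .mark => 2
  | .cell .stay _ _ => 3
  | .cell .arrive _ _ => 4
  | .cell .depart _ _ => 5

/-- The position of an address bit. -/
def Sym.idx : Sym α → Option α
  | .bit _ j => some j
  | _ => none

/-- The letter of a cell before the step. -/
def Sym.fst : Sym α → Option α
  | .cell _ a _ => some a
  | _ => none

/-- The letter of a cell after the step. -/
def Sym.snd : Sym α → Option α
  | .cell _ _ b => some b
  | _ => none

/-- A number that tells the visible shapes of control states apart.  What is remembered is
invisible.  Moreover `toMark` looks like `undecided`, so that the environment does not see which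
address bit is remembered, nor whether one is; and `good` looks like `comp`, so that it does not see
whether the comparison has ended. -/
def Ctl.tag : Ctl α → ℕ
  | .init u _ => cond u 1 0
  | .header _ => 2
  | .select u _ _ => cond u 4 3
  | .pre m _ _ _ => cond m 6 5
  | .midL _ _ _ => 7
  | .midR _ => 8
  | .post _ => 9
  | .chk => 10
  | .incr u _ => cond u 12 11
  | .skip _ _ => 13
  | .comp _ _ => 14
  | .good => 14
  | .last => 15
  | .ones => 16
  | .undecided => 17
  | .toMark _ => 17
  | .search _ => 18
  | .bad => 19

/-- The state of the machine in a control state. -/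
def Ctl.st : Ctl α → Option α
  | .header q => some q
  | .select _ q _ => some q
  | .pre _ q _ _ => some q
  | .midL q _ _ => some q
  | .midR q => some q
  | .post q => some q
  | _ => none

/-- The letter that the step of the machine reads. -/
def Ctl.fst : Ctl α → Option α
  | .select _ _ a => some a
  | .pre _ _ a _ => some a
  | .midL _ a _ => some a
  | _ => none

/-- The letter that the step of the machine writes. -/
def Ctl.snd : Ctl α → Option α
  | .pre _ _ _ b => some b
  | .midL _ _ b => some b
  | _ => none

/-- The visible position in the input word or in an address. -/
def Ctl.pos : Ctl α → Option α
  | .init _ i => some i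
  | .incr _ j => some j
  | _ => none

/-- The position of the address bit that is remembered. -/
def Memo.idx : Memo α → Option α
  | .addr j _ => some j
  | _ => none

/-- The letter that is remembered. -/
def Memo.letter : Memo α → Option α
  | .cont c _ => some c
  | _ => none

/-- A number that tells the shapes of what is remembered apart. -/
def Memo.tag : Memo α → ℕ
  | .addr _ b => cond b 1 0
  | .cont _ h => cond h 3 2

/-- The invisible position in an address. -/
def Ctl.hidIdx : Ctl α → Option α
  | .skip j _ => some j
  | .comp j _ => some j
  | .toMark I => I.idx
  | .search I => I.idx
  | _ => none

/-- The invisible letter. -/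
def Ctl.hidLetter : Ctl α → Option α
  | .toMark I => I.letter
  | .search I => I.letter
  | _ => none

/-- A number that tells the invisible shapes of control states apart. -/
def Ctl.hidTag : Ctl α → ℕ
  | .skip _ e => cond e 1 0
  | .comp _ e => cond e 1 0
  | .toMark I => I.tag
  | .search I => I.tag
  | _ => 4

theorem Sym.ext_fields {s t : Sym α} (h : s.tag = t.tag) (h₁ : s.idx = t.idx) (h₂ : s.fst = t.fst)
    (h₃ : s.snd = t.snd) : s = t := by
  rcases s with ⟨_ | _, _⟩ | _ | ⟨_ | _ | _, _, _⟩ <;>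
    rcases t with ⟨_ | _, _⟩ | _ | ⟨_ | _ | _, _, _⟩ <;>
    simp_all [Sym.tag, Sym.idx, Sym.fst, Sym.snd]

theorem Memo.tag_lt (I : Memo α) : I.tag < 4 := by
  rcases I with ⟨_, _ | _⟩ | ⟨_, _ | _⟩ <;> simp [Memo.tag]

theorem Ctl.ext_fields {s t : Ctl α} (h : s.tag = t.tag) (h₁ : s.st = t.st) (h₂ : s.fst = t.fst)
    (h₃ : s.snd = t.snd) (h₄ : s.pos = t.pos) (h₅ : s.hidIdx = t.hidIdx)
    (h₆ : s.hidLetter = t.hidLetter) (h₇ : s.hidTag = t.hidTag) : s = t := by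
  rcases s with ⟨_ | _, _⟩ | _ | ⟨_ | _, _, _⟩ | ⟨_ | _, _, _, _⟩ | _ | _ | _ | _ | ⟨_ | _, _⟩ |
      ⟨_, _ | _⟩ | ⟨_, _ | _⟩ | _ | _ | _ | ⟨⟨_, _ | _⟩ | ⟨_, _ | _⟩⟩ |
      ⟨⟨_, _ | _⟩ | ⟨_, _ | _⟩⟩ | _ | _ <;>
    rcases t with ⟨_ | _, _⟩ | _ | ⟨_ | _, _, _⟩ | ⟨_ | _, _, _, _⟩ | _ | _ | _ | _ | ⟨_ | _, _⟩ |
      ⟨_, _ | _⟩ | ⟨_, _ | _⟩ | _ | _ | _ | ⟨⟨_, _ | _⟩ | ⟨_, _ | _⟩⟩ |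
      ⟨⟨_, _ | _⟩ | ⟨_, _ | _⟩⟩ | _ | _ <;>
    first
    | exact absurd h (Nat.ne_of_beq_eq_false rfl)
    | exact absurd h₇ (Nat.ne_of_beq_eq_false rfl)
    | simp_all [Ctl.st, Ctl.fst, Ctl.snd, Ctl.pos, Ctl.hidIdx, Ctl.hidLetter, Memo.idx, Memo.letter]

end PMC

namespace PMC
open Function (update)

/-- The set of the positions of `true` in a word. -/
def toSet (l : List Bool) : Finset ℕ :=
  (Finset.range l.length).filter fun i => l.getD i false = true

theorem encSet_toSet (l : List Bool) : encSet l.length (toSet l) = l := by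
  apply List.ext_getElem
  · simp [encSet]
  · intro i h₁ h₂
    simp [encSet, toSet, h₂]

theorem toSet_subset (l : List Bool) : toSet l ⊆ Finset.range l.length := Finset.filter_subset _ _

theorem toSet_injective {l r : List Bool} (hl : l.length = r.length) (h : toSet l = toSet r) :
    l = r := by
  rw [← encSet_toSet l, ← encSet_toSet r, h, hl]

theorem toSet_append_inter (l r : List Bool) :
    toSet (l ++ r) ∩ Finset.range l.length = toSet l := by
  ext i
  simp only [toSet, Finset.mem_inter, Finset.mem_filter, Finset.mem_range, List.length_append]
  constructor
  · rintro ⟨⟨-, h⟩, hi⟩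
    exact ⟨hi, by rwa [List.getD_append _ _ _ _ hi] at h⟩
  · rintro ⟨hi, h⟩
    exact ⟨⟨by omega, by rwa [List.getD_append _ _ _ _ hi]⟩, hi⟩

@[simp]
theorem length_field (N : ℕ) (o : Option ℕ) : (field N o).length = N := by simp [field]

theorem field_injective {N : ℕ} {o o' : Option ℕ} (ho : ∀ x ∈ o, x < N) (ho' : ∀ x ∈ o', x < N)
    (h : field N o = field N o') : o = o' := by
  have key : ∀ k < N, (some k = o ↔ some k = o') := by
    intro k hk
    have := congrArg (fun l : List Bool => l[k]?) h
    simpa [field, hk] using this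
  rcases o with _ | x
  · rcases o' with _ | y
    · rfl
    · exact ((key y (ho' y rfl)).2 rfl).symm
  · exact (key x (ho x rfl)).1 rfl

/-- The constants of an instance: zero, the sizes of the alphabet and of the state set, the blank,
the initial state, the length of the input word, and this length plus one. -/
inductive Base where
  | zero
  | nA
  | nQ
  | blank
  | q0
  | n
  | n1
  deriving DecidableEq

/-- Variables for loops. -/
inductive Var where
  | q
  | a
  | b
  | c
  | i
  | i1
  | j
  | x
  | y
  | z
  deriving DecidableEq

instance : Fintype Base := ⟨{.zero, .nA, .nQ, .blank, .q0, .n, .n1}, fun x => by cases x <;> simp⟩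

instance : Fintype Var :=
  ⟨{.q, .a, .b, .c, .i, .i1, .j, .x, .y, .z}, fun v => by cases v <;> simp⟩

/-- The variables of the transducers below. -/
abbrev Reg : Type := Base ⊕ Var

/-- The code of a stack symbol. -/
def Sym.code (β : Base → ℕ) (s : Sym ℕ) : List Bool :=
  field 6 (some s.tag) ++ (field (β .n) s.idx ++ (field (β .nA) s.fst ++ field (β .nA) s.snd))

/-- The visible part of the code of a control state. -/
def Ctl.visCode (β : Base → ℕ) (s : Ctl ℕ) : List Bool :=
  field 20 (some s.tag) ++ (field (β .nQ) s.st ++ (field (β .nA) s.fst ++ (field (β .nA) s.snd ++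
    field (β .n1) s.pos)))

/-- The invisible part of the code of a control state. -/
def Ctl.hidCode (β : Base → ℕ) (s : Ctl ℕ) : List Bool :=
  field (β .n) s.hidIdx ++ (field (β .nA) s.hidLetter ++ field 5 (some s.hidTag))

/-- The code of a control state. -/
def Ctl.code (β : Base → ℕ) (s : Ctl ℕ) : List Bool := s.visCode β ++ s.hidCode β

/-- The numbers in a stack symbol are within the bounds of the instance. -/
def Sym.InRange (β : Base → ℕ) (s : Sym ℕ) : Prop :=
  (∀ j ∈ s.idx, j < β .n) ∧ (∀ a ∈ s.fst, a < β .nA) ∧ ∀ b ∈ s.snd, b < β .nA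

/-- The numbers in a control state are within the bounds of the instance. -/
def Ctl.InRange (β : Base → ℕ) (s : Ctl ℕ) : Prop :=
  (∀ q ∈ s.st, q < β .nQ) ∧ (∀ a ∈ s.fst, a < β .nA) ∧ (∀ b ∈ s.snd, b < β .nA) ∧
    (∀ i ∈ s.pos, i < β .n1) ∧ (∀ j ∈ s.hidIdx, j < β .n) ∧ ∀ c ∈ s.hidLetter, c < β .nA

variable {β : Base → ℕ}

theorem Sym.length_code (s : Sym ℕ) : (s.code β).length = 6 + (β .n + (β .nA + β .nA)) := by
  simp [Sym.code]

theorem Ctl.length_visCode (s : Ctl ℕ) :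
    (s.visCode β).length = 20 + (β .nQ + (β .nA + (β .nA + β .n1))) := by
  simp [Ctl.visCode]

theorem Ctl.length_hidCode (s : Ctl ℕ) : (s.hidCode β).length = β .n + (β .nA + 5) := by
  simp [Ctl.hidCode]

theorem Sym.tag_lt (s : Sym ℕ) : s.tag < 6 := by
  rcases s with ⟨_ | _, _⟩ | _ | ⟨_ | _ | _, _, _⟩ <;> simp [Sym.tag]

theorem Ctl.tag_lt (s : Ctl ℕ) : s.tag < 20 := by
  rcases s with ⟨_ | _, _⟩ | _ | ⟨_ | _, _, _⟩ | ⟨_ | _, _, _, _⟩ | _ | _ | _ | _ | ⟨_ | _, _⟩ |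
    ⟨_, _ | _⟩ | ⟨_, _ | _⟩ | _ | _ | _ | _ | _ | _ | _ <;> simp [Ctl.tag]

theorem Ctl.hidTag_lt (s : Ctl ℕ) : s.hidTag < 5 := by
  rcases s with _ | _ | _ | _ | _ | _ | _ | _ | _ | ⟨_, _ | _⟩ | ⟨_, _ | _⟩ | _ | _ | _ |
    I | I | _ | _ <;> first | exact (Memo.tag_lt I).trans (by omega) | simp [Ctl.hidTag]

theorem field_some_injective {N x y : ℕ} (hx : x < N) (hy : y < N)
    (h : field N (some x) = field N (some y)) : x = y :=
  Option.some.inj (field_injective (by simpa using hx) (by simpa using hy) h)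

theorem Sym.code_injective {s t : Sym ℕ} (hs : s.InRange β) (ht : t.InRange β)
    (h : s.code β = t.code β) : s = t := by
  obtain ⟨s1, s2, s3⟩ := hs
  obtain ⟨t1, t2, t3⟩ := ht
  obtain ⟨h0, h⟩ := List.append_inj h (by simp)
  obtain ⟨h1, h⟩ := List.append_inj h (by simp)
  obtain ⟨h2, h3⟩ := List.append_inj h (by simp)
  exact Sym.ext_fields (field_some_injective s.tag_lt t.tag_lt h0) (field_injective s1 t1 h1)
    (field_injective s2 t2 h2) (field_injective s3 t3 h3)

theorem Ctl.visCode_eq_iff {s t : Ctl ℕ} (hs : s.InRange β) (ht : t.InRange β) :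
    s.visCode β = t.visCode β ↔
      s.tag = t.tag ∧ s.st = t.st ∧ s.fst = t.fst ∧ s.snd = t.snd ∧ s.pos = t.pos := by
  constructor
  · intro h
    obtain ⟨s1, s2, s3, s4, -⟩ := hs
    obtain ⟨t1, t2, t3, t4, -⟩ := ht
    obtain ⟨h0, h⟩ := List.append_inj h (by simp)
    obtain ⟨h1, h⟩ := List.append_inj h (by simp)
    obtain ⟨h2, h⟩ := List.append_inj h (by simp)
    obtain ⟨h3, h4⟩ := List.append_inj h (by simp)
    exact ⟨field_some_injective s.tag_lt t.tag_lt h0, field_injective s1 t1 h1,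
      field_injective s2 t2 h2, field_injective s3 t3 h3, field_injective s4 t4 h4⟩
  · rintro ⟨h0, h1, h2, h3, h4⟩
    simp only [Ctl.visCode, h0, h1, h2, h3, h4]

theorem Ctl.code_injective {s t : Ctl ℕ} (hs : s.InRange β) (ht : t.InRange β)
    (h : s.code β = t.code β) : s = t := by
  obtain ⟨h, h'⟩ := List.append_inj h (by simp [Ctl.length_visCode])
  obtain ⟨h0, h1, h2, h3, h4⟩ := (Ctl.visCode_eq_iff hs ht).1 h
  obtain ⟨-, -, -, -, s5, s6⟩ := hs
  obtain ⟨-, -, -, -, t5, t6⟩ := ht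
  obtain ⟨h5, h'⟩ := List.append_inj h' (by simp)
  obtain ⟨h6, h7⟩ := List.append_inj h' (by simp)
  exact Ctl.ext_fields h0 h1 h2 h3 h4 (field_injective s5 t5 h5) (field_injective s6 t6 h6)
    (field_some_injective s.hidTag_lt t.hidTag_lt h7)

/-- Whether the environment moves is visible. -/
theorem Ctl.isEnv_eq_of_tag_eq {s t : Ctl ℕ} (h : s.tag = t.tag) : s.isEnv = t.isEnv := by
  rcases s with ⟨_ | _, _⟩ | _ | ⟨_ | _, _, _⟩ | ⟨_ | _, _, _, _⟩ | _ | _ | _ | _ | ⟨_ | _, _⟩ |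
      _ | _ | _ | _ | _ | _ | _ | _ | _ <;>
    rcases t with ⟨_ | _, _⟩ | _ | ⟨_ | _, _, _⟩ | ⟨_ | _, _, _, _⟩ | _ | _ | _ | _ | ⟨_ | _, _⟩ |
      _ | _ | _ | _ | _ | _ | _ | _ | _ <;>
    first
    | rfl
    | exact absurd h (Nat.ne_of_beq_eq_false rfl)

/-! ### Families of items, given by nested loops -/

/-- A list of items, described by nested loops.  The items may contain the names of constants and
of loop variables. -/
inductive Fam (τ : Type) where
  | items : List τ → Fam τ
  | app : Fam τ → Fam τ → Fam τ
  /-- The variable ranges over the numbers below a constant. -/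
  | loop : Var → Base → Fam τ → Fam τ
  /-- `succ v r F` is `F` with `v = r + 1`. -/
  | succ : Var → Reg → Fam τ → Fam τ

namespace Fam

variable {τ σ : Type}

infixr:65 " ⊹ " => app

/-- The list that a family describes, where `I` interprets the items. -/
def den (I : (Reg → ℕ) → τ → σ) (β : Base → ℕ) : Fam τ → (Var → ℕ) → List σ
  | items l, η => l.map (I (Sum.elim β η))
  | app F G, η => F.den I β η ++ G.den I β η
  | loop v N F, η => (List.range (β N)).flatMap fun k => F.den I β (update η v k)
  | succ v r F, η => F.den I β (update η v (Sum.elim β (update η v 0) r + 1))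

/-- The transducer that runs through a family. -/
def cmd (E : τ → Cmd Reg) : Fam τ → Cmd Reg
  | items l => l.foldr (fun t c => (E t).seq c) .nil
  | app F G => (F.cmd E).seq (G.cmd E)
  | loop v N F => .loop (.inr v) (.inl N) (F.cmd E)
  | succ v r F => .succ (.inr v) r (F.cmd E)

/-- All bits of addresses. -/
def anyBit (F : Sym Reg → Fam τ) : Fam τ :=
  loop .x .n (F (.bit false (.inr .x)) ⊹ F (.bit true (.inr .x)))

/-- All contents of cells. -/
def anyCell (F : Kind → Reg → Reg → Fam τ) : Fam τ :=
  loop .y .nA (loop .z .nA (F .stay (.inr .y) (.inr .z) ⊹ (F .arrive (.inr .y) (.inr .z) ⊹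
    F .depart (.inr .y) (.inr .z))))

variable {I : (Reg → ℕ) → τ → σ} {η : Var → ℕ} {t : σ}

theorem mem_den_append {F G : Fam τ} :
    t ∈ (F ⊹ G).den I β η ↔ t ∈ F.den I β η ∨ t ∈ G.den I β η := List.mem_append

theorem mem_den_items {l : List τ} :
    t ∈ (items l).den I β η ↔ ∃ s ∈ l, I (Sum.elim β η) s = t := List.mem_map

theorem mem_den_loop {F : Fam τ} {v : Var} {N : Base} :
    t ∈ (loop v N F).den I β η ↔ ∃ k < β N, t ∈ F.den I β (update η v k) := by
  simp [den]

theorem mem_den_succ {F : Fam τ} {v : Var} {r : Reg} :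
    t ∈ (succ v r F).den I β η ↔ t ∈ F.den I β (update η v (Sum.elim β (update η v 0) r + 1)) :=
  Iff.rfl

theorem mem_den_anyBit {F : Sym Reg → Fam τ} :
    t ∈ (anyBit F).den I β η ↔
      ∃ k < β .n, ∃ b, t ∈ (F (.bit b (.inr .x))).den I β (update η .x k) := by
  simp [anyBit, mem_den_loop, mem_den_append]

theorem mem_den_anyCell {F : Kind → Reg → Reg → Fam τ} :
    t ∈ (anyCell F).den I β η ↔ ∃ a < β .nA, ∃ b < β .nA, ∃ k,
      t ∈ (F k (.inr .y) (.inr .z)).den I β (update (update η .y a) .z b) := by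
  simp only [anyCell, mem_den_loop, mem_den_append]
  constructor
  · rintro ⟨a, ha, b, hb, h | h | h⟩
    exacts [⟨a, ha, b, hb, _, h⟩, ⟨a, ha, b, hb, _, h⟩, ⟨a, ha, b, hb, _, h⟩]
  · rintro ⟨a, ha, b, hb, _ | _ | _, h⟩
    exacts [⟨a, ha, b, hb, .inl h⟩, ⟨a, ha, b, hb, .inr (.inl h)⟩, ⟨a, ha, b, hb, .inr (.inr h)⟩]

end Fam

end PMC

namespace PMC
open Function (update)
open Fam

set_option linter.unusedSimpArgs false

/-! ### The control states, stack symbols and transitions of the reduction -/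

/-- The interpretation of control states over names as control states over numbers. -/
def Ctl.sub (ρ : Reg → ℕ) (s : Ctl Reg) : Ctl ℕ := s.map ρ

/-- The interpretation of stack symbols over names as stack symbols over numbers. -/
def Sym.sub (ρ : Reg → ℕ) (g : Sym Reg) : Sym ℕ := g.map ρ

/-- The interpretation of push transitions over names. -/
def pushSub (ρ : Reg → ℕ) (t : Ctl Reg × Ctl Reg × Sym Reg) : Ctl ℕ × Ctl ℕ × Sym ℕ :=
  (t.1.map ρ, t.2.1.map ρ, t.2.2.map ρ)

/-- The interpretation of pop transitions over names. -/
def popSub (ρ : Reg → ℕ) (t : Ctl Reg × Option (Sym Reg) × Ctl Reg) :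
    Ctl ℕ × Option (Sym ℕ) × Ctl ℕ :=
  (t.1.map ρ, t.2.1.map (Sym.map ρ), t.2.2.map ρ)

/-- The interpretation of control states with a top of the stack over names. -/
def envSub (ρ : Reg → ℕ) (t : Ctl Reg × Option (Sym Reg)) : Ctl ℕ × Option (Sym ℕ) :=
  (t.1.map ρ, t.2.map (Sym.map ρ))

/-- All control states but `good`. -/
def ctlFam : Fam (Ctl Reg) :=
  loop .i .n1 (items [.init false (.inr .i), .init true (.inr .i), .incr false (.inr .i),
    .incr true (.inr .i)]) ⊹ (
  loop .q .nQ (items [.header (.inr .q), .post (.inr .q), .midR (.inr .q)] ⊹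
    loop .a .nA (items [.select false (.inr .q) (.inr .a), .select true (.inr .q) (.inr .a)] ⊹
      loop .b .nA (items [.pre false (.inr .q) (.inr .a) (.inr .b),
        .pre true (.inr .q) (.inr .a) (.inr .b), .midL (.inr .q) (.inr .a) (.inr .b)]))) ⊹ (
  items [.chk, .last, .ones, .undecided, .bad] ⊹ (
  loop .j .n (items [.skip (.inr .j) false, .skip (.inr .j) true, .comp (.inr .j) false,
    .comp (.inr .j) true, .toMark (.addr (.inr .j) false), .toMark (.addr (.inr .j) true),
    .search (.addr (.inr .j) false), .search (.addr (.inr .j) true)]) ⊹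
  loop .a .nA (items [.toMark (.cont (.inr .a) false), .toMark (.cont (.inr .a) true),
    .search (.cont (.inr .a) false), .search (.cont (.inr .a) true)]))))

/-- All stack symbols. -/
def symFam : Fam (Sym Reg) :=
  items [.mark] ⊹ (anyBit (fun s => items [s]) ⊹ anyCell fun k a b => items [.cell k a b])

/-- The push transitions that do not depend on the input word. -/
def pushFam : Fam (Ctl Reg × Ctl Reg × Sym Reg) :=
  anyBit (fun s =>
    loop .i .n1 (items [(.init false (.inr .i), .init false (.inr .i), s),
      (.init true (.inr .i), .init true (.inr .i), s)]) ⊹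
    loop .q .nQ (items [(.post (.inr .q), .post (.inr .q), s),
        (.midR (.inr .q), .midR (.inr .q), s)] ⊹
      loop .a .nA (loop .b .nA (items [
        (.pre false (.inr .q) (.inr .a) (.inr .b), .pre false (.inr .q) (.inr .a) (.inr .b), s),
        (.pre true (.inr .q) (.inr .a) (.inr .b), .pre true (.inr .q) (.inr .a) (.inr .b), s),
        (.midL (.inr .q) (.inr .a) (.inr .b), .midL (.inr .q) (.inr .a) (.inr .b), s)])))) ⊹ (
  loop .q .nQ (items [(.post (.inr .q), .header (.inr .q), .mark)] ⊹ (
    loop .c .nA (items [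
      (.midR (.inr .q), .post (.inr .q), .cell .arrive (.inr .c) (.inr .c)),
      (.post (.inr .q), .post (.inr .q), .cell .stay (.inr .c) (.inr .c))]) ⊹
    loop .a .nA (loop .b .nA (items [
        (.pre true (.inr .q) (.inr .a) (.inr .b), .midR (.inr .q),
          .cell .depart (.inr .a) (.inr .b)),
        (.midL (.inr .q) (.inr .a) (.inr .b), .post (.inr .q),
          .cell .depart (.inr .a) (.inr .b))] ⊹
      loop .c .nA (items [
        (.pre false (.inr .q) (.inr .a) (.inr .b), .pre false (.inr .q) (.inr .a) (.inr .b),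
          .cell .stay (.inr .c) (.inr .c)),
        (.pre true (.inr .q) (.inr .a) (.inr .b), .pre true (.inr .q) (.inr .a) (.inr .b),
          .cell .stay (.inr .c) (.inr .c)),
        (.pre false (.inr .q) (.inr .a) (.inr .b), .midL (.inr .q) (.inr .a) (.inr .b),
          .cell .arrive (.inr .c) (.inr .c))]))))) ⊹
  items [(.init false (.inl .n), .init false (.inl .n), .cell .stay (.inl .blank) (.inl .blank)),
    (.init false (.inl .n), .header (.inl .q0), .mark)])

/-- The pop transitions that start the checks, and those that check addresses. -/
def addrPopFam : Fam (Ctl Reg × Option (Sym Reg) × Ctl Reg) :=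
  items [(.chk, some .mark, .chk), (.chk, none, .good), (.chk, some .mark, .last),
    (.incr false (.inl .n), some .mark, .good), (.incr false (.inl .n), none, .good),
    (.ones, some .mark, .good), (.ones, none, .good)] ⊹ (
  anyBit (fun s => items [(.chk, some s, .chk)] ⊹
    loop .j .n (items [(.skip (.inr .j) false, some s, .skip (.inr .j) false),
      (.skip (.inr .j) true, some s, .skip (.inr .j) true),
      (.comp (.inr .j) false, some s, .comp (.inr .j) false),
      (.comp (.inr .j) true, some s, .comp (.inr .j) true)])) ⊹ (
  anyCell (fun k a b => items [(.chk, some (.cell k a b), .chk),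
      (.chk, some (.cell k a b), .incr false (.inl .zero)),
      (.chk, some (.cell k a b), .undecided),
      (.incr true (.inl .n), some (.cell k a b), .good),
      (.last, some (.cell k a b), .ones),
      (.ones, some (.cell k a b), .good)] ⊹
    loop .j .n (items [(.skip (.inr .j) false, some (.cell k a b), .comp (.inr .j) false),
      (.skip (.inr .j) true, some (.cell k a b), .comp (.inr .j) true),
      (.comp (.inr .j) false, some (.cell k a b), .good),
      (.comp (.inr .j) true, some (.cell k a b), .good)])) ⊹
  loop .j .n (items [
    (.incr false (.inr .j), some (.bit false (.inr .j)), .skip (.inr .j) true),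
    (.incr false (.inr .j), some (.bit true (.inr .j)), .skip (.inr .j) false),
    (.incr true (.inr .j), some (.bit false (.inr .j)), .skip (.inr .j) false),
    (.incr true (.inr .j), some (.bit true (.inr .j)), .skip (.inr .j) true),
    (.skip (.inr .j) false, some .mark, .good), (.skip (.inr .j) false, none, .good),
    (.skip (.inr .j) true, some .mark, .good), (.skip (.inr .j) true, none, .good),
    (.comp (.inr .j) false, some .mark, .good), (.comp (.inr .j) false, none, .good),
    (.comp (.inr .j) true, some .mark, .good), (.comp (.inr .j) true, none, .good),
    (.comp (.inr .j) false, some (.bit true (.inr .j)), .bad),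
    (.comp (.inr .j) true, some (.bit false (.inr .j)), .bad),
    (.ones, some (.bit true (.inr .j)), .ones)] ⊹
    succ .i1 (.inr .j) (items [
      (.incr false (.inr .j), some (.bit false (.inr .j)), .incr false (.inr .i1)),
      (.incr false (.inr .j), some (.bit true (.inr .j)), .incr true (.inr .i1)),
      (.incr true (.inr .j), some (.bit false (.inr .j)), .incr true (.inr .i1)),
      (.incr true (.inr .j), some (.bit true (.inr .j)), .incr true (.inr .i1))]))))

/-- The pop transitions that check the contents of a cell against the previous block. -/
def contPopFam : Fam (Ctl Reg × Option (Sym Reg) × Ctl Reg) :=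
  items [(.undecided, some .mark, .good), (.undecided, none, .good)] ⊹ (
  anyBit (fun s => items [(.undecided, some s, .undecided)] ⊹ (
    loop .j .n (items [(.toMark (.addr (.inr .j) false), some s, .toMark (.addr (.inr .j) false)),
      (.toMark (.addr (.inr .j) true), some s, .toMark (.addr (.inr .j) true)),
      (.search (.addr (.inr .j) false), some s, .search (.addr (.inr .j) false)),
      (.search (.addr (.inr .j) true), some s, .search (.addr (.inr .j) true))]) ⊹
    loop .c .nA (items [(.toMark (.cont (.inr .c) false), some s, .toMark (.cont (.inr .c) false)),
      (.toMark (.cont (.inr .c) true), some s, .toMark (.cont (.inr .c) true)),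
      (.search (.cont (.inr .c) false), some s, .search (.cont (.inr .c) false)),
      (.search (.cont (.inr .c) true), some s, .search (.cont (.inr .c) true))]))) ⊹ (
  anyCell (fun k a b => items [(.undecided, some (.cell k a b), .good)] ⊹ (
    loop .j .n (items [
      (.toMark (.addr (.inr .j) false), some (.cell k a b), .toMark (.addr (.inr .j) false)),
      (.toMark (.addr (.inr .j) true), some (.cell k a b), .toMark (.addr (.inr .j) true)),
      (.search (.addr (.inr .j) false), some (.cell k a b), .search (.addr (.inr .j) false)),
      (.search (.addr (.inr .j) true), some (.cell k a b), .search (.addr (.inr .j) true)),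
      (.search (.addr (.inr .j) false), some (.cell k a b), .comp (.inr .j) false),
      (.search (.addr (.inr .j) true), some (.cell k a b), .comp (.inr .j) true)]) ⊹
    loop .c .nA (items [
      (.toMark (.cont (.inr .c) false), some (.cell k a b), .toMark (.cont (.inr .c) false)),
      (.toMark (.cont (.inr .c) true), some (.cell k a b), .toMark (.cont (.inr .c) true)),
      (.search (.cont (.inr .c) false), some (.cell k a b), .search (.cont (.inr .c) false)),
      (.search (.cont (.inr .c) true), some (.cell k a b), .search (.cont (.inr .c) true))]))) ⊹ (
  loop .a .nA (loop .b .nA (items [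
      (.chk, some (.cell .stay (.inr .a) (.inr .b)), .toMark (.cont (.inr .a) false)),
      (.chk, some (.cell .arrive (.inr .a) (.inr .b)), .toMark (.cont (.inr .a) false)),
      (.chk, some (.cell .depart (.inr .a) (.inr .b)), .toMark (.cont (.inr .a) true)),
      (.search (.cont (.inr .b) false), some (.cell .stay (.inr .a) (.inr .b)), .good),
      (.search (.cont (.inr .b) true), some (.cell .arrive (.inr .a) (.inr .b)), .good),
      (.search (.cont (.inr .b) false), some (.cell .depart (.inr .a) (.inr .b)), .good)])) ⊹ (
  loop .c .nA (items [
      (.toMark (.cont (.inr .c) false), some .mark, .search (.cont (.inr .c) false)),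
      (.toMark (.cont (.inr .c) true), some .mark, .search (.cont (.inr .c) true)),
      (.toMark (.cont (.inr .c) false), none, .good),
      (.toMark (.cont (.inr .c) true), none, .good)]) ⊹
  loop .j .n (items [
    (.undecided, some (.bit false (.inr .j)), .toMark (.addr (.inr .j) false)),
    (.undecided, some (.bit true (.inr .j)), .toMark (.addr (.inr .j) true)),
    (.toMark (.addr (.inr .j) false), some .mark, .search (.addr (.inr .j) false)),
    (.toMark (.addr (.inr .j) true), some .mark, .search (.addr (.inr .j) true)),
    (.toMark (.addr (.inr .j) false), none, .good),
    (.toMark (.addr (.inr .j) true), none, .good)])))))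

/-- A control state with each of the possible tops of the stack. -/
def withTop (s : Ctl Reg) : Fam (Ctl Reg × Option (Sym Reg)) :=
  items [(s, none), (s, some .mark)] ⊹ (anyBit (fun g => items [(s, some g)]) ⊹
    anyCell fun k a b => items [(s, some (.cell k a b))])

/-- The control states of the environment with all tops of the stack. -/
def envFam : Fam (Ctl Reg × Option (Sym Reg)) :=
  loop .i .n1 (withTop (.init false (.inr .i)) ⊹ withTop (.init true (.inr .i))) ⊹ (
  loop .q .nQ (withTop (.header (.inr .q)) ⊹ (withTop (.post (.inr .q)) ⊹ (
    withTop (.midR (.inr .q)) ⊹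
    loop .a .nA (withTop (.select false (.inr .q) (.inr .a)) ⊹
      loop .b .nA (withTop (.pre false (.inr .q) (.inr .a) (.inr .b)) ⊹ (
        withTop (.pre true (.inr .q) (.inr .a) (.inr .b)) ⊹
        withTop (.midL (.inr .q) (.inr .a) (.inr .b)))))))) ⊹ (
  loop .j .n (withTop (.search (.addr (.inr .j) false)) ⊹
    withTop (.search (.addr (.inr .j) true))) ⊹
  loop .c .nA (withTop (.search (.cont (.inr .c) false)) ⊹
    withTop (.search (.cont (.inr .c) true)))))

variable {β : Base → ℕ}

/-- The values of loop variables before any loop. -/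
abbrev noVar : Var → ℕ := fun _ => 0

theorem mem_symFam {s : Sym ℕ} : s ∈ symFam.den Sym.sub β noVar ↔ s.InRange β := by
  simp only [symFam, mem_den_append, mem_den_items, mem_den_anyBit, mem_den_anyCell, Sym.sub,
    List.mem_cons, List.not_mem_nil, or_false, exists_eq_left, exists_eq_or_imp, Sym.map,
    Sum.elim_inr, Function.update_self, Function.update_of_ne, ne_eq, reduceCtorEq,
    not_false_eq_true]
  rcases s with ⟨b, j⟩ | _ | ⟨k, a, b⟩ <;>
    simp [Sym.InRange, Sym.idx, Sym.fst, Sym.snd]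

theorem mem_ctlFam {s : Ctl ℕ} :
    s = .good ∨ s ∈ ctlFam.den Ctl.sub β noVar ↔ s.InRange β := by
  simp only [ctlFam, mem_den_append, mem_den_items, mem_den_loop, Ctl.sub, List.mem_cons,
    List.not_mem_nil, or_false, exists_eq_left, exists_eq_or_imp, Ctl.map, Memo.map,
    Sum.elim_inr, Function.update_self, Function.update_of_ne, ne_eq, reduceCtorEq,
    not_false_eq_true]
  rcases s with ⟨_ | _, i⟩ | q | ⟨_ | _, q, a⟩ | ⟨_ | _, q, a, b⟩ | ⟨q, a, b⟩ | q | q | _ |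
      ⟨_ | _, j⟩ | ⟨j, _ | _⟩ | ⟨j, _ | _⟩ | _ | _ | _ | ⟨⟨j, _ | _⟩ | ⟨c, _ | _⟩⟩ |
      ⟨⟨j, _ | _⟩ | ⟨c, _ | _⟩⟩ | _ | _ <;>
    simp only [Ctl.InRange, Ctl.st, Ctl.fst, Ctl.snd, Ctl.pos, Ctl.hidIdx, Ctl.hidLetter, Memo.idx,
      Memo.letter, reduceCtorEq, Ctl.init.injEq, Ctl.header.injEq, Ctl.select.injEq, Ctl.pre.injEq,
      Ctl.midL.injEq, Ctl.midR.injEq, Ctl.post.injEq, Ctl.incr.injEq, Ctl.skip.injEq,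
      Ctl.comp.injEq, Ctl.toMark.injEq, Ctl.search.injEq, Memo.addr.injEq, Memo.cont.injEq,
      Option.mem_def, Option.some.injEq, false_or, or_false, and_false, exists_false, true_and,
      and_true, false_and, exists_eq_right, exists_eq_right_right, forall_eq', implies_true,
      true_or, or_true, IsEmpty.forall_iff] <;> try simp [and_comm]

end PMC

namespace PMC
open Function (update)
open Fam
set_option linter.unusedSimpArgs false
variable {β : Base → ℕ}

namespace Fam

variable {τ σ : Type} {I : (Reg → ℕ) → τ → σ} {η : Var → ℕ} {P : σ → Prop}

theorem forall_den_append {F G : Fam τ} :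
    (∀ t ∈ (F ⊹ G).den I β η, P t) ↔ (∀ t ∈ F.den I β η, P t) ∧ ∀ t ∈ G.den I β η, P t :=
  List.forall_mem_append

theorem forall_den_items {l : List τ} :
    (∀ t ∈ (items l).den I β η, P t) ↔ ∀ s ∈ l, P (I (Sum.elim β η) s) := List.forall_mem_map

theorem forall_den_loop {F : Fam τ} {v : Var} {N : Base} :
    (∀ t ∈ (loop v N F).den I β η, P t) ↔
      ∀ k < β N, ∀ t ∈ F.den I β (update η v k), P t := by
  simp only [mem_den_loop]
  exact ⟨fun h k hk t ht => h t ⟨k, hk, ht⟩, fun h t ⟨k, hk, ht⟩ => h k hk t ht⟩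

theorem forall_den_succ {F : Fam τ} {v : Var} {r : Reg} :
    (∀ t ∈ (succ v r F).den I β η, P t) ↔
      ∀ t ∈ F.den I β (update η v (Sum.elim β (update η v 0) r + 1)), P t := Iff.rfl

theorem forall_den_anyBit {F : Sym Reg → Fam τ} :
    (∀ t ∈ (anyBit F).den I β η, P t) ↔
      ∀ k < β .n, ∀ b, ∀ t ∈ (F (.bit b (.inr .x))).den I β (update η .x k), P t := by
  simp only [mem_den_anyBit]
  exact ⟨fun h k hk b t ht => h t ⟨k, hk, b, ht⟩, fun h t ⟨k, hk, b, ht⟩ => h k hk b t ht⟩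

theorem forall_den_anyCell {F : Kind → Reg → Reg → Fam τ} :
    (∀ t ∈ (anyCell F).den I β η, P t) ↔ ∀ a < β .nA, ∀ b < β .nA, ∀ k,
      ∀ t ∈ (F k (.inr .y) (.inr .z)).den I β (update (update η .y a) .z b), P t := by
  simp only [mem_den_anyCell]
  exact ⟨fun h a ha b hb k t ht => h t ⟨a, ha, b, hb, k, ht⟩,
    fun h t ⟨a, ha, b, hb, k, ht⟩ => h a ha b hb k t ht⟩

end Fam

/-! ### The transitions as relations -/

/-- The push transitions that do not depend on the input word. -/
inductive StaticPush (β : Base → ℕ) : Ctl ℕ → Ctl ℕ → Sym ℕ → Prop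
  | init_bit {u i b j} (hi : i < β .n1) (hj : j < β .n) :
      StaticPush β (.init u i) (.init u i) (.bit b j)
  | post_bit {q b j} (hq : q < β .nQ) (hj : j < β .n) : StaticPush β (.post q) (.post q) (.bit b j)
  | midR_bit {q b j} (hq : q < β .nQ) (hj : j < β .n) : StaticPush β (.midR q) (.midR q) (.bit b j)
  | pre_bit {m q a b e j} (hq : q < β .nQ) (ha : a < β .nA) (hb : b < β .nA) (hj : j < β .n) :
      StaticPush β (.pre m q a b) (.pre m q a b) (.bit e j)
  | midL_bit {q a b e j} (hq : q < β .nQ) (ha : a < β .nA) (hb : b < β .nA) (hj : j < β .n) :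
      StaticPush β (.midL q a b) (.midL q a b) (.bit e j)
  | post_mark {q} (hq : q < β .nQ) : StaticPush β (.post q) (.header q) .mark
  | midR_arrive {q c} (hq : q < β .nQ) (hc : c < β .nA) :
      StaticPush β (.midR q) (.post q) (.cell .arrive c c)
  | post_stay {q c} (hq : q < β .nQ) (hc : c < β .nA) :
      StaticPush β (.post q) (.post q) (.cell .stay c c)
  | pre_depart {q a b} (hq : q < β .nQ) (ha : a < β .nA) (hb : b < β .nA) :
      StaticPush β (.pre true q a b) (.midR q) (.cell .depart a b)
  | midL_depart {q a b} (hq : q < β .nQ) (ha : a < β .nA) (hb : b < β .nA) :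
      StaticPush β (.midL q a b) (.post q) (.cell .depart a b)
  | pre_stay {m q a b c} (hq : q < β .nQ) (ha : a < β .nA) (hb : b < β .nA) (hc : c < β .nA) :
      StaticPush β (.pre m q a b) (.pre m q a b) (.cell .stay c c)
  | pre_arrive {q a b c} (hq : q < β .nQ) (ha : a < β .nA) (hb : b < β .nA) (hc : c < β .nA) :
      StaticPush β (.pre false q a b) (.midL q a b) (.cell .arrive c c)
  | init_blank : StaticPush β (.init false (β .n)) (.init false (β .n))
      (.cell .stay (β .blank) (β .blank))
  | init_mark : StaticPush β (.init false (β .n)) (.header (β .q0)) .mark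

/-- The pop transitions of `addrPopFam`. -/
inductive AddrPop (β : Base → ℕ) : Ctl ℕ → Option (Sym ℕ) → Ctl ℕ → Prop
  | chk_mark : AddrPop β .chk (some .mark) .chk
  | chk_bot : AddrPop β .chk none .good
  | chk_bit {b j} (hj : j < β .n) : AddrPop β .chk (some (.bit b j)) .chk
  | chk_cell {k a b} (ha : a < β .nA) (hb : b < β .nA) : AddrPop β .chk (some (.cell k a b)) .chk
  | chk_incr {k a b} (ha : a < β .nA) (hb : b < β .nA) :
      AddrPop β .chk (some (.cell k a b)) (.incr false (β .zero))
  | chk_undecided {k a b} (ha : a < β .nA) (hb : b < β .nA) :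
      AddrPop β .chk (some (.cell k a b)) .undecided
  | chk_last : AddrPop β .chk (some .mark) .last
  | incr_mark : AddrPop β (.incr false (β .n)) (some .mark) .good
  | incr_bot : AddrPop β (.incr false (β .n)) none .good
  | incr_cell {k a b} (ha : a < β .nA) (hb : b < β .nA) :
      AddrPop β (.incr true (β .n)) (some (.cell k a b)) .good
  | incr_bit {u b j} (hj : j < β .n) :
      AddrPop β (.incr u j) (some (.bit b j)) (.incr (u || b) (j + 1))
  | incr_skip {u b j} (hj : j < β .n) :
      AddrPop β (.incr u j) (some (.bit b j)) (.skip j (b == u))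
  | skip_bit {j e b i} (hj : j < β .n) (hi : i < β .n) :
      AddrPop β (.skip j e) (some (.bit b i)) (.skip j e)
  | skip_cell {j e k a b} (hj : j < β .n) (ha : a < β .nA) (hb : b < β .nA) :
      AddrPop β (.skip j e) (some (.cell k a b)) (.comp j e)
  | skip_mark {j e} (hj : j < β .n) : AddrPop β (.skip j e) (some .mark) .good
  | skip_bot {j e} (hj : j < β .n) : AddrPop β (.skip j e) none .good
  | comp_bit {j e b i} (hj : j < β .n) (hi : i < β .n) :
      AddrPop β (.comp j e) (some (.bit b i)) (.comp j e)
  | comp_bad {j e} (hj : j < β .n) : AddrPop β (.comp j e) (some (.bit (!e) j)) .bad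
  | comp_cell {j e k a b} (hj : j < β .n) (ha : a < β .nA) (hb : b < β .nA) :
      AddrPop β (.comp j e) (some (.cell k a b)) .good
  | comp_mark {j e} (hj : j < β .n) : AddrPop β (.comp j e) (some .mark) .good
  | comp_bot {j e} (hj : j < β .n) : AddrPop β (.comp j e) none .good
  | last_cell {k a b} (ha : a < β .nA) (hb : b < β .nA) :
      AddrPop β .last (some (.cell k a b)) .ones
  | ones_bit {j} (hj : j < β .n) : AddrPop β .ones (some (.bit true j)) .ones
  | ones_cell {k a b} (ha : a < β .nA) (hb : b < β .nA) :
      AddrPop β .ones (some (.cell k a b)) .good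
  | ones_mark : AddrPop β .ones (some .mark) .good
  | ones_bot : AddrPop β .ones none .good

/-- The numbers in what an invisible check remembers are within the bounds of the instance. -/
def Memo.InRange (β : Base → ℕ) (I : Memo ℕ) : Prop :=
  (∀ j ∈ I.idx, j < β .n) ∧ ∀ c ∈ I.letter, c < β .nA

/-- The head is at a cell of this kind before the step. -/
def Kind.before : Kind → Bool
  | .depart => true
  | _ => false

/-- The head is at a cell of this kind after the step. -/
def Kind.after : Kind → Bool
  | .arrive => true
  | _ => false

/-- The pop transitions of `contPopFam`. -/
inductive ContPop (β : Base → ℕ) : Ctl ℕ → Option (Sym ℕ) → Ctl ℕ → Prop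
  | chk {k a b} (ha : a < β .nA) (hb : b < β .nA) :
      ContPop β .chk (some (.cell k a b)) (.toMark (.cont a k.before))
  | und_mark : ContPop β .undecided (some .mark) .good
  | und_bot : ContPop β .undecided none .good
  | und_cell {k a b} (ha : a < β .nA) (hb : b < β .nA) :
      ContPop β .undecided (some (.cell k a b)) .good
  | und_bit {b j} (hj : j < β .n) : ContPop β .undecided (some (.bit b j)) .undecided
  | und_addr {b j} (hj : j < β .n) :
      ContPop β .undecided (some (.bit b j)) (.toMark (.addr j b))
  | toMark_bit {I b i} (hI : I.InRange β) (hi : i < β .n) :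
      ContPop β (.toMark I) (some (.bit b i)) (.toMark I)
  | toMark_cell {I k a b} (hI : I.InRange β) (ha : a < β .nA) (hb : b < β .nA) :
      ContPop β (.toMark I) (some (.cell k a b)) (.toMark I)
  | toMark_mark {I} (hI : I.InRange β) : ContPop β (.toMark I) (some .mark) (.search I)
  | toMark_bot {I} (hI : I.InRange β) : ContPop β (.toMark I) none .good
  | search_bit {I b i} (hI : I.InRange β) (hi : i < β .n) :
      ContPop β (.search I) (some (.bit b i)) (.search I)
  | search_cell {I k a b} (hI : I.InRange β) (ha : a < β .nA) (hb : b < β .nA) :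
      ContPop β (.search I) (some (.cell k a b)) (.search I)
  | search_addr {j e k a b} (hj : j < β .n) (ha : a < β .nA) (hb : b < β .nA) :
      ContPop β (.search (.addr j e)) (some (.cell k a b)) (.comp j e)
  | search_cont {k a b} (ha : a < β .nA) (hb : b < β .nA) :
      ContPop β (.search (.cont b k.after)) (some (.cell k a b)) .good

theorem inRange_addr {j : ℕ} {b : Bool} : (Memo.addr j b).InRange β ↔ j < β .n := by
  simp [Memo.InRange, Memo.idx, Memo.letter]

theorem inRange_cont {c : ℕ} {h : Bool} : (Memo.cont c h).InRange β ↔ c < β .nA := by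
  simp [Memo.InRange, Memo.idx, Memo.letter]

theorem staticPush_of_mem :
    ∀ t ∈ pushFam.den pushSub β noVar, StaticPush β t.1 t.2.1 t.2.2 := by
  simp only [pushFam, forall_den_append, forall_den_items, forall_den_anyBit, forall_den_loop,
    pushSub, List.forall_mem_cons, List.not_mem_nil, IsEmpty.forall_iff, implies_true, and_true,
    Ctl.map, Sym.map, Sum.elim_inr, Sum.elim_inl, Function.update_self, Function.update_of_ne,
    ne_eq, reduceCtorEq, not_false_eq_true]
  repeat' first | apply And.intro | intro _
  all_goals constructor <;> assumption

theorem addrPop_of_mem :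
    ∀ t ∈ addrPopFam.den popSub β noVar, AddrPop β t.1 t.2.1 t.2.2 := by
  simp only [addrPopFam, forall_den_append, forall_den_items, forall_den_anyBit, forall_den_loop,
    forall_den_anyCell, forall_den_succ,
    popSub, List.forall_mem_cons, List.not_mem_nil, IsEmpty.forall_iff, implies_true, and_true,
    Ctl.map, Sym.map, Sum.elim_inr, Sum.elim_inl, Function.update_self, Function.update_of_ne,
    ne_eq, reduceCtorEq, not_false_eq_true, Option.map_some, Option.map_none]
  repeat' first | apply And.intro | intro _
  all_goals constructor <;> assumption

theorem contPop_of_mem :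
    ∀ t ∈ contPopFam.den popSub β noVar, ContPop β t.1 t.2.1 t.2.2 := by
  simp only [contPopFam, forall_den_append, forall_den_items, forall_den_anyBit, forall_den_loop,
    forall_den_anyCell, forall_den_succ,
    popSub, List.forall_mem_cons, List.not_mem_nil, IsEmpty.forall_iff, implies_true, and_true,
    Ctl.map, Memo.map, Sym.map, Sum.elim_inr, Sum.elim_inl, Function.update_self,
    Function.update_of_ne, ne_eq, reduceCtorEq, not_false_eq_true, Option.map_some,
    Option.map_none]
  repeat' first | apply And.intro | intro _
  all_goals first
    | exact ContPop.und_mark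
    | exact ContPop.und_bot
    | exact ContPop.und_bit (by assumption)
    | exact ContPop.und_addr (by assumption)
    | exact ContPop.und_cell (by assumption) (by assumption)
    | exact ContPop.search_addr (by assumption) (by assumption) (by assumption)
    | exact ContPop.toMark_bit (inRange_addr.2 (by assumption)) (by assumption)
    | exact ContPop.toMark_bit (inRange_cont.2 (by assumption)) (by assumption)
    | exact ContPop.toMark_cell (inRange_addr.2 (by assumption)) (by assumption) (by assumption)
    | exact ContPop.toMark_cell (inRange_cont.2 (by assumption)) (by assumption) (by assumption)
    | exact ContPop.toMark_mark (inRange_addr.2 (by assumption))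
    | exact ContPop.toMark_mark (inRange_cont.2 (by assumption))
    | exact ContPop.toMark_bot (inRange_addr.2 (by assumption))
    | exact ContPop.toMark_bot (inRange_cont.2 (by assumption))
    | exact ContPop.search_bit (inRange_addr.2 (by assumption)) (by assumption)
    | exact ContPop.search_bit (inRange_cont.2 (by assumption)) (by assumption)
    | exact ContPop.search_cell (inRange_addr.2 (by assumption)) (by assumption) (by assumption)
    | exact ContPop.search_cell (inRange_cont.2 (by assumption)) (by assumption) (by assumption)
    | exact ContPop.chk (k := .stay) (by assumption) (by assumption)
    | exact ContPop.chk (k := .arrive) (by assumption) (by assumption)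
    | exact ContPop.chk (k := .depart) (by assumption) (by assumption)
    | exact ContPop.search_cont (k := .stay) (by assumption) (by assumption)
    | exact ContPop.search_cont (k := .arrive) (by assumption) (by assumption)
    | exact ContPop.search_cont (k := .depart) (by assumption) (by assumption)

theorem mem_of_staticPush {s s' : Ctl ℕ} {g : Sym ℕ} (h : StaticPush β s s' g) :
    (s, s', g) ∈ pushFam.den pushSub β noVar := by
  simp only [pushFam, mem_den_append, mem_den_items, mem_den_anyBit, mem_den_loop,
    pushSub, List.mem_cons, List.not_mem_nil, or_false, exists_eq_or_imp, exists_eq_left,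
    Ctl.map, Sym.map, Sum.elim_inr, Sum.elim_inl, Function.update_self, Function.update_of_ne,
    ne_eq, reduceCtorEq, not_false_eq_true, Prod.mk.injEq]
  rcases h with @⟨⟨_ | _⟩, _, ⟨_ | _⟩, _, _, _⟩ | @⟨_, ⟨_ | _⟩, _⟩ | @⟨_, ⟨_ | _⟩, _⟩ |
      @⟨⟨_ | _⟩, _, _, _, ⟨_ | _⟩, _⟩ | @⟨_, _, _, ⟨_ | _⟩, _⟩ | _ | _ | _ | _ | _ |
      @⟨⟨_ | _⟩, _⟩ | _ | _ | _ <;>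
    simp only [reduceCtorEq, Ctl.init.injEq, Ctl.header.injEq, Ctl.pre.injEq,
      Ctl.midL.injEq, Ctl.midR.injEq, Ctl.post.injEq, Sym.bit.injEq, Sym.cell.injEq,
      and_false, exists_false, true_and, and_true, false_and, false_or, or_false, true_or,
        or_true] <;>
    simp [*]

theorem mem_of_addrPop {s s' : Ctl ℕ} {g : Option (Sym ℕ)} (h : AddrPop β s g s') :
    (s, g, s') ∈ addrPopFam.den popSub β noVar := by
  simp only [addrPopFam, mem_den_append, mem_den_items, mem_den_anyBit, mem_den_loop,
    mem_den_anyCell, mem_den_succ,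
    popSub, List.mem_cons, List.not_mem_nil, or_false, exists_eq_or_imp, exists_eq_left,
    Ctl.map, Sym.map, Sum.elim_inr, Sum.elim_inl, Function.update_self, Function.update_of_ne,
    ne_eq, reduceCtorEq, not_false_eq_true, Prod.mk.injEq, Option.map_some, Option.map_none]
  rcases h with _ | _ | _ | _ | _ | _ | _ | _ | _ | _ | @⟨⟨_ | _⟩, ⟨_ | _⟩, _⟩ |
      @⟨⟨_ | _⟩, ⟨_ | _⟩, _⟩ | @⟨_, ⟨_ | _⟩, _, _⟩ | @⟨_, ⟨_ | _⟩, _, _⟩ | @⟨_, ⟨_ | _⟩⟩ |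
      @⟨_, ⟨_ | _⟩⟩ | @⟨_, ⟨_ | _⟩, _, _⟩ | @⟨_, ⟨_ | _⟩⟩ | @⟨_, ⟨_ | _⟩, _, _⟩ |
      @⟨_, ⟨_ | _⟩⟩ | @⟨_, ⟨_ | _⟩⟩ | _ | _ | _ | _ | _ <;>
    simp only [reduceCtorEq, Ctl.incr.injEq, Ctl.skip.injEq, Ctl.comp.injEq, Option.some.injEq,
      Sym.bit.injEq, Sym.cell.injEq, Bool.or_false, Bool.or_true, Bool.not_false, Bool.not_true,
      beq_self_eq_true, Bool.true_beq, Bool.false_beq,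
      and_false, exists_false, true_and, and_true, false_and, false_or, or_false, true_or,
        or_true] <;>
    simp [*]

theorem mem_of_contPop {s s' : Ctl ℕ} {g : Option (Sym ℕ)} (h : ContPop β s g s') :
    (s, g, s') ∈ contPopFam.den popSub β noVar := by
  simp only [contPopFam, mem_den_append, mem_den_items, mem_den_anyBit, mem_den_loop,
    mem_den_anyCell, popSub, List.mem_cons, List.not_mem_nil, or_false, exists_eq_or_imp,
    exists_eq_left, Ctl.map, Memo.map, Sym.map, Sum.elim_inr, Sum.elim_inl, Function.update_self,
    Function.update_of_ne, ne_eq, reduceCtorEq, not_false_eq_true, Prod.mk.injEq, Option.map_some,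
    Option.map_none]
  rcases h with @⟨⟨_ | _ | _⟩, _⟩ | _ | _ | _ | _ | @⟨⟨_ | _⟩, _⟩ | 
      @⟨⟨_, _ | _⟩ | ⟨_, _ | _⟩, _, _, hI⟩ | @⟨⟨_, _ | _⟩ | ⟨_, _ | _⟩, _, _, _, hI⟩ |
      @⟨⟨_, _ | _⟩ | ⟨_, _ | _⟩, hI⟩ | @⟨⟨_, _ | _⟩ | ⟨_, _ | _⟩, hI⟩ |
      @⟨⟨_, _ | _⟩ | ⟨_, _ | _⟩, _, _, hI⟩ | @⟨⟨_, _ | _⟩ | ⟨_, _ | _⟩, _, _, _, hI⟩ |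
      @⟨_, ⟨_ | _⟩, _⟩ | @⟨⟨_ | _ | _⟩, _⟩ <;>
    (try simp only [inRange_addr, inRange_cont] at hI) <;>
    simp only [reduceCtorEq, Ctl.comp.injEq, Ctl.toMark.injEq, Ctl.search.injEq, Memo.addr.injEq,
      Memo.cont.injEq, Kind.before, Kind.after, Option.some.injEq, Sym.bit.injEq, Sym.cell.injEq,
      and_false, exists_false, true_and, and_true, false_and, false_or, or_false, true_or,
        or_true] <;>
    simp [*]

theorem mem_envFam {s : Ctl ℕ} {g : Option (Sym ℕ)} :
    (s, g) ∈ envFam.den envSub β noVar ↔ s.isEnv = true ∧ s.InRange β ∧ ∀ γ ∈ g, γ.InRange β := by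
  simp only [envFam, withTop, mem_den_append, mem_den_items, mem_den_anyBit, mem_den_loop,
    mem_den_anyCell, envSub, List.mem_cons, List.not_mem_nil, or_false, exists_eq_or_imp,
    exists_eq_left, Ctl.map, Memo.map, Sym.map, Sum.elim_inr, Sum.elim_inl, Function.update_self,
    Function.update_of_ne, ne_eq, reduceCtorEq, not_false_eq_true, Prod.mk.injEq, Option.map_some,
    Option.map_none]
  rcases s with ⟨_ | _, i⟩ | q | ⟨_ | _, q, a⟩ | ⟨_ | _, q, a, b⟩ | ⟨q, a, b⟩ | q | q | _ |
      ⟨_ | _, j⟩ | ⟨j, _ | _⟩ | ⟨j, _ | _⟩ | _ | _ | _ | ⟨⟨j, _ | _⟩ | ⟨c, _ | _⟩⟩ |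
      ⟨⟨j, _ | _⟩ | ⟨c, _ | _⟩⟩ | _ | _ <;> rcases g with _ | ⟨b', j'⟩ | _ | ⟨k', a', b'⟩ <;>
    simp only [Ctl.InRange, Sym.InRange, Ctl.st, Ctl.fst, Ctl.snd, Ctl.pos, Ctl.hidIdx,
      Ctl.hidLetter, Ctl.isEnv, Memo.idx, Memo.letter, Sym.idx, Sym.fst, Sym.snd, Bool.not_false,
      Bool.not_true, Bool.false_eq_true,
      reduceCtorEq, Ctl.init.injEq, Ctl.header.injEq, Ctl.select.injEq, Ctl.pre.injEq,
      Ctl.midL.injEq, Ctl.midR.injEq, Ctl.post.injEq, Ctl.search.injEq, Memo.addr.injEq,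
      Memo.cont.injEq, Sym.bit.injEq, Sym.cell.injEq,
      Option.mem_def, Option.some.injEq, false_or, or_false, and_false, exists_false, true_and,
      and_true, false_and, forall_eq', implies_true, true_or, or_true, IsEmpty.forall_iff] <;>
    try simp [and_comm, and_assoc, and_left_comm]

end PMC

namespace PMC
open Function (update)
open Fam

/-! ### The open pushdown system of a machine and an input word -/

/-- The constants of the instance `(T, w)`. -/
def baseOf (T : ATM) (w : List (Fin T.nA)) : Base → ℕ
  | .zero => 0
  | .nA => T.nA
  | .nQ => T.nQ
  | .blank => T.blank
  | .q0 => T.q0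
  | .n => w.length
  | .n1 => w.length + 1

/-- The internal transitions for a triple that can be chosen in the state `q` at the letter `a`. -/
def tripleInts (T : ATM) (q a : ℕ) (t : Fin T.nQ × Fin T.nA × Move) : List (Ctl ℕ × Ctl ℕ) :=
  [(.select false q a, .pre (encMove t.2.2) t.1 a t.2.1),
    (.select true q a, .pre (encMove t.2.2) t.1 a t.2.1)]

/-- The internal transitions. -/
def intList (T : ATM) : List (Ctl ℕ × Ctl ℕ) :=
  ((List.finRange T.nQ).flatMap fun q : Fin T.nQ => (List.finRange T.nA).flatMap fun a : Fin T.nA =>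
    [(.header q, .select (T.isUniv q) q a)]) ++
  ((List.finRange T.nQ).flatMap fun q : Fin T.nQ =>
    if T.isAcc q = true then [(.header q, .chk)] else []) ++
  (List.finRange T.nQ).flatMap fun q : Fin T.nQ => (List.finRange T.nA).flatMap fun a : Fin T.nA =>
    tripleInts T q a (T.δ q a).1 ++ tripleInts T q a (T.δ q a).2

/-- The push transitions that write the input word into the cells. -/
def wordPush (T : ATM) (w : List (Fin T.nA)) : List (Ctl ℕ × Ctl ℕ × Sym ℕ) :=
  (List.finRange w.length).flatMap fun k : Fin w.length =>
    [(.init true k, .init false (k + 1), .cell .arrive (w.get k) (w.get k)),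
      (.init false k, .init false (k + 1), .cell .stay (w.get k) (w.get k))]

/-- The push transitions. -/
def pushList (T : ATM) (w : List (Fin T.nA)) : List (Ctl ℕ × Ctl ℕ × Sym ℕ) :=
  pushFam.den pushSub (baseOf T w) noVar ++ wordPush T w

/-- The pop transitions. -/
def popList (β : Base → ℕ) : List (Ctl ℕ × Option (Sym ℕ) × Ctl ℕ) :=
  addrPopFam.den popSub β noVar ++ contPopFam.den popSub β noVar

/-- The variables of a control state of the open pushdown system. -/
def Ctl.toVars (β : Base → ℕ) (s : Ctl ℕ) : Finset ℕ := toSet (s.code β)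

/-- The variables of a stack symbol of the open pushdown system. -/
def Sym.toVars (β : Base → ℕ) (s : Sym ℕ) : Finset ℕ := toSet (s.code β)

section

variable {β : Base → ℕ}

theorem Sym.toVars_injective {s t : Sym ℕ} (hs : s.InRange β) (ht : t.InRange β)
    (h : s.toVars β = t.toVars β) : s = t :=
  Sym.code_injective hs ht (toSet_injective (by simp [Sym.length_code]) h)

theorem Ctl.toVars_injective {s t : Ctl ℕ} (hs : s.InRange β) (ht : t.InRange β)
    (h : s.toVars β = t.toVars β) : s = t :=
  Ctl.code_injective hs ht
    (toSet_injective (by simp [Ctl.code, Ctl.length_visCode, Ctl.length_hidCode]) h)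

/-- The visible part of a control state of the open pushdown system. -/
theorem Ctl.toVars_inter (s : Ctl ℕ) :
    s.toVars β ∩ Finset.range (20 + (β .nQ + (β .nA + (β .nA + β .n1)))) =
      toSet (s.visCode β) := by
  rw [← Ctl.length_visCode (β := β) s]
  exact toSet_append_inter _ _

theorem Ctl.toVars_inter_eq_iff {s t : Ctl ℕ} (hs : s.InRange β) (ht : t.InRange β) :
    s.toVars β ∩ Finset.range (20 + (β .nQ + (β .nA + (β .nA + β .n1)))) =
      t.toVars β ∩ Finset.range (20 + (β .nQ + (β .nA + (β .nA + β .n1)))) ↔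
      s.tag = t.tag ∧ s.st = t.st ∧ s.fst = t.fst ∧ s.snd = t.snd ∧ s.pos = t.pos := by
  rw [Ctl.toVars_inter, Ctl.toVars_inter, ← Ctl.visCode_eq_iff hs ht]
  exact ⟨toSet_injective (by simp [Ctl.length_visCode]), congrArg toSet⟩

theorem inRange_of_staticPush {s s' : Ctl ℕ} {g : Sym ℕ} (h : StaticPush β s s' g)
    (h0 : β .q0 < β .nQ) (h1 : β .blank < β .nA) (h2 : β .n < β .n1) :
    s.InRange β ∧ s'.InRange β ∧ g.InRange β := by
  cases h <;> simp [Ctl.InRange, Sym.InRange, Ctl.st, Ctl.fst, Ctl.snd, Ctl.pos, Ctl.hidIdx,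
    Ctl.hidLetter, Sym.idx, Sym.fst, Sym.snd, *]

theorem inRange_of_addrPop {s s' : Ctl ℕ} {g : Option (Sym ℕ)} (h : AddrPop β s g s')
    (h0 : β .zero = 0) (h2 : β .n1 = β .n + 1) :
    s.InRange β ∧ (∀ γ ∈ g, γ.InRange β) ∧ s'.InRange β := by
  cases h <;> simp [Ctl.InRange, Sym.InRange, Ctl.st, Ctl.fst, Ctl.snd, Ctl.pos, Ctl.hidIdx,
    Ctl.hidLetter, Sym.idx, Sym.fst, Sym.snd, *] <;> omega

theorem inRange_of_contPop {s s' : Ctl ℕ} {g : Option (Sym ℕ)} (h : ContPop β s g s') :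
    s.InRange β ∧ (∀ γ ∈ g, γ.InRange β) ∧ s'.InRange β := by
  rcases h with _ | _ | _ | _ | _ | _ | ⟨hI, _⟩ | ⟨hI, _⟩ | hI | hI | ⟨hI, _⟩ | ⟨hI, _⟩ | _ | _ <;>
    (try obtain ⟨hI, hI'⟩ := hI) <;>
    simp_all [Ctl.InRange, Sym.InRange, Ctl.st, Ctl.fst, Ctl.snd, Ctl.pos, Ctl.hidIdx,
      Ctl.hidLetter, Sym.idx, Sym.fst, Sym.snd, Memo.idx, Memo.letter]

theorem good_notMem_ctlFam : Ctl.good ∉ ctlFam.den Ctl.sub β noVar := by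
  simp only [ctlFam, mem_den_append, mem_den_items, mem_den_loop, Ctl.sub, List.mem_cons,
    List.not_mem_nil, or_false, exists_eq_left, exists_eq_or_imp, Ctl.map, Memo.map,
    reduceCtorEq, and_false, exists_false, not_false_eq_true]

end

variable (T : ATM) (w : List (Fin T.nA))

theorem inRange_of_mem_intList {t : Ctl ℕ × Ctl ℕ} (h : t ∈ intList T) :
    t.1.InRange (baseOf T w) ∧ t.2.InRange (baseOf T w) := by
  simp only [intList, tripleInts, List.mem_append, List.mem_flatMap, List.mem_finRange, true_and,
    List.mem_ite_nil_right, List.mem_cons, List.not_mem_nil, or_false] at h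
  rcases h with (⟨q, a, rfl⟩ | ⟨q, -, rfl⟩) | ⟨q, a, (rfl | rfl) | rfl | rfl⟩ <;>
    simp [Ctl.InRange, Ctl.st, Ctl.fst, Ctl.snd, Ctl.pos, Ctl.hidIdx, Ctl.hidLetter, baseOf]

theorem inRange_of_mem_pushList {t : Ctl ℕ × Ctl ℕ × Sym ℕ} (h : t ∈ pushList T w) :
    t.1.InRange (baseOf T w) ∧ t.2.1.InRange (baseOf T w) ∧ t.2.2.InRange (baseOf T w) := by
  rcases List.mem_append.1 h with h | h
  · exact inRange_of_staticPush (staticPush_of_mem t h) T.q0.2 T.blank.2 (Nat.lt_succ_self _)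
  · simp only [wordPush, List.mem_flatMap, List.mem_finRange, true_and, List.mem_cons,
      List.not_mem_nil, or_false] at h
    obtain ⟨k, rfl | rfl⟩ := h <;>
      simp [Ctl.InRange, Sym.InRange, Ctl.st, Ctl.fst, Ctl.snd, Ctl.pos, Ctl.hidIdx,
        Ctl.hidLetter, Sym.idx, Sym.fst, Sym.snd, baseOf]

theorem inRange_of_mem_popList {t : Ctl ℕ × Option (Sym ℕ) × Ctl ℕ}
    (h : t ∈ popList (baseOf T w)) :
    t.1.InRange (baseOf T w) ∧ (∀ γ ∈ t.2.1, γ.InRange (baseOf T w)) ∧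
      t.2.2.InRange (baseOf T w) := by
  rcases List.mem_append.1 h with h | h
  · exact inRange_of_addrPop (addrPop_of_mem t h) rfl rfl
  · exact inRange_of_contPop (contPop_of_mem t h)

/-- The control states. -/
def ctlList (β : Base → ℕ) : List (Ctl ℕ) := .good :: ctlFam.den Ctl.sub β noVar

theorem mem_ctlList {β : Base → ℕ} {s : Ctl ℕ} : s ∈ ctlList β ↔ s.InRange β := by
  rw [← mem_ctlFam, ctlList, List.mem_cons]

theorem mem_map_ctlList {β : Base → ℕ} {s : Ctl ℕ} (h : s.InRange β) :
    s.toVars β ∈ (ctlList β).map (Ctl.toVars β) := List.mem_map_of_mem (mem_ctlList.2 h)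

theorem mem_map_symFam {β : Base → ℕ} {s : Sym ℕ} (h : s.InRange β) :
    s.toVars β ∈ (symFam.den Sym.sub β noVar).map (Sym.toVars β) :=
  List.mem_map_of_mem (mem_symFam.2 h)

theorem mem_map_envFam {β : Base → ℕ} {s : Ctl ℕ} {g : Option (Sym ℕ)} (hs : s.InRange β)
    (hg : ∀ γ ∈ g, γ.InRange β) :
    (s.toVars β, g.map (Sym.toVars β)) ∈
      (envFam.den envSub β noVar).map (Prod.map (Ctl.toVars β) (Option.map (Sym.toVars β))) ↔
      s.isEnv = true := by
  constructor
  · rintro h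
    obtain ⟨⟨s', g'⟩, h, e⟩ := List.mem_map.1 h
    obtain ⟨h1, h2, h3⟩ := mem_envFam.1 h
    rw [← Ctl.toVars_injective h2 hs (congrArg Prod.fst e)]
    exact h1
  · intro h
    exact List.mem_map.2 ⟨(s, g), mem_envFam.2 ⟨h, hs, hg⟩, rfl⟩

theorem exists_top_eq {β : Base → ℕ} {g : Option (Finset ℕ)}
    (h : g ∈ none :: ((symFam.den Sym.sub β noVar).map (Sym.toVars β)).map some) :
    ∃ g' : Option (Sym ℕ), (∀ γ ∈ g', γ.InRange β) ∧ g = g'.map (Sym.toVars β) := by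
  rcases List.mem_cons.1 h with rfl | h
  · exact ⟨none, by simp, rfl⟩
  · simp only [List.map_map, List.mem_map, Function.comp_apply] at h
    obtain ⟨s, hs, rfl⟩ := h
    exact ⟨some s, by simpa using mem_symFam.1 hs, rfl⟩

/-- The open pushdown system of a machine and an input word. -/
def reduction : OPD :=
  let β := baseOf T w
  { nI := 20 + (β .nQ + (β .nA + (β .nA + β .n1)))
    nH := β .n + (β .nA + 5)
    nIΓ := 6 + (β .n + (β .nA + β .nA))
    nHΓ := 0
    AP := [0, 1]
    Q := (ctlList β).map (Ctl.toVars β)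
    q0 := (Ctl.init true 0).toVars β
    Γ := (symFam.den Sym.sub β noVar).map (Sym.toVars β)
    int := (intList T).map (Prod.map (Ctl.toVars β) (Ctl.toVars β))
    push := (pushList T w).map (Prod.map (Ctl.toVars β) (Prod.map (Ctl.toVars β) (Sym.toVars β)))
    pop := (popList β).map
      (Prod.map (Ctl.toVars β) (Prod.map (Option.map (Sym.toVars β)) (Ctl.toVars β)))
    μ q _ := if q = Ctl.good.toVars β then 1 else 0
    Env := (envFam.den envSub β noVar).map (Prod.map (Ctl.toVars β) (Option.map (Sym.toVars β)))
    Q_sub := by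
      simp only [List.forall_mem_map]
      intro s _
      rw [← Ctl.length_visCode (β := β) s, ← Ctl.length_hidCode (β := β) s, ← List.length_append]
      exact toSet_subset _
    Γ_sub := by
      simp only [List.forall_mem_map]
      intro s _
      rw [Nat.add_zero, ← Sym.length_code (β := β) s]
      exact toSet_subset _
    q0_mem := mem_map_ctlList (by
      simp [Ctl.InRange, Ctl.st, Ctl.fst, Ctl.snd, Ctl.pos, Ctl.hidIdx, Ctl.hidLetter, β, baseOf])
    int_mem := by
      simp only [List.forall_mem_map]
      intro t ht
      obtain ⟨h1, h2⟩ := inRange_of_mem_intList T w ht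
      exact ⟨mem_map_ctlList h1, mem_map_ctlList h2⟩
    push_mem := by
      simp only [List.forall_mem_map]
      intro t ht
      obtain ⟨h1, h2, h3⟩ := inRange_of_mem_pushList T w ht
      exact ⟨mem_map_ctlList h1, mem_map_ctlList h2, mem_map_symFam h3⟩
    pop_mem := by
      simp only [List.forall_mem_map]
      intro t ht
      obtain ⟨h1, h2, h3⟩ := inRange_of_mem_popList T w ht
      refine ⟨mem_map_ctlList h1, ?_, mem_map_ctlList h3⟩
      intro γ hγ
      obtain ⟨g, hg, rfl⟩ := Option.mem_map.1 hγ
      exact mem_map_symFam (h2 g hg)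
    μ_mem := by
      intro q _ g _
      split <;> simp
    Env_mem := by
      simp only [List.forall_mem_map]
      intro t ht
      obtain ⟨-, h1, h2⟩ := mem_envFam.1 ht
      refine ⟨mem_map_ctlList h1, ?_⟩
      intro γ hγ
      obtain ⟨g, hg, rfl⟩ := Option.mem_map.1 hγ
      exact mem_map_symFam (h2 g hg)
    Env_vis := by
      simp only [List.forall_mem_map]
      intro s hs s' hs' g hg g' hg' h _
      rw [mem_ctlList] at hs hs'
      obtain ⟨g, hg₁, rfl⟩ := exists_top_eq hg
      obtain ⟨g', hg₁', rfl⟩ := exists_top_eq hg'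
      rw [mem_map_envFam hs hg₁, mem_map_envFam hs' hg₁',
        Ctl.isEnv_eq_of_tag_eq ((Ctl.toVars_inter_eq_iff hs hs').1 h).1] }

end PMC

namespace PMC
open Function (update)
open Fam

/-! ### The transducer that writes the open pushdown system -/

/-- With these values of the variables, `c` reads the word `u` and writes the word `o`. -/
def Cmd.Reads {R : Type} [DecidableEq R] (c : Cmd R) (ρ : R → ℕ) (u o : List Bool) : Prop :=
  ∀ full rest, c.run ρ full (u ++ rest) = (o, rest)

namespace Cmd.Reads

variable {R : Type} [DecidableEq R] {c d : Cmd R} {ρ : R → ℕ} {u u' o o' : List Bool}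

theorem nil : Reads nil ρ [] [] := fun _ _ => rfl

theorem lit (b : Bool) : Reads (lit b) ρ [] [b] := fun _ _ => rfl

theorem seq (h : Reads c ρ u o) (h' : Reads d ρ u' o') : Reads (c.seq d) ρ (u ++ u') (o ++ o') := by
  intro full rest
  simp only [Cmd.run, List.append_assoc]
  rw [h, h']

/-- A program that only writes, and a second one. -/
theorem write_seq (h : Reads c ρ [] o) (h' : Reads d ρ u' o') : Reads (c.seq d) ρ u' (o ++ o') :=
  h.seq h'

theorem loop {v r : R} {N : ℕ} (hr : update ρ v 0 r = N) {f g : Fin N → List Bool}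
    (h : ∀ k : Fin N, Reads c (update ρ v k) (f k) (g k)) :
    Reads (loop v r c) ρ ((List.finRange N).flatMap f) ((List.finRange N).flatMap g) := by
  intro full rest
  have key : ∀ (m : ℕ) (hm : m ≤ N) (f g : Fin m → List Bool) (rest : List Bool),
      (∀ k : Fin m, Reads c (update ρ v k) (f k) (g k)) →
      (Nat.rec ([], (List.finRange m).flatMap f ++ rest) (fun k p =>
        (p.1 ++ (c.run (update ρ v k) full p.2).1, (c.run (update ρ v k) full p.2).2)) m :
        List Bool × List Bool) = ((List.finRange m).flatMap g, rest) := by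
    intro m
    induction m with
    | zero => intros; rfl
    | succ m ih =>
      intro hm f g rest h
      have e := fun f : Fin (m + 1) → List Bool => show (List.finRange (m + 1)).flatMap f =
        (List.finRange m).flatMap (fun k => f k.castSucc) ++ f (Fin.last m) by
          rw [List.finRange_succ_last, List.flatMap_append, List.flatMap_map]; simp
      rw [e f, e g, List.append_assoc]
      simp only
      rw [ih (by omega) _ (fun k => g k.castSucc) _ fun k => h k.castSucc,
        show c.run (update ρ v m) full (f (Fin.last m) ++ rest) = _ from h (Fin.last m) full rest]
  simp only [Cmd.run, hr]
  exact key N le_rfl f g rest h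

theorem write_loop {v r : R} {N : ℕ} (hr : update ρ v 0 r = N) {g : ℕ → List Bool}
    (h : ∀ k < N, Reads c (update ρ v k) [] (g k)) :
    Reads (.loop v r c) ρ [] ((List.range N).flatMap g) := by
  have := loop (c := c) hr (f := fun _ => []) (g := fun k => g k) fun k => h k k.2
  rwa [← List.map_coe_finRange_eq_range, List.flatMap_map,
    ← List.flatMap_eq_nil_iff.2 fun (_ : Fin N) (_ : _ ∈ List.finRange N) => rfl]

theorem _root_.PMC.Cmd.run_readNat (c : Cmd R) (x : R) (m : ℕ) (ρ : R → ℕ) (full i : List Bool) :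
    (Cmd.readNat x c).run ρ full (encNat m ++ i) = c.run (update ρ x m) full i := by
  have e1 : ((encNat m ++ i).takeWhile id).length = m := by
    simp only [encNat, List.append_assoc, List.cons_append, List.nil_append]
    rw [List.takeWhile_append_of_pos (by simp), List.takeWhile_cons_of_neg (by simp)]
    simp
  have e2 : ((encNat m ++ i).dropWhile id).tail = i := by
    simp only [encNat, List.append_assoc, List.cons_append, List.nil_append]
    rw [List.dropWhile_append_of_pos (by simp), List.dropWhile_cons_of_neg (by simp)]
    simp
  simp only [Cmd.run]
  rw [e1, e2]

theorem readNat {x : R} {m : ℕ} (h : Reads c (update ρ x m) u o) :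
    Reads (readNat x c) ρ (encNat m ++ u) o := by
  intro full rest
  rw [List.append_assoc, Cmd.run_readNat, h]

theorem readBit {b : Bool} (h : Reads (if b = true then c else d) ρ u o) :
    Reads (readBit c d) ρ (b :: u) o := by
  intro full rest
  cases b
  · simpa [Cmd.run] using h full rest
  · simpa [Cmd.run] using h full rest

theorem succ {x y : R} (h : Reads c (update ρ x (update ρ x 0 y + 1)) u o) :
    Reads (succ x y c) ρ u o := h

theorem oneHot (N x : R) : Reads (oneHot N x) ρ [] (field (ρ N) (some (ρ x))) := by
  intro full rest
  simp [Cmd.run, field]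

end Cmd.Reads

/-- Write a fixed word. -/
def Cmd.lits {R : Type} (l : List Bool) : Cmd R := l.foldr (fun b c => (Cmd.lit b).seq c) .nil

theorem Cmd.reads_lits {R : Type} [DecidableEq R] (l : List Bool) (ρ : R → ℕ) :
    (lits l : Cmd R).Reads ρ [] l := by
  induction l with
  | nil => exact .nil
  | cons b l ih => exact (Cmd.Reads.lit b).write_seq ih

/-- Write a `true` for each number below a constant. -/
def Cmd.trues (N : Base) : Cmd Reg := .loop (.inr .q) (.inl N) (.lit true)

theorem Cmd.reads_trues (N : Base) (β : Base → ℕ) (η : Var → ℕ) :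
    (trues N).Reads (Sum.elim β η) [] (List.replicate (β N) true) := by
  have : (List.range (β N)).flatMap (fun _ => [true]) = List.replicate (β N) true := by
    rw [← List.map_eq_flatMap, List.map_const', List.length_range]
  rw [← this]
  exact Cmd.Reads.write_loop (by simp) fun k _ => .lit true

/-- Write a field for an optional value. -/
def Cmd.field (N : Base) : Option Reg → Cmd Reg
  | none => .loop (.inr .q) (.inl N) (.lit false)
  | some x => .oneHot (.inl N) x

theorem Cmd.reads_field (N : Base) (o : Option Reg) (β : Base → ℕ) (η : Var → ℕ) :
    (Cmd.field N o).Reads (Sum.elim β η) [] (PMC.field (β N) (o.map (Sum.elim β η))) := by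
  cases o with
  | none =>
    have : PMC.field (β N) none = (List.range (β N)).flatMap (fun _ => [false]) := by
      simp [PMC.field, ← List.map_eq_flatMap]
    rw [Option.map_none, this]
    exact Cmd.Reads.write_loop (by simp) fun k _ => .lit false
  | some x => exact Cmd.Reads.oneHot (.inl N) x

/-- Write the code of a stack symbol. -/
def Sym.emit (s : Sym Reg) : Cmd Reg :=
  (Cmd.lits (field 6 (some s.tag))).seq ((Cmd.field .n s.idx).seq ((Cmd.field .nA s.fst).seq
    (Cmd.field .nA s.snd)))

theorem Sym.reads_emit (s : Sym Reg) (β : Base → ℕ) (η : Var → ℕ) :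
    s.emit.Reads (Sum.elim β η) [] ((s.map (Sum.elim β η)).code β) := by
  have h : ∀ f : Reg → ℕ, (s.map f).tag = s.tag ∧ (s.map f).idx = s.idx.map f ∧
      (s.map f).fst = s.fst.map f ∧ (s.map f).snd = s.snd.map f := by
    intro f
    rcases s with ⟨_ | _, _⟩ | _ | ⟨_ | _ | _, _, _⟩ <;> exact ⟨rfl, rfl, rfl, rfl⟩
  obtain ⟨h0, h1, h2, h3⟩ := h (Sum.elim β η)
  rw [Sym.code, h0, h1, h2, h3]
  exact (Cmd.reads_lits _ _).write_seq ((Cmd.reads_field _ _ _ _).write_seq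
    ((Cmd.reads_field _ _ _ _).write_seq (Cmd.reads_field _ _ _ _)))

/-- Write the code of a control state. -/
def Ctl.emit (s : Ctl Reg) : Cmd Reg :=
  ((Cmd.lits (field 20 (some s.tag))).seq ((Cmd.field .nQ s.st).seq ((Cmd.field .nA s.fst).seq
    ((Cmd.field .nA s.snd).seq (Cmd.field .n1 s.pos))))).seq
  ((Cmd.field .n s.hidIdx).seq ((Cmd.field .nA s.hidLetter).seq
    (Cmd.lits (field 5 (some s.hidTag)))))

theorem Ctl.reads_emit (s : Ctl Reg) (β : Base → ℕ) (η : Var → ℕ) :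
    s.emit.Reads (Sum.elim β η) [] ((s.map (Sum.elim β η)).code β) := by
  have h : ∀ f : Reg → ℕ, (s.map f).tag = s.tag ∧ (s.map f).st = s.st.map f ∧
      (s.map f).fst = s.fst.map f ∧ (s.map f).snd = s.snd.map f ∧ (s.map f).pos = s.pos.map f ∧
      (s.map f).hidIdx = s.hidIdx.map f ∧ (s.map f).hidLetter = s.hidLetter.map f ∧
      (s.map f).hidTag = s.hidTag := by
    intro f
    rcases s with _ | _ | _ | _ | _ | _ | _ | _ | _ | _ | _ | _ | _ | _ | ⟨_ | _⟩ |
      ⟨_ | _⟩ | _ | _ <;> exact ⟨rfl, rfl, rfl, rfl, rfl, rfl, rfl, rfl⟩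
  obtain ⟨h0, h1, h2, h3, h4, h5, h6, h7⟩ := h (Sum.elim β η)
  rw [Ctl.code, Ctl.visCode, Ctl.hidCode, h0, h1, h2, h3, h4, h5, h6, h7]
  exact ((Cmd.reads_lits _ _).write_seq ((Cmd.reads_field _ _ _ _).write_seq
    ((Cmd.reads_field _ _ _ _).write_seq ((Cmd.reads_field _ _ _ _).write_seq
    (Cmd.reads_field _ _ _ _))))).write_seq ((Cmd.reads_field _ _ _ _).write_seq
    ((Cmd.reads_field _ _ _ _).write_seq (Cmd.reads_lits _ _)))

/-- The code of a stack symbol or of the bottom of the stack. -/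
def topCode (β : Base → ℕ) : Option (Sym ℕ) → List Bool
  | none => [false]
  | some s => true :: s.code β

/-- Write the code of a stack symbol or of the bottom of the stack. -/
def topEmit : Option (Sym Reg) → Cmd Reg
  | none => .lit false
  | some s => (Cmd.lit true).seq s.emit

theorem reads_topEmit (g : Option (Sym Reg)) (β : Base → ℕ) (η : Var → ℕ) :
    (topEmit g).Reads (Sum.elim β η) [] (topCode β (g.map (Sym.map (Sum.elim β η)))) := by
  cases g with
  | none => exact .lit _
  | some g => exact (Cmd.Reads.lit true).write_seq (g.reads_emit β η)

theorem Fam.reads_cmd {τ σ : Type} {I : (Reg → ℕ) → τ → σ} {β : Base → ℕ} {E : τ → Cmd Reg}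
    {e : σ → List Bool}
    (h : ∀ t η, (E t).Reads (Sum.elim β η) [] (e (I (Sum.elim β η) t))) (F : Fam τ) (η : Var → ℕ) :
    (F.cmd E).Reads (Sum.elim β η) [] ((F.den I β η).flatMap e) := by
  induction F generalizing η with
  | items l =>
    induction l with
    | nil => exact .nil
    | cons t l ih => exact (h t η).write_seq ih
  | app F G ihF ihG =>
    rw [Fam.den, List.flatMap_append]
    exact (ihF η).write_seq (ihG η)
  | loop v N F ih =>
    rw [Fam.den, List.flatMap_assoc]
    refine Cmd.Reads.write_loop (by simp) fun k _ => ?_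
    rw [Sum.update_elim_inr]
    exact ih _
  | succ v y F ih =>
    refine Cmd.Reads.succ ?_
    rw [Sum.update_elim_inr, Sum.update_elim_inr]
    exact ih _

theorem Fam.reads_cmd_list {τ σ : Type} {I : (Reg → ℕ) → τ → σ} {β : Base → ℕ} {E : τ → Cmd Reg}
    {e : σ → List Bool}
    (h : ∀ t η, (E t).Reads (Sum.elim β η) [] (e (I (Sum.elim β η) t))) (F : Fam τ) (η : Var → ℕ) :
    (F.cmd fun t => (Cmd.lit true).seq (E t)).Reads (Sum.elim β η) []
      ((F.den I β η).flatMap fun x => true :: e x) :=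
  Fam.reads_cmd (e := fun x => true :: e x) (fun t η => (Cmd.Reads.lit true).write_seq (h t η)) F η

section emit

variable {β : Base → ℕ}

/-- The code of an internal transition. -/
def pairCode (β : Base → ℕ) (t : Ctl ℕ × Ctl ℕ) : List Bool := t.1.code β ++ t.2.code β

/-- The code of a push transition. -/
def pushCode (β : Base → ℕ) (t : Ctl ℕ × Ctl ℕ × Sym ℕ) : List Bool :=
  t.1.code β ++ t.2.1.code β ++ t.2.2.code β

/-- The code of a pop transition. -/
def popCode (β : Base → ℕ) (t : Ctl ℕ × Option (Sym ℕ) × Ctl ℕ) : List Bool :=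
  t.1.code β ++ topCode β t.2.1 ++ t.2.2.code β

/-- The code of a control state with a top of the stack. -/
def envCode (β : Base → ℕ) (t : Ctl ℕ × Option (Sym ℕ)) : List Bool :=
  t.1.code β ++ topCode β t.2

theorem length_code_ctl (s : Ctl ℕ) : (s.code β).length =
    20 + (β .nQ + (β .nA + (β .nA + β .n1))) + (β .n + (β .nA + 5)) := by
  rw [Ctl.code, List.length_append, Ctl.length_visCode, Ctl.length_hidCode]

variable (T : ATM) (w : List (Fin T.nA))

theorem encCtrl_toVars (s : Ctl ℕ) :
    (reduction T w).encCtrl (s.toVars (baseOf T w)) = s.code (baseOf T w) := by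
  have := encSet_toSet (s.code (baseOf T w))
  rwa [length_code_ctl] at this

theorem encSym_toVars (s : Sym ℕ) :
    (reduction T w).encSym (s.toVars (baseOf T w)) = s.code (baseOf T w) := by
  have := encSet_toSet (s.code (baseOf T w))
  rwa [Sym.length_code] at this

theorem encTop_toVars (g : Option (Sym ℕ)) :
    (reduction T w).encTop (g.map (Sym.toVars (baseOf T w))) = topCode (baseOf T w) g := by
  cases g with
  | none => rfl
  | some g => exact congrArg (List.cons true) (encSym_toVars T w g)

theorem encList_map {σ τ : Type} (f : σ → τ) (e : τ → List Bool) (l : List σ) :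
    encList e (l.map f) = (l.flatMap fun x => true :: e (f x)) ++ [false] := by
  rw [encList, List.flatMap_map]

/-- The encoding of the open pushdown system, in terms of the codes of its parts. -/
theorem encode_reduction :
    (reduction T w).encode =
      let β := baseOf T w
      encNat (20 + (β .nQ + (β .nA + (β .nA + β .n1)))) ++
      encNat (β .n + (β .nA + 5)) ++
      encNat (6 + (β .n + (β .nA + β .nA))) ++ [false, true, false, true, true, false, false] ++
      ((ctlList β).flatMap fun s => true :: s.code β) ++ [false] ++
      (Ctl.init true 0).code β ++
      ((symFam.den Sym.sub β noVar).flatMap fun s => true :: s.code β) ++ [false] ++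
      ((intList T).flatMap fun t => true :: pairCode β t) ++ [false] ++
      ((pushList T w).flatMap fun t => true :: pushCode β t) ++ [false] ++
      ((popList β).flatMap fun t => true :: popCode β t) ++ [false] ++
      ([true, false] ++ (symFam.den Sym.sub β noVar).flatMap fun _ => [true, false]) ++
      ((ctlFam.den Ctl.sub β noVar).flatMap fun _ =>
        [false] ++ (symFam.den Sym.sub β noVar).flatMap fun _ => [false]) ++
      ((envFam.den envSub β noVar).flatMap fun t => true :: envCode β t) ++ [false] := by
  have hμ : (ctlFam.den Ctl.sub (baseOf T w) noVar).flatMap (fun s => (none ::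
        ((symFam.den Sym.sub (baseOf T w) noVar).map (Sym.toVars (baseOf T w))).map some).flatMap
        fun _ => encNat (if s.toVars (baseOf T w) = Ctl.good.toVars (baseOf T w) then 1 else 0)) =
      ((ctlFam.den Ctl.sub (baseOf T w) noVar).flatMap fun _ =>
        [false] ++ (symFam.den Sym.sub (baseOf T w) noVar).flatMap fun _ => [false]) := by
    refine List.flatMap_congr fun s hs => ?_
    rw [if_neg]
    · simp [List.flatMap_map, encNat]
    · intro h
      have : s = .good := Ctl.toVars_injective (mem_ctlFam.1 (.inr hs)) (mem_ctlFam.1 (.inl rfl)) h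
      exact good_notMem_ctlFam (this ▸ hs)
  have hg : (none ::
        ((symFam.den Sym.sub (baseOf T w) noVar).map (Sym.toVars (baseOf T w))).map some).flatMap
        (fun _ => encNat (if Ctl.good.toVars (baseOf T w) = Ctl.good.toVars (baseOf T w)
          then 1 else 0)) =
      [true, false] ++ (symFam.den Sym.sub (baseOf T w) noVar).flatMap fun _ => [true, false] := by
    simp [List.flatMap_map, encNat]
  have e1 : (reduction T w).encode = encNat (reduction T w).nI ++ encNat (reduction T w).nH ++
      encNat (reduction T w).nIΓ ++ [false, true, false, true, true, false, false] ++
      encList (reduction T w).encCtrl ((ctlList (baseOf T w)).map (Ctl.toVars (baseOf T w))) ++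
      (reduction T w).encCtrl ((Ctl.init true 0).toVars (baseOf T w)) ++
      encList (reduction T w).encSym
        ((symFam.den Sym.sub (baseOf T w) noVar).map (Sym.toVars (baseOf T w))) ++
      encList (fun t => (reduction T w).encCtrl t.1 ++ (reduction T w).encCtrl t.2)
        ((intList T).map (Prod.map (Ctl.toVars (baseOf T w)) (Ctl.toVars (baseOf T w)))) ++
      encList (fun t => (reduction T w).encCtrl t.1 ++ (reduction T w).encCtrl t.2.1 ++
          (reduction T w).encSym t.2.2)
        ((pushList T w).map (Prod.map (Ctl.toVars (baseOf T w))
          (Prod.map (Ctl.toVars (baseOf T w)) (Sym.toVars (baseOf T w))))) ++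
      encList (fun t => (reduction T w).encCtrl t.1 ++ (reduction T w).encTop t.2.1 ++
          (reduction T w).encCtrl t.2.2)
        ((popList (baseOf T w)).map (Prod.map (Ctl.toVars (baseOf T w))
          (Prod.map (Option.map (Sym.toVars (baseOf T w))) (Ctl.toVars (baseOf T w))))) ++
      (((ctlList (baseOf T w)).map (Ctl.toVars (baseOf T w))).flatMap fun q => (none ::
        ((symFam.den Sym.sub (baseOf T w) noVar).map (Sym.toVars (baseOf T w))).map some).flatMap
        fun _ => encNat (if q = Ctl.good.toVars (baseOf T w) then 1 else 0)) ++
      encList (fun t => (reduction T w).encCtrl t.1 ++ (reduction T w).encTop t.2)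
        ((envFam.den envSub (baseOf T w) noVar).map
          (Prod.map (Ctl.toVars (baseOf T w)) (Option.map (Sym.toVars (baseOf T w))))) := by
    simp only [OPD.encode, List.append_assoc]
    rfl
  have hm : (((ctlList (baseOf T w)).map (Ctl.toVars (baseOf T w))).flatMap fun q => (none ::
        ((symFam.den Sym.sub (baseOf T w) noVar).map (Sym.toVars (baseOf T w))).map some).flatMap
        fun _ => encNat (if q = Ctl.good.toVars (baseOf T w) then 1 else 0)) =
      [true, false] ++ ((symFam.den Sym.sub (baseOf T w) noVar).flatMap fun _ => [true, false]) ++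
      ((ctlFam.den Ctl.sub (baseOf T w) noVar).flatMap fun _ =>
        [false] ++ (symFam.den Sym.sub (baseOf T w) noVar).flatMap fun _ => [false]) := by
    rw [ctlList, List.map_cons, List.flatMap_cons, List.flatMap_map, hμ, hg]
  rw [e1, hm]
  simp only [encList_map, encCtrl_toVars, encSym_toVars, encTop_toVars, Prod.map_fst, Prod.map_snd,
    pairCode, pushCode, popCode, envCode, List.append_assoc]
  rfl

end emit

end PMC

namespace PMC
open Function (update)
open Fam

/-! ### The computation of the reduction -/

/-- Write an internal transition as an item of a list. -/
def intEmit (t : Ctl Reg × Ctl Reg) : Cmd Reg := (Cmd.lit true).seq (t.1.emit.seq t.2.emit)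

/-- Write the code of a push transition. -/
def pushEmit (t : Ctl Reg × Ctl Reg × Sym Reg) : Cmd Reg :=
  (t.1.emit.seq t.2.1.emit).seq t.2.2.emit

/-- Write the code of a pop transition. -/
def popEmit (t : Ctl Reg × Option (Sym Reg) × Ctl Reg) : Cmd Reg :=
  (t.1.emit.seq (topEmit t.2.1)).seq t.2.2.emit

/-- Write the code of a control state with a top of the stack. -/
def envEmit (t : Ctl Reg × Option (Sym Reg)) : Cmd Reg := t.1.emit.seq (topEmit t.2)

section

variable {β : Base → ℕ} {η : Var → ℕ}

theorem reads_intEmit (t : Ctl Reg × Ctl Reg) : (intEmit t).Reads (Sum.elim β η) []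
    (true :: pairCode β (t.1.map (Sum.elim β η), t.2.map (Sum.elim β η))) :=
  (Cmd.Reads.lit true).write_seq ((t.1.reads_emit β η).write_seq (t.2.reads_emit β η))

theorem reads_pushEmit (t : Ctl Reg × Ctl Reg × Sym Reg) : (pushEmit t).Reads (Sum.elim β η) []
    (pushCode β (pushSub (Sum.elim β η) t)) :=
  ((t.1.reads_emit β η).write_seq (t.2.1.reads_emit β η)).write_seq (t.2.2.reads_emit β η)

theorem reads_popEmit (t : Ctl Reg × Option (Sym Reg) × Ctl Reg) :
    (popEmit t).Reads (Sum.elim β η) [] (popCode β (popSub (Sum.elim β η) t)) :=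
  ((t.1.reads_emit β η).write_seq (reads_topEmit t.2.1 β η)).write_seq (t.2.2.reads_emit β η)

theorem reads_envEmit (t : Ctl Reg × Option (Sym Reg)) :
    (envEmit t).Reads (Sum.elim β η) [] (envCode β (envSub (Sum.elim β η) t)) :=
  (t.1.reads_emit β η).write_seq (reads_topEmit t.2 β η)

end

/-- Read the table of the universal states, and write the transitions from `header`. -/
def univCmd : Cmd Reg :=
  .loop (.inr .q) (.inl .nQ) (.readBit
    (.loop (.inr .a) (.inl .nA) (intEmit (.header (.inr .q), .select true (.inr .q) (.inr .a))))
    (.loop (.inr .a) (.inl .nA) (intEmit (.header (.inr .q), .select false (.inr .q) (.inr .a)))))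

/-- Read the table of the accepting states, and write the transitions to `chk`. -/
def accCmd : Cmd Reg :=
  .loop (.inr .q) (.inl .nQ) (.readBit (intEmit (.header (.inr .q), .chk)) .nil)

/-- Read a triple, and write the transitions that choose it. -/
def tripleCmd : Cmd Reg :=
  .readNat (.inr .c) (.readNat (.inr .b) (.readBit
    ((intEmit (.select false (.inr .q) (.inr .a), .pre true (.inr .c) (.inr .a) (.inr .b))).seq
      (intEmit (.select true (.inr .q) (.inr .a), .pre true (.inr .c) (.inr .a) (.inr .b))))
    ((intEmit (.select false (.inr .q) (.inr .a), .pre false (.inr .c) (.inr .a) (.inr .b))).seq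
      (intEmit (.select true (.inr .q) (.inr .a), .pre false (.inr .c) (.inr .a) (.inr .b))))))

/-- Read the table of the transition function, and write the transitions that choose triples. -/
def deltaCmd : Cmd Reg :=
  .loop (.inr .q) (.inl .nQ) (.loop (.inr .a) (.inl .nA) (tripleCmd.seq tripleCmd))

/-- The push transitions for a letter of the input word. -/
def letterCmd : Cmd Reg :=
  .readNat (.inr .c) (.succ (.inr .i1) (.inr .i)
    (((Cmd.lit true).seq (pushEmit (.init true (.inr .i), .init false (.inr .i1),
      .cell .arrive (.inr .c) (.inr .c)))).seq
    ((Cmd.lit true).seq (pushEmit (.init false (.inr .i), .init false (.inr .i1),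
      .cell .stay (.inr .c) (.inr .c))))))

/-- Read the input word, and write its push transitions. -/
def wordCmd : Cmd Reg := .loop (.inr .i) (.inl .n) (.readBit letterCmd letterCmd)

/-- The output of the whole open pushdown system; the input is read once more from its start. -/
def outputCmd : Cmd Reg :=
  (((Cmd.lits (List.replicate 20 true)).seq ((Cmd.trues .nQ).seq ((Cmd.trues .nA).seq
    ((Cmd.trues .nA).seq (Cmd.trues .n1))))).seq (.lit false)).seq (
  (((Cmd.trues .n).seq ((Cmd.trues .nA).seq (Cmd.lits (List.replicate 5 true)))).seq
    (.lit false)).seq (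
  (((Cmd.lits (List.replicate 6 true)).seq ((Cmd.trues .n).seq ((Cmd.trues .nA).seq
    (Cmd.trues .nA)))).seq (.lit false)).seq (
  (Cmd.lits [false, true, false, true, true, false, false]).seq (
  (((Cmd.lit true).seq (Ctl.good : Ctl Reg).emit).seq
    (ctlFam.cmd fun t => (Cmd.lit true).seq t.emit)).seq ((Cmd.lit false).seq (
  (Ctl.init true (.inl .zero) : Ctl Reg).emit.seq (
  (symFam.cmd fun t => (Cmd.lit true).seq t.emit).seq ((Cmd.lit false).seq (
  (Cmd.readNat (.inr .q) .nil).seq ((Cmd.readNat (.inr .q) .nil).seq (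
  (Cmd.readNat (.inr .q) .nil).seq ((Cmd.readNat (.inr .q) .nil).seq (
  univCmd.seq (accCmd.seq (deltaCmd.seq ((Cmd.lit false).seq (
  (pushFam.cmd fun t => (Cmd.lit true).seq (pushEmit t)).seq (wordCmd.seq ((Cmd.lit false).seq (
  ((addrPopFam.cmd fun t => (Cmd.lit true).seq (popEmit t)).seq
    (contPopFam.cmd fun t => (Cmd.lit true).seq (popEmit t))).seq ((Cmd.lit false).seq (
  ((Cmd.lits [true, false]).seq (symFam.cmd fun _ => Cmd.lits [true, false])).seq (
  (ctlFam.cmd fun _ => (Cmd.lit false).seq (symFam.cmd fun _ => .lit false)).seq (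
  (envFam.cmd fun t => (Cmd.lit true).seq (envEmit t)).seq
  (.lit false)))))))))))))))))))))))))

/-- Skip the tables of a machine. -/
def skipCmd : Cmd Reg :=
  (Cmd.loop (.inr .q) (.inl .nQ) (.readBit .nil .nil)).seq
  ((Cmd.loop (.inr .q) (.inl .nQ) (.readBit .nil .nil)).seq
  (Cmd.loop (.inr .q) (.inl .nQ) (.loop (.inr .a) (.inl .nA)
    ((Cmd.readNat (.inr .q) (.readNat (.inr .q) (.readBit .nil .nil))).seq
      (Cmd.readNat (.inr .q) (.readNat (.inr .q) (.readBit .nil .nil)))))))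

/-- The transducer that writes the open pushdown system of a machine and an input word.  In a first
pass, it determines the length of the word. -/
def reductionCmd : Cmd Reg :=
  .readNat (.inl .nA) (.readNat (.inl .nQ) (.readNat (.inl .blank) (.readNat (.inl .q0)
    (skipCmd.seq (.countFalse (.inl .n) (.succ (.inl .n1) (.inl .n)
      (Cmd.rewind.seq outputCmd)))))))

section

variable (T : ATM) (w : List (Fin T.nA)) {β : Base → ℕ} {η : Var → ℕ}

theorem flatMap_const_nil {σ τ : Type} (l : List σ) : (l.flatMap fun _ => ([] : List τ)) = [] :=
  List.flatMap_eq_nil_iff.2 fun _ _ => rfl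

theorem reads_univCmd (hA : β .nA = T.nA) (hQ : β .nQ = T.nQ) :
    univCmd.Reads (Sum.elim β η) ((List.finRange T.nQ).map T.isUniv)
      ((List.finRange T.nQ).flatMap fun q : Fin T.nQ => (List.finRange T.nA).flatMap
        fun a : Fin T.nA => true :: pairCode β (.header q, .select (T.isUniv q) q a)) := by
  rw [List.map_eq_flatMap]
  refine Cmd.Reads.loop (by exact hQ) fun q => Cmd.Reads.readBit ?_
  have h : ∀ b, (Cmd.loop (.inr .a) (.inl .nA)
      (intEmit (.header (.inr .q), .select b (.inr .q) (.inr .a)))).Reads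
      (update (Sum.elim β η) (.inr .q) q) [] ((List.finRange T.nA).flatMap
        fun a : Fin T.nA => true :: pairCode β (.header q, .select b q a)) := by
    intro b
    have := Cmd.Reads.loop (ρ := update (Sum.elim β η) (.inr .q) q) (v := .inr .a) (r := .inl .nA)
      (N := T.nA) (by exact hA) (f := fun _ => []) (g := fun a : Fin T.nA =>
        true :: pairCode β (.header q, .select b q a))
      (c := intEmit (.header (.inr .q), .select b (.inr .q) (.inr .a))) fun a => by
        rw [Sum.update_elim_inr, Sum.update_elim_inr]
        have := reads_intEmit (β := β) (η := update (update η .q q) .a a)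
          (.header (.inr .q), .select b (.inr .q) (.inr .a))
        simpa only [Ctl.map, Sum.elim_inr, Function.update_self, Function.update_of_ne, ne_eq,
      reduceCtorEq, not_false_eq_true] using this
    rwa [flatMap_const_nil] at this
  cases T.isUniv q
  · exact h false
  · exact h true

theorem reads_accCmd (hQ : β .nQ = T.nQ) :
    accCmd.Reads (Sum.elim β η) ((List.finRange T.nQ).map T.isAcc)
      ((List.finRange T.nQ).flatMap fun q : Fin T.nQ =>
        if T.isAcc q = true then true :: pairCode β (.header q, .chk) else []) := by
  rw [List.map_eq_flatMap]
  refine Cmd.Reads.loop (by exact hQ) fun q => Cmd.Reads.readBit ?_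
  cases T.isAcc q
  · exact .nil
  · rw [Sum.update_elim_inr, if_pos rfl, if_pos rfl]
    have := reads_intEmit (β := β) (η := update η .q q) (.header (.inr .q), .chk)
    simpa only [Ctl.map, Sum.elim_inr, Function.update_self, Function.update_of_ne, ne_eq,
      reduceCtorEq, not_false_eq_true] using this

theorem reads_tripleCmd (q a : ℕ) (t : Fin T.nQ × Fin T.nA × Move) (hq : η .q = q)
    (ha : η .a = a) :
    tripleCmd.Reads (Sum.elim β η) (T.encTriple t)
      ((tripleInts T q a t).flatMap fun t => true :: pairCode β t) := by
  subst hq ha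
  rw [ATM.encTriple, List.append_assoc]
  refine Cmd.Reads.readNat (Cmd.Reads.readNat (Cmd.Reads.readBit ?_))
  rw [Sum.update_elim_inr, Sum.update_elim_inr]
  have h : ∀ b u, (intEmit (.select u (.inr .q) (.inr .a),
      .pre b (.inr .c) (.inr .a) (.inr .b))).Reads
      (Sum.elim β (update (update η .c t.1) .b t.2.1)) []
      (true :: pairCode β (.select u (η .q) (η .a), .pre b t.1 (η .a) t.2.1)) := by
    intro b u
    have := reads_intEmit (β := β) (η := update (update η .c t.1) .b t.2.1)
      (.select u (.inr .q) (.inr .a), .pre b (.inr .c) (.inr .a) (.inr .b))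
    simpa only [Ctl.map, Sum.elim_inr, Function.update_self, Function.update_of_ne, ne_eq,
      reduceCtorEq, not_false_eq_true] using this
  simp only [tripleInts, List.flatMap_cons, List.flatMap_nil, List.append_nil]
  cases encMove t.2.2
  · exact (h false false).write_seq (h false true)
  · exact (h true false).write_seq (h true true)

theorem reads_deltaCmd (hA : β .nA = T.nA) (hQ : β .nQ = T.nQ) :
    deltaCmd.Reads (Sum.elim β η)
      ((List.finRange T.nQ).flatMap fun q => (List.finRange T.nA).flatMap fun a =>
        T.encTriple (T.δ q a).1 ++ T.encTriple (T.δ q a).2)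
      ((List.finRange T.nQ).flatMap fun q : Fin T.nQ => (List.finRange T.nA).flatMap
        fun a : Fin T.nA => ((tripleInts T q a (T.δ q a).1 ++ tripleInts T q a (T.δ q a).2).flatMap
          fun t => true :: pairCode β t)) := by
  refine Cmd.Reads.loop (by exact hQ) fun q => Cmd.Reads.loop (by exact hA) fun a => ?_
  rw [Sum.update_elim_inr, Sum.update_elim_inr, List.flatMap_append]
  exact (reads_tripleCmd T q a _ rfl rfl).seq
    (reads_tripleCmd T q a _ rfl rfl)

theorem reads_wordCmd (hn : β .n = w.length) :
    wordCmd.Reads (Sum.elim β η) (w.flatMap fun a => true :: encNat a.val)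
      ((wordPush T w).flatMap fun t => true :: pushCode β t) := by
  have e : (w.flatMap fun a => true :: encNat a.val) =
      (List.finRange w.length).flatMap fun k => true :: encNat (w.get k).val := by
    conv_lhs => rw [← List.map_get_finRange w, List.flatMap_map]
  rw [e, wordPush, List.flatMap_assoc]
  refine Cmd.Reads.loop (by exact hn) fun k => Cmd.Reads.readBit ?_
  rw [if_pos rfl, ← List.append_nil (encNat _)]
  refine Cmd.Reads.readNat (Cmd.Reads.succ ?_)
  rw [Sum.update_elim_inr, Sum.update_elim_inr, Sum.update_elim_inr, Sum.update_elim_inr]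
  simp only [List.flatMap_cons, List.flatMap_nil, List.append_nil]
  refine Cmd.Reads.write_seq (o := _ :: _) ((Cmd.Reads.lit true).write_seq ?_)
    ((Cmd.Reads.lit true).write_seq ?_)
  · have := reads_pushEmit (β := β) (η := update (update (update η .i k) .c (w.get k)) .i1 (k + 1))
      (.init true (.inr .i), .init false (.inr .i1), .cell .arrive (.inr .c) (.inr .c))
    simp only [pushSub, Ctl.map, Sym.map, Sum.elim_inr, Function.update_self,
      Function.update_of_ne, ne_eq, reduceCtorEq, not_false_eq_true] at this
    exact this
  · have := reads_pushEmit (β := β) (η := update (update (update η .i k) .c (w.get k)) .i1 (k + 1))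
      (.init false (.inr .i), .init false (.inr .i1), .cell .stay (.inr .c) (.inr .c))
    simp only [pushSub, Ctl.map, Sym.map, Sum.elim_inr, Function.update_self,
      Function.update_of_ne, ne_eq, reduceCtorEq, not_false_eq_true] at this
    exact this

theorem reads_skipNat (m : ℕ) (ρ : Reg → ℕ) :
    (Cmd.readNat (.inr .q) .nil : Cmd Reg).Reads ρ (encNat m) [] := by
  have := Cmd.Reads.readNat (x := (.inr .q : Reg)) (m := m) (ρ := ρ) .nil
  rwa [List.append_nil] at this

theorem reads_skipCmd (hA : β .nA = T.nA) (hQ : β .nQ = T.nQ) :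
    skipCmd.Reads (Sum.elim β η) ((List.finRange T.nQ).map T.isUniv ++
      ((List.finRange T.nQ).map T.isAcc ++
      (List.finRange T.nQ).flatMap fun q => (List.finRange T.nA).flatMap fun a =>
        T.encTriple (T.δ q a).1 ++ T.encTriple (T.δ q a).2)) [] := by
  have hb : ∀ (b : Bool) (ρ : Reg → ℕ), (Cmd.readBit .nil .nil : Cmd Reg).Reads ρ [b] [] := by
    intro b ρ
    refine Cmd.Reads.readBit ?_
    rw [ite_self]
    exact .nil
  have h1 : ∀ f : Fin T.nQ → Bool, (Cmd.loop (.inr .q) (.inl .nQ) (.readBit .nil .nil)).Reads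
      (Sum.elim β η) ((List.finRange T.nQ).map f) [] := by
    intro f
    have := Cmd.Reads.loop (ρ := Sum.elim β η) (v := .inr .q) (r := .inl .nQ) (N := T.nQ)
      (by exact hQ) (c := .readBit .nil .nil) (f := fun q => [f q]) (g := fun _ => [])
      fun q => hb _ _
    rwa [flatMap_const_nil, ← List.map_eq_flatMap] at this
  have h2 : ∀ (t : Fin T.nQ × Fin T.nA × Move) (ρ : Reg → ℕ),
      (Cmd.readNat (.inr .q) (.readNat (.inr .q) (.readBit .nil .nil)) : Cmd Reg).Reads ρ
        (T.encTriple t) [] := by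
    intro t ρ
    rw [ATM.encTriple, List.append_assoc]
    exact Cmd.Reads.readNat (Cmd.Reads.readNat (hb _ _))
  have h3 := Cmd.Reads.loop (ρ := Sum.elim β η) (v := .inr .q) (r := .inl .nQ) (N := T.nQ)
      (by exact hQ) (g := fun _ => (List.finRange T.nA).flatMap fun _ => [] ++ [])
      (f := fun q => (List.finRange T.nA).flatMap fun a =>
        T.encTriple (T.δ q a).1 ++ T.encTriple (T.δ q a).2)
      fun q => Cmd.Reads.loop (v := .inr .a) (r := .inl .nA) (by exact hA)
        fun a => (h2 (T.δ q a).1 _).seq (h2 (T.δ q a).2 _)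
  have e : ((List.finRange T.nQ).flatMap fun _ => (List.finRange T.nA).flatMap
      fun _ => [] ++ []) = ([] : List Bool) := by simp
  rw [e] at h3
  exact (h1 _).seq ((h1 _).seq h3)

theorem Fam.flatMap_const_den {τ σ υ : Type} {I : (Reg → ℕ) → τ → σ} {β : Base → ℕ}
    {l : List υ} {F : Fam τ} (η η' : Var → ℕ) :
    (F.den I β η).flatMap (fun _ => l) = (F.den I β η').flatMap fun _ => l := by
  induction F generalizing η η' with
  | items s => simp only [Fam.den, List.flatMap_map]
  | app F G ihF ihG => simp only [Fam.den, List.flatMap_append, ihF η η', ihG η η']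
  | loop v N F ih =>
    simp only [Fam.den, List.flatMap_assoc]
    exact List.flatMap_congr fun k _ => ih _ _
  | succ v y F ih => exact ih _ _

theorem reads_outputCmd : outputCmd.Reads (Sum.elim (baseOf T w) noVar)
    (T.encode ++ w.flatMap fun a => true :: encNat a.val) (reduction T w).encode := by
  set β := baseOf T w with hβ
  have t : ∀ N : Base, (Cmd.trues N).Reads (Sum.elim β noVar) [] (List.replicate (β N) true) :=
    fun N => Cmd.reads_trues N β noVar
  have l : ∀ l : List Bool, (Cmd.lits l).Reads (Sum.elim β noVar) [] l := fun l =>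
    Cmd.reads_lits l _
  have f : (Cmd.lit false).Reads (Sum.elim β noVar) [] [false] := .lit false
  have n1 : (((Cmd.lits (List.replicate 20 true)).seq ((Cmd.trues .nQ).seq ((Cmd.trues .nA).seq
      ((Cmd.trues .nA).seq (Cmd.trues .n1))))).seq (.lit false)).Reads (Sum.elim β noVar) []
      (encNat (20 + (β .nQ + (β .nA + (β .nA + β .n1))))) := by
    simp only [encNat, ← List.replicate_append_replicate]
    exact ((l _).write_seq ((t _).write_seq ((t _).write_seq ((t _).write_seq (t _))))).write_seq f
  have n2 : (((Cmd.trues .n).seq ((Cmd.trues .nA).seq (Cmd.lits (List.replicate 5 true)))).seq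
      (.lit false)).Reads (Sum.elim β noVar) [] (encNat (β .n + (β .nA + 5))) := by
    simp only [encNat, ← List.replicate_append_replicate]
    exact ((t _).write_seq ((t _).write_seq (l _))).write_seq f
  have n3 : (((Cmd.lits (List.replicate 6 true)).seq ((Cmd.trues .n).seq ((Cmd.trues .nA).seq
      (Cmd.trues .nA)))).seq (.lit false)).Reads (Sum.elim β noVar) []
      (encNat (6 + (β .n + (β .nA + β .nA)))) := by
    simp only [encNat, ← List.replicate_append_replicate]
    exact ((l _).write_seq ((t _).write_seq ((t _).write_seq (t _)))).write_seq f
  have hg : Ctl.good.emit.Reads (Sum.elim β noVar) [] (Ctl.good.code β) :=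
    Ctl.reads_emit .good β noVar
  have h0 : (Ctl.init true (.inl .zero)).emit.Reads (Sum.elim β noVar) []
    ((Ctl.init true 0).code β) := Ctl.reads_emit (.init true (.inl .zero)) β noVar
  have key := n1.write_seq (n2.write_seq (n3.write_seq (
    (l [false, true, false, true, true, false, false]).write_seq (
    (((Cmd.Reads.lit true).write_seq hg).write_seq (Fam.reads_cmd_list (I := Ctl.sub)
      (fun s η => s.reads_emit β η) ctlFam noVar)).write_seq (f.write_seq (h0.write_seq (
    (Fam.reads_cmd_list (I := Sym.sub) (fun s η => s.reads_emit β η) symFam noVar).write_seq (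
    f.write_seq ((reads_skipNat T.nA _).seq ((reads_skipNat T.nQ _).seq (
    (reads_skipNat T.blank _).seq ((reads_skipNat T.q0 _).seq (
    (reads_univCmd T (η := noVar) (β := β) rfl rfl).seq (
    (reads_accCmd T (η := noVar) (β := β) rfl).seq (
    (reads_deltaCmd T (η := noVar) (β := β) rfl rfl).seq (f.write_seq (
    (Fam.reads_cmd_list (I := pushSub) (e := pushCode β) (fun t η => reads_pushEmit t) pushFam
      noVar).write_seq ((reads_wordCmd T w (η := noVar) (β := β) rfl).seq (f.write_seq (
    ((Fam.reads_cmd_list (I := popSub) (e := popCode β) (fun t η => reads_popEmit t) addrPopFam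
      noVar).write_seq (Fam.reads_cmd_list (I := popSub) (e := popCode β)
      (fun t η => reads_popEmit t) contPopFam noVar)).write_seq (f.write_seq (
    ((l [true, false]).write_seq (Fam.reads_cmd (I := Sym.sub) (e := fun _ => [true, false])
      (fun t η => Cmd.reads_lits _ _) symFam noVar)).write_seq (
    (Fam.reads_cmd (I := Ctl.sub) (e := fun _ => [false] ++
      (symFam.den Sym.sub β noVar).flatMap fun _ => [false])
      (fun t η => (Cmd.Reads.lit false).write_seq (by
        rw [Fam.flatMap_const_den noVar η]
        exact Fam.reads_cmd (I := Sym.sub) (e := fun _ => [false]) (fun t η => .lit false)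
          symFam η)) ctlFam noVar).write_seq (
    (Fam.reads_cmd_list (I := envSub) (e := envCode β) (fun t η => reads_envEmit t) envFam
      noVar).write_seq f))))))))))))))))))))))))
  have hi : ((intList T).flatMap fun t => true :: pairCode β t) =
      ((List.finRange T.nQ).flatMap fun q : Fin T.nQ => (List.finRange T.nA).flatMap
        fun a : Fin T.nA => true :: pairCode β (.header q, .select (T.isUniv q) q a)) ++
      (((List.finRange T.nQ).flatMap fun q : Fin T.nQ =>
        if T.isAcc q = true then true :: pairCode β (.header q, .chk) else []) ++
      (List.finRange T.nQ).flatMap fun q : Fin T.nQ => (List.finRange T.nA).flatMap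
        fun a : Fin T.nA => ((tripleInts T q a (T.δ q a).1 ++ tripleInts T q a (T.δ q a).2).flatMap
          fun t => true :: pairCode β t)) := by
    simp only [intList, List.flatMap_append, List.flatMap_assoc, List.append_assoc,
      List.flatMap_singleton]
    congr 2
    refine List.flatMap_congr fun q _ => ?_
    split <;> simp
  rw [encode_reduction]
  simp only [hi, ← hβ]
  suffices h : ∀ {u u' o o' : List Bool}, u' = u → o' = o →
      outputCmd.Reads (Sum.elim β noVar) u o → outputCmd.Reads (Sum.elim β noVar) u' o' by
    refine h ?_ ?_ key
    · simp only [ATM.encode, List.append_assoc, List.append_nil]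
    · simp only [pushList, popList, List.flatMap_append, List.append_assoc, List.nil_append,
        List.cons_append, ctlList, List.flatMap_cons, ← hβ]
  rintro _ _ _ _ rfl rfl h
  exact h

/-- A program whose first pass reads the header, skips the tables and measures the word. -/
theorem run_twoPass {c d : Cmd Reg} {a b u v : ℕ} {tables word full o rest : List Bool}
    (hf : full = encNat a ++ (encNat b ++ (encNat u ++ (encNat v ++ (tables ++ word)))))
    (hc : ∀ β : Base → ℕ, β .nA = a → β .nQ = b → c.Reads (Sum.elim β noVar) tables [])
    (hd : ∀ β : Base → ℕ, β .zero = 0 → β .nA = a → β .nQ = b → β .blank = u → β .q0 = v →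
      β .n = word.count false - 1 → β .n1 = word.count false - 1 + 1 →
      d.run (Sum.elim β noVar) full full = (o, rest)) :
    ((Cmd.readNat (.inl .nA) (.readNat (.inl .nQ) (.readNat (.inl .blank) (.readNat (.inl .q0)
      (c.seq (.countFalse (.inl .n) (.succ (.inl .n1) (.inl .n) (Cmd.rewind.seq d)))))))).run
      (fun _ => 0) full full).1 = o := by
  have h0 : (fun _ : Reg => 0) = Sum.elim (fun _ => 0) noVar := by
    funext r; cases r <;> rfl
  rw [h0]
  nth_rw 2 [hf]
  rw [Cmd.run_readNat, Cmd.run_readNat, Cmd.run_readNat, Cmd.run_readNat]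
  simp only [Sum.update_elim_inl, Cmd.run]
  rw [hc _ rfl rfl]
  simp only [Sum.elim_inl, List.nil_append]
  rw [hd _ rfl rfl rfl rfl rfl rfl rfl]

/-- The transducer computes the reduction. -/
theorem run_reductionCmd : (reductionCmd.run (fun _ => 0) (encodeInput ⟨T, w⟩)
    (encodeInput ⟨T, w⟩)).1 = (reduction T w).encode := by
  have hc : ((w.flatMap fun a => true :: encNat a.val) ++ [false]).count false - 1 = w.length := by
    have : ∀ l : List (Fin T.nA), (l.flatMap fun a => true :: encNat a.val).count false =
        l.length := by
      intro l
      induction l with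
      | nil => rfl
      | cons a l ih =>
        rw [List.flatMap_cons, List.count_append, ih, List.length_cons, Nat.add_comm]
        simp [encNat, List.count_replicate]
    rw [List.count_append, this]
    rfl
  have e : encodeInput ⟨T, w⟩ = encNat T.nA ++ (encNat T.nQ ++ (encNat T.blank ++ (encNat T.q0 ++
      (((List.finRange T.nQ).map T.isUniv ++ ((List.finRange T.nQ).map T.isAcc ++
      (List.finRange T.nQ).flatMap fun q => (List.finRange T.nA).flatMap fun a =>
        T.encTriple (T.δ q a).1 ++ T.encTriple (T.δ q a).2)) ++
      ((w.flatMap fun a => true :: encNat a.val) ++ [false]))))) := by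
    simp only [encodeInput, ATM.encode, encList, List.append_assoc]
  have e' : encodeInput ⟨T, w⟩ =
      (T.encode ++ w.flatMap fun a => true :: encNat a.val) ++ [false] := by
    simp only [encodeInput, encList, List.append_assoc]
  have ho := reads_outputCmd T w (encodeInput ⟨T, w⟩) [false]
  rw [← e'] at ho
  refine run_twoPass e (fun β hA hQ => reads_skipCmd T hA hQ) (rest := [false]) ?_
  intro β h1 h2 h3 h4 h5 h6 h7
  have : β = baseOf T w := by
    rw [hc] at h6 h7
    funext r
    cases r <;> assumption
  rw [this, ho]

end

theorem reduction_computable : Nonempty (Turing.TM2ComputableInPolyTime encodeInput OPD.encode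
    fun x : Σ T : ATM, List (Fin T.nA) => reduction x.1 x.2) :=
  reductionCmd.nonempty_computableInPolyTime fun x => run_reductionCmd x.1 x.2

end PMC

namespace PMC

/-! ### Strategy trees on which a proposition holds eventually -/

namespace OpenKripke

variable (M : OpenKripke)

/-- On every full path from a node of the tree `ST`, the proposition `1` holds eventually. -/
inductive Eventually (ST : Set M.Node) : M.Node → Prop
  | here {x : M.Node} (h : 1 ∈ M.L x.1) : Eventually ST x
  | step {x : M.Node} (h : ∃ y, M.childIn ST x y) (h' : ∀ y, M.childIn ST x y → Eventually ST y) :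
      Eventually ST x

/-- There is a strategy tree on which the proposition `1` holds eventually. -/
def Wins : Prop := ∃ ST, M.IsStrategyTree M.init ST ∧ M.Eventually ST (M.init, [])

variable {M}

theorem treeSat_iff_eventually {s : M.State} {ST : Set M.Node} :
    M.TreeSat s ST (.AU .tt (.prop 1)) ↔ M.Eventually ST (s, []) := by
  change (∀ (len : ℕ∞) (π : ℕ → M.Node), CTL.IsFullPath (M.childIn ST) (s, []) len π →
      ∃ i : ℕ, (i : ℕ∞) < len ∧ 1 ∈ M.L (π i).1 ∧ ∀ j < i, True) ↔ _
  constructor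
  · intro h
    by_contra hs
    classical
    -- a node from which `1` may be avoided has a child of this kind, or no child at all
    let next : M.Node → M.Node := fun x =>
      if h : ∃ y, M.childIn ST x y ∧ ¬ M.Eventually ST y then h.choose else x
    let π : ℕ → M.Node := fun i => next^[i] (s, [])
    have hπ : ∀ i, π (i + 1) = next (π i) := fun i => Function.iterate_succ_apply' _ _ _
    have hnext : ∀ x, ¬ M.Eventually ST x → ¬ M.Eventually ST (next x) := by
      intro x hx
      by_cases h : ∃ y, M.childIn ST x y ∧ ¬ M.Eventually ST y
      · simp only [next, dif_pos h]
        exact h.choose_spec.2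
      · simpa only [next, dif_neg h] using hx
    have hbad : ∀ i, ¬ M.Eventually ST (π i) := by
      intro i
      induction i with
      | zero => exact hs
      | succ i ih => rw [hπ]; exact hnext _ ih
    have hchild : ∀ i, (∃ y, M.childIn ST (π i) y) → M.childIn ST (π i) (π (i + 1)) := by
      intro i hi
      have h : ∃ y, M.childIn ST (π i) y ∧ ¬ M.Eventually ST y := by
        by_contra hc
        push Not at hc
        exact hbad i (.step hi hc)
      rw [hπ]
      simp only [next, dif_pos h]
      exact h.choose_spec.1
    have hex : ∃ len, CTL.IsFullPath (M.childIn ST) (s, []) len π := by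
      by_cases hd : ∃ i, ∀ y, ¬ M.childIn ST (π i) y
      · refine ⟨((Nat.find hd + 1 : ℕ) : ℕ∞), by exact_mod_cast Nat.succ_pos _, rfl, ?_, ?_⟩
        · intro i hi
          have hi : i + 1 < Nat.find hd + 1 := by exact_mod_cast hi
          have := Nat.find_min hd (m := i) (by omega)
          push Not at this
          exact hchild i this
        · intro i hi
          have hi : Nat.find hd + 1 = i + 1 := by exact_mod_cast hi
          have : i = Nat.find hd := by omega
          rw [this]
          exact Nat.find_spec hd
      · push Not at hd
        refine ⟨⊤, ENat.top_pos, rfl, fun i _ => hchild i (hd i), ?_⟩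
        intro i hi
        exact absurd hi (ENat.top_ne_natCast _)
    obtain ⟨len, hlen⟩ := hex
    obtain ⟨i, -, hi, -⟩ := h len π hlen
    exact hbad i (.here hi)
  · intro h
    generalize (s, []) = x at h
    induction h with
    | here h =>
      rintro len π ⟨h0, h1, -, -⟩
      exact ⟨0, by exact_mod_cast h0, h1 ▸ h, fun _ _ => trivial⟩
    | @step x h h' ih =>
      rintro len π ⟨h0, h1, h2, h3⟩
      have hlen : ((0 + 1 : ℕ) : ℕ∞) < len := by
        refine lt_of_le_of_ne (by exact_mod_cast Order.one_le_iff_pos.2 h0) fun hc => ?_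
        obtain ⟨y, hy⟩ := h
        exact h3 0 hc.symm y (h1 ▸ hy)
      obtain ⟨len', rfl⟩ : ∃ len', len = len' + 1 := by
        cases len with
        | top => exact ⟨⊤, rfl⟩
        | coe m =>
          have : 1 < m := by exact_mod_cast hlen
          exact ⟨(m - 1 : ℕ), by exact_mod_cast (Nat.sub_add_cancel this.le).symm⟩
      have hc : ∀ i : ℕ, ((i + 1 : ℕ) : ℕ∞) < len' + 1 ↔ (i : ℕ∞) < len' := by
        intro i
        rw [Nat.cast_add, Nat.cast_one, ENat.add_lt_add_iff_right ENat.one_ne_top]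
      obtain ⟨i, hi, hi', -⟩ := ih (π 1) (h1 ▸ h2 0 hlen) len' (fun i => π (i + 1))
        ⟨by exact_mod_cast (hc 0).1 hlen, rfl, fun i hi => h2 (i + 1) ((hc _).2 hi), fun i hi =>
          h3 (i + 1) (by rw [hi]; push_cast; rfl)⟩
      exact ⟨i + 1, (hc i).2 hi, hi', fun _ _ => trivial⟩

theorem IsNode.of_cons {s t t' : M.State} {h : List M.State} (hn : M.IsNode s (t', t :: h)) :
    M.IsNode s (t, h) ∧ M.R t t' := by
  cases hn with
  | child hn hR => exact ⟨hn, hR⟩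

section transfer

variable {K : OpenKripke} {ι : M.State → K.State}

/-- The image of a node. -/
def mapNode (ι : M.State → K.State) (x : M.Node) : K.Node := (ι x.1, x.2.map ι)

theorem mapNode_injective (hι : Function.Injective ι) : Function.Injective (mapNode ι) := by
  rintro ⟨s, h⟩ ⟨s', h'⟩ e
  have e1 : ι s = ι s' := congrArg Prod.fst e
  have e2 : h.map ι = h'.map ι := congrArg Prod.snd e
  rw [hι e1, List.map_injective_iff.2 hι e2]

theorem isNode_mapNode (hR : ∀ s s', M.R s s' ↔ K.R (ι s) (ι s')) {s : M.State} {x : M.Node}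
    (hx : M.IsNode s x) : K.IsNode (ι s) (mapNode ι x) := by
  induction hx with
  | root => exact .root
  | child hn h ih => exact .child ih ((hR _ _).1 h)

theorem exists_isNode (hR : ∀ s s', M.R s s' ↔ K.R (ι s) (ι s'))
    (hlift : ∀ s y, K.R (ι s) y → ∃ s', ι s' = y) {s : M.State} {y : K.Node}
    (hy : K.IsNode (ι s) y) : ∃ x, M.IsNode s x ∧ mapNode ι x = y := by
  induction hy with
  | root => exact ⟨_, .root, rfl⟩
  | child hn h ih =>
    obtain ⟨⟨t, l⟩, hx, e⟩ := ih
    obtain ⟨e1, e2⟩ := Prod.mk.inj e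
    subst e1 e2
    obtain ⟨t', rfl⟩ := hlift _ _ h
    exact ⟨(t', t :: l), .child hx ((hR _ _).2 h), rfl⟩

theorem visHist_mapNode_iff (hι : ∀ s s', M.indist s s' ↔ K.indist (ι s) (ι s')) {x y : M.Node} :
    K.visHist (mapNode ι x) = K.visHist (mapNode ι y) ↔ M.visHist x = M.visHist y := by
  let g : Quotient M.indist → Quotient K.indist :=
    Quotient.map ι fun s s' h => (hι s s').1 h
  have hg : Function.Injective g := by
    intro a b
    induction a using Quotient.inductionOn
    induction b using Quotient.inductionOn
    intro h
    exact Quotient.sound ((hι _ _).2 (Quotient.exact h))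
  have e : ∀ x : M.Node, K.visHist (mapNode ι x) = (M.visHist x).map g := by
    intro x
    simp [visHist, mapNode, g, Function.comp_def]
  rw [e, e, List.map_injective_iff.2 hg |>.eq_iff]

theorem eventually_mapNode_iff (hι : Function.Injective ι)
    (hL : ∀ s, 1 ∈ M.L s ↔ 1 ∈ K.L (ι s)) {ST : Set K.Node}
    (hST : ∀ y ∈ ST, ∃ x, mapNode ι x = y) {x : M.Node} :
    M.Eventually (mapNode ι ⁻¹' ST) x ↔ K.Eventually ST (mapNode ι x) := by
  have hc : ∀ x y, M.childIn (mapNode ι ⁻¹' ST) x y ↔ K.childIn ST (mapNode ι x) (mapNode ι y) := by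
    intro x y
    simp only [childIn, Set.mem_preimage]
    refine and_congr_right fun _ => and_congr_right fun _ => ?_
    exact (List.map_injective_iff.2 hι).eq_iff.symm
  constructor
  · intro h
    induction h with
    | here h => exact .here ((hL _).1 h)
    | step h _ ih =>
      obtain ⟨y, hy⟩ := h
      refine .step ⟨_, (hc _ _).1 hy⟩ fun z hz => ?_
      obtain ⟨z, rfl⟩ := hST z hz.2.1
      exact ih z ((hc _ _).2 hz)
  · intro h
    generalize hy : mapNode ι x = y at h
    induction h generalizing x with
    | here h =>
      subst hy
      exact .here ((hL _).2 h)
    | step h _ ih =>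
      subst hy
      obtain ⟨z, hz⟩ := h
      obtain ⟨z, rfl⟩ := hST z hz.2.1
      exact .step ⟨z, (hc _ _).2 hz⟩ fun y hy => ih _ ((hc _ _).1 hy) rfl

/-- Winning is invariant under an isomorphism onto a part that is closed under transitions. -/
theorem wins_iff_of_embedding (hι : Function.Injective ι) (hinit : ι M.init = K.init)
    (hR : ∀ s s', M.R s s' ↔ K.R (ι s) (ι s')) (hlift : ∀ s y, K.R (ι s) y → ∃ s', ι s' = y)
    (henv : ∀ s, s ∈ M.env ↔ ι s ∈ K.env) (hL : ∀ s, 1 ∈ M.L s ↔ 1 ∈ K.L (ι s))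
    (hind : ∀ s s', M.indist s s' ↔ K.indist (ι s) (ι s')) : M.Wins ↔ K.Wins := by
  have hinj := mapNode_injective hι
  have hroot : mapNode ι (M.init, []) = (K.init, []) := by simp [mapNode, hinit]
  have hnode : ∀ {x}, M.IsNode M.init x → K.IsNode K.init (mapNode ι x) := fun h =>
    hinit ▸ isNode_mapNode hR h
  have hnode' : ∀ {y}, K.IsNode K.init y → ∃ x, M.IsNode M.init x ∧ mapNode ι x = y := fun h =>
    exists_isNode hR hlift (hinit.symm ▸ h)
  have hnode'' : ∀ {x}, K.IsNode K.init (mapNode ι x) → M.IsNode M.init x := fun h => by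
    obtain ⟨x', hx', e⟩ := hnode' h
    rwa [← hinj e]
  constructor
  · rintro ⟨ST, h, he⟩
    have hpre : mapNode ι ⁻¹' (mapNode ι '' ST) = ST := Set.preimage_image_eq _ hinj
    refine ⟨mapNode ι '' ST, ⟨⟨_, h.root_mem, hroot⟩, ?_, ?_, ?_, ?_, ?_⟩, ?_⟩
    · rintro _ ⟨x, hx, rfl⟩
      exact hnode (h.contained x hx)
    · rintro t t' l ⟨⟨s', _ | ⟨s, l'⟩⟩, hx, e⟩
      · simp [mapNode] at e
      · obtain ⟨rfl, rfl⟩ : ι s = t ∧ l'.map ι = l := List.cons.inj (congrArg Prod.snd e)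
        exact ⟨(s, l'), h.prefix_closed _ _ _ hx, rfl⟩
    · rintro t t' l ⟨⟨s, l'⟩, hx, e⟩ ht hR'
      obtain ⟨rfl, rfl⟩ := Prod.mk.inj e
      obtain ⟨s', rfl⟩ := hlift _ _ hR'
      exact ⟨(s', s :: l'), h.system _ _ _ hx (fun hs => ht ((henv _).1 hs)) ((hR _ _).2 hR'), rfl⟩
    · rintro t l ⟨⟨s, l'⟩, hx, e⟩ ht ⟨t', hR'⟩
      obtain ⟨rfl, rfl⟩ := Prod.mk.inj e
      obtain ⟨s', rfl⟩ := hlift _ _ hR'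
      obtain ⟨s'', hs''⟩ := h.environment _ _ hx ((henv _).2 ht) ⟨s', (hR _ _).2 hR'⟩
      exact ⟨ι s'', (s'', s :: l'), hs'', rfl⟩
    · intro x₁ x₂ h₁ h₂ e
      obtain ⟨y₁, hy₁, rfl⟩ := hnode' h₁
      obtain ⟨y₂, hy₂, rfl⟩ := hnode' h₂
      rw [hinj.mem_set_image, hinj.mem_set_image]
      exact h.uniform _ _ hy₁ hy₂ ((visHist_mapNode_iff hind).1 e)
    · rw [← hroot, ← eventually_mapNode_iff hι hL, hpre]
      · exact he
      · rintro _ ⟨x, -, rfl⟩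
        exact ⟨x, rfl⟩
  · rintro ⟨ST, h, he⟩
    refine ⟨mapNode ι ⁻¹' ST, ⟨?_, ?_, ?_, ?_, ?_, ?_⟩, ?_⟩
    · rw [Set.mem_preimage, hroot]
      exact h.root_mem
    · exact fun x hx => hnode'' (h.contained _ hx)
    · exact fun t t' l hx => h.prefix_closed _ _ _ hx
    · exact fun t t' l hx ht hR' =>
        h.system _ _ _ hx (fun hs => ht ((henv _).2 hs)) ((hR _ _).1 hR')
    · rintro t l hx ht ⟨t', hR'⟩
      obtain ⟨y, hy⟩ := h.environment _ _ hx ((henv _).1 ht) ⟨_, (hR _ _).1 hR'⟩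
      obtain ⟨s', rfl⟩ := hlift _ _ (h.contained _ hy).of_cons.2
      exact ⟨s', hy⟩
    · exact fun x₁ x₂ h₁ h₂ e =>
        h.uniform _ _ (hnode h₁) (hnode h₂) ((visHist_mapNode_iff hind).2 e)
    · rw [eventually_mapNode_iff hι hL, hroot]
      · exact he
      · intro y hy
        obtain ⟨x, -, e⟩ := hnode' (h.contained _ hy)
        exact ⟨x, e⟩

end transfer

end OpenKripke

end PMC

namespace PMC

/-! ### The open Kripke structure in terms of symbols and states -/

/-- The visible part of a control state. -/
def Ctl.vis (s : Ctl ℕ) : ℕ × Option ℕ × Option ℕ × Option ℕ × Option ℕ :=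
  (s.tag, s.st, s.fst, s.snd, s.pos)

/-- A control state and a stack content. -/
abbrev Pos : Type := Ctl ℕ × List (Sym ℕ)

variable (T : ATM) (w : List (Fin T.nA))

/-- The transitions. -/
inductive Trans : Pos → Pos → Prop
  | int {s s' α} (h : (s, s') ∈ intList T) : Trans (s, α) (s', α)
  | push {s s' g α} (h : (s, s', g) ∈ pushList T w) : Trans (s, α) (s', g :: α)
  | popBot {s s'} (h : (s, none, s') ∈ popList (baseOf T w)) : Trans (s, []) (s', [])
  | pop {s s' g α} (h : (s, some g, s') ∈ popList (baseOf T w)) : Trans (s, g :: α) (s', α)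

/-- The open Kripke structure of positions. -/
def game : OpenKripke where
  State := Pos
  env := {p | p.1.isEnv = true}
  init := (.init true 0, [])
  R := Trans T w
  L p := {i | i = 1 ∧ p.1 = .good}
  indist := Setoid.ker fun p => (p.1.vis, p.2)

section decode

variable {β : Base → ℕ}

open Classical in
/-- The control state with a given set of variables. -/
noncomputable def Ctl.ofVars (β : Base → ℕ) (v : Finset ℕ) : Ctl ℕ :=
  if h : ∃ s : Ctl ℕ, s.InRange β ∧ s.toVars β = v then h.choose else .bad

open Classical in
/-- The stack symbol with a given set of variables. -/
noncomputable def Sym.ofVars (β : Base → ℕ) (v : Finset ℕ) : Sym ℕ :=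
  if h : ∃ s : Sym ℕ, s.InRange β ∧ s.toVars β = v then h.choose else .mark

theorem Ctl.ofVars_toVars {s : Ctl ℕ} (hs : s.InRange β) : Ctl.ofVars β (s.toVars β) = s := by
  have h : ∃ t : Ctl ℕ, t.InRange β ∧ t.toVars β = s.toVars β := ⟨s, hs, rfl⟩
  rw [Ctl.ofVars, dif_pos h]
  exact Ctl.toVars_injective h.choose_spec.1 hs h.choose_spec.2

theorem Sym.ofVars_toVars {s : Sym ℕ} (hs : s.InRange β) : Sym.ofVars β (s.toVars β) = s := by
  have h : ∃ t : Sym ℕ, t.InRange β ∧ t.toVars β = s.toVars β := ⟨s, hs, rfl⟩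
  rw [Sym.ofVars, dif_pos h]
  exact Sym.toVars_injective h.choose_spec.1 hs h.choose_spec.2

theorem map_ofVars_toVars {l : List (Sym ℕ)} (hl : ∀ γ ∈ l, γ.InRange β) :
    (l.map (Sym.toVars β)).map (Sym.ofVars β) = l := by
  rw [List.map_map]
  exact (List.map_congr_left fun γ hγ => Sym.ofVars_toVars (hl γ hγ)).trans (List.map_id l)

end decode

variable {T w}

theorem exists_ctl_eq {v : Finset ℕ} (h : v ∈ (reduction T w).Q) :
    ∃ s : Ctl ℕ, s.InRange (baseOf T w) ∧ s.toVars (baseOf T w) = v := by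
  obtain ⟨s, hs, e⟩ := List.mem_map.1 h
  exact ⟨s, mem_ctlList.1 hs, e⟩

theorem exists_sym_eq {v : Finset ℕ} (h : v ∈ (reduction T w).Γ) :
    ∃ s : Sym ℕ, s.InRange (baseOf T w) ∧ s.toVars (baseOf T w) = v := by
  obtain ⟨s, hs, e⟩ := List.mem_map.1 h
  exact ⟨s, mem_symFam.1 hs, e⟩

theorem exists_stack_eq {l : List (Finset ℕ)} (h : ∀ v ∈ l, v ∈ (reduction T w).Γ) :
    ∃ α : List (Sym ℕ), (∀ γ ∈ α, γ.InRange (baseOf T w)) ∧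
      α.map (Sym.toVars (baseOf T w)) = l := by
  induction l with
  | nil => exact ⟨[], by simp, rfl⟩
  | cons v l ih =>
    obtain ⟨α, hα, rfl⟩ := ih fun v hv => h v (List.mem_cons_of_mem _ hv)
    obtain ⟨s, hs, rfl⟩ := exists_sym_eq (h v List.mem_cons_self)
    exact ⟨s :: α, List.forall_mem_cons.2 ⟨hs, hα⟩, rfl⟩

/-- The position of a configuration. -/
noncomputable def position (c : (reduction T w).Config) : Pos :=
  (.ofVars (baseOf T w) c.ctrl, c.stack.map (Sym.ofVars (baseOf T w)))

/-- A position within the bounds of the instance. -/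
def InRange (T : ATM) (w : List (Fin T.nA)) (p : Pos) : Prop :=
  p.1.InRange (baseOf T w) ∧ ∀ γ ∈ p.2, γ.InRange (baseOf T w)

/-- The configuration at a position. -/
def configAt (p : Pos) (hp : InRange T w p) : (reduction T w).Config where
  ctrl := p.1.toVars (baseOf T w)
  stack := p.2.map (Sym.toVars (baseOf T w))
  ctrl_mem := mem_map_ctlList hp.1
  stack_mem := by
    simp only [List.forall_mem_map]
    exact fun γ hγ => mem_map_symFam (hp.2 γ hγ)

theorem position_configAt (p : Pos) (hp : InRange T w p) : position (configAt p hp) = p :=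
  Prod.ext (Ctl.ofVars_toVars hp.1) (map_ofVars_toVars hp.2)

theorem exists_configAt (c : (reduction T w).Config) : ∃ p hp, configAt p hp = c := by
  obtain ⟨s, hs, e⟩ := exists_ctl_eq c.ctrl_mem
  obtain ⟨α, hα, e'⟩ := exists_stack_eq c.stack_mem
  exact ⟨(s, α), ⟨hs, hα⟩, OPD.Config.ext e e'⟩

theorem map_toVars_injective {α α' : List (Sym ℕ)} (h : ∀ γ ∈ α, γ.InRange (baseOf T w))
    (h' : ∀ γ ∈ α', γ.InRange (baseOf T w))
    (e : α.map (Sym.toVars (baseOf T w)) = α'.map (Sym.toVars (baseOf T w))) : α = α' := by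
  rw [← map_ofVars_toVars h, e, map_ofVars_toVars h']

theorem Trans.inRange {p p' : Pos} (h : Trans T w p p') (hp : InRange T w p) :
    InRange T w p' := by
  obtain ⟨-, hp⟩ := hp
  cases h with
  | int h => exact ⟨(inRange_of_mem_intList T w h).2, hp⟩
  | push h =>
    obtain ⟨-, h1, h2⟩ := inRange_of_mem_pushList T w h
    exact ⟨h1, List.forall_mem_cons.2 ⟨h2, hp⟩⟩
  | popBot h => exact ⟨(inRange_of_mem_popList T w h).2.2, hp⟩
  | pop h =>
    exact ⟨(inRange_of_mem_popList T w h).2.2, fun γ hγ => hp γ (List.mem_cons_of_mem _ hγ)⟩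

theorem step_configAt_iff {p p' : Pos} (hp : InRange T w p) (hp' : InRange T w p') :
    OPD.Step (configAt p hp) (configAt p' hp') ↔ Trans T w p p' := by
  obtain ⟨s, α⟩ := p
  obtain ⟨s', α'⟩ := p'
  constructor
  · intro h
    rcases h with ⟨h, hs⟩ | ⟨γ, h, hs⟩ | ⟨h, hs, hs'⟩ | ⟨γ, h, hs⟩ <;>
      obtain ⟨t, ht, e⟩ := List.mem_map.1 h
    · obtain ⟨h1, h2⟩ := inRange_of_mem_intList T w ht
      obtain ⟨e1, e2⟩ := Prod.mk.inj e
      obtain ⟨t1, t2⟩ := t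
      obtain rfl := map_toVars_injective hp.2 hp'.2 hs.symm
      obtain rfl : t1 = s := Ctl.toVars_injective h1 hp.1 e1
      obtain rfl : t2 = s' := Ctl.toVars_injective h2 hp'.1 e2
      exact .int ht
    · obtain ⟨h1, h2, h3⟩ := inRange_of_mem_pushList T w ht
      obtain ⟨e1, e'⟩ := Prod.mk.inj e
      obtain ⟨e2, e3⟩ := Prod.mk.inj e'
      subst e3
      obtain ⟨t1, t2, g⟩ := t
      obtain rfl := map_toVars_injective (α := g :: α) (List.forall_mem_cons.2 ⟨h3, hp.2⟩)
        hp'.2 hs.symm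
      obtain rfl : t1 = s := Ctl.toVars_injective h1 hp.1 e1
      obtain rfl : t2 = s' := Ctl.toVars_injective h2 hp'.1 e2
      exact .push ht
    · obtain ⟨h1, -, h3⟩ := inRange_of_mem_popList T w ht
      obtain ⟨e1, e'⟩ := Prod.mk.inj e
      obtain ⟨e2, e3⟩ := Prod.mk.inj e'
      obtain rfl := List.map_eq_nil_iff.1 hs
      obtain rfl := List.map_eq_nil_iff.1 hs'
      obtain ⟨t1, g, t2⟩ := t
      obtain rfl := Option.map_eq_none_iff.1 e2
      obtain rfl : t1 = s := Ctl.toVars_injective h1 hp.1 e1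
      obtain rfl : t2 = s' := Ctl.toVars_injective h3 hp'.1 e3
      exact .popBot ht
    · obtain ⟨h1, h2, h3⟩ := inRange_of_mem_popList T w ht
      obtain ⟨e1, e'⟩ := Prod.mk.inj e
      obtain ⟨e2, e3⟩ := Prod.mk.inj e'
      obtain ⟨t1, g, t2⟩ := t
      obtain ⟨g, rfl, rfl⟩ := Option.map_eq_some_iff.1 e2
      obtain rfl := map_toVars_injective (α' := g :: α') hp.2
        (List.forall_mem_cons.2 ⟨h2 g rfl, hp'.2⟩) hs
      obtain rfl : t1 = s := Ctl.toVars_injective h1 hp.1 e1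
      obtain rfl : t2 = s' := Ctl.toVars_injective h3 hp'.1 e3
      exact .pop ht
  · intro h
    rcases h with h | h | h | h
    · exact .int (List.mem_map.2 ⟨_, h, rfl⟩) rfl
    · exact .push _ (List.mem_map.2 ⟨_, h, rfl⟩) rfl
    · exact .popBot (List.mem_map.2 ⟨_, h, rfl⟩) rfl rfl
    · exact .pop _ (List.mem_map.2 ⟨_, h, rfl⟩) rfl

theorem good_inRange {β : Base → ℕ} : Ctl.good.InRange β := mem_ctlFam.1 (.inl rfl)

/-- A strategy tree of the open pushdown system that satisfies the formula corresponds to one of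
the structure of positions. -/
theorem existsStrategyTree_iff_wins :
    (reduction T w).ExistsStrategyTree (.AU .tt (.prop 1)) ↔ (game T w).Wins := by
  have h1 : (reduction T w).ExistsStrategyTree (.AU .tt (.prop 1)) ↔
      (reduction T w).toKripke.Wins :=
    exists_congr fun ST => and_congr_right fun _ => OpenKripke.treeSat_iff_eventually
  rw [h1]
  have hstack : ∀ c : (reduction T w).Config,
      c.stack.filterMap (reduction T w).visSym = c.stack := by
    intro c
    have : ∀ γ ∈ c.stack, (reduction T w).visSym γ = some γ := by
      intro γ hγ
      have h0 : (reduction T w).nHΓ = 0 := rfl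
      have := (reduction T w).Γ_sub γ (c.stack_mem γ hγ)
      rw [h0, Nat.add_zero] at this
      rw [OPD.visSym, Finset.inter_eq_left.2 this, if_neg]
      simp [h0]
    exact (List.filterMap_congr this).trans List.filterMap_some
  refine OpenKripke.wins_iff_of_embedding (ι := position) ?_ ?_ ?_ ?_ ?_ ?_ ?_
  · intro c c' e
    obtain ⟨p, hp, rfl⟩ := exists_configAt c
    obtain ⟨p', hp', rfl⟩ := exists_configAt c'
    rw [position_configAt, position_configAt] at e
    subst e
    rfl
  · exact position_configAt (.init true 0, []) ⟨by
      simp [Ctl.InRange, Ctl.st, Ctl.fst, Ctl.snd, Ctl.pos, Ctl.hidIdx, Ctl.hidLetter, baseOf],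
      by simp⟩
  · intro c c'
    obtain ⟨p, hp, rfl⟩ := exists_configAt c
    obtain ⟨p', hp', rfl⟩ := exists_configAt c'
    rw [position_configAt, position_configAt]
    exact step_configAt_iff hp hp'
  · intro c y h
    obtain ⟨p, hp, rfl⟩ := exists_configAt c
    rw [position_configAt] at h
    exact ⟨configAt y (h.inRange hp), position_configAt _ _⟩
  · intro c
    obtain ⟨p, hp, rfl⟩ := exists_configAt c
    rw [position_configAt]
    refine Iff.trans ?_ (mem_map_envFam (g := p.2.head?) hp.1
      fun γ hγ => hp.2 γ (List.mem_of_mem_head? hγ))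
    rw [← List.head?_map]
    rfl
  · intro c
    obtain ⟨p, hp, rfl⟩ := exists_configAt c
    rw [position_configAt]
    change 1 ∈ ({if p.1.toVars _ = Ctl.good.toVars _ then 1 else 0} : Set ℕ) ↔ 1 = 1 ∧ p.1 = .good
    by_cases h : p.1 = .good
    · simp [h]
    · have : p.1.toVars (baseOf T w) ≠ Ctl.good.toVars (baseOf T w) :=
        fun e => h (Ctl.toVars_injective hp.1 good_inRange e)
      simp [h, this]
  · intro c c'
    obtain ⟨p, hp, rfl⟩ := exists_configAt c
    obtain ⟨p', hp', rfl⟩ := exists_configAt c'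
    rw [position_configAt, position_configAt]
    change (configAt p hp).vis = (configAt p' hp').vis ↔ (p.1.vis, p.2) = (p'.1.vis, p'.2)
    have e : ∀ (p : Pos) (hp : InRange T w p), (configAt p hp).vis =
        (p.1.toVars (baseOf T w) ∩ Finset.range (reduction T w).nI,
          p.2.map (Sym.toVars (baseOf T w))) := by
      intro p hp
      rw [OPD.Config.vis, hstack]
      rfl
    rw [e, e, Prod.mk.injEq, Prod.mk.injEq]
    refine and_congr ((Ctl.toVars_inter_eq_iff hp.1 hp'.1).trans ?_)
      ⟨map_toVars_injective hp.2 hp'.2, congrArg _⟩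
    simp only [Ctl.vis, Prod.mk.injEq]

end PMC

namespace PMC

/-! ### What the checks verify -/

/-- The bit `j` of the address at the start of the word is `e`, if it is there. -/
def CompOK (j : ℕ) (e : Bool) : List (Sym ℕ) → Prop
  | [] => True
  | .bit b i :: α => ¬ (i = j ∧ b = !e) ∧ CompOK j e α
  | .mark :: _ => True
  | .cell _ _ _ :: _ => True

/-- If another cell of the block follows, then the bit `j` of its address is `e`. -/
def SkipOK (j : ℕ) (e : Bool) : List (Sym ℕ) → Prop
  | [] => True
  | .bit _ _ :: α => SkipOK j e α
  | .mark :: _ => True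
  | .cell _ _ _ :: α => CompOK j e α

/-- From the bit `j` on, the address at the start of the word is the successor of the next one, or
is zero and ends the block; `u` tells whether one of the bits before `j` is `true`. -/
def IncrOK (n : ℕ) : Bool → ℕ → List (Sym ℕ) → Prop
  | u, j, [] => u = false ∧ j = n
  | u, j, .bit b i :: α => i = j ∧ j < n ∧ IncrOK n (u || b) (j + 1) α ∧ SkipOK j (b == u) α
  | u, j, .mark :: _ => u = false ∧ j = n
  | u, j, .cell _ _ _ :: _ => u = true ∧ j = n

/-- The address at the start of the word has no bit `false`. -/
def OnesOK : List (Sym ℕ) → Prop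
  | [] => True
  | .bit b _ :: α => b = true ∧ OnesOK α
  | .mark :: _ => True
  | .cell _ _ _ :: _ => True

/-- The word starts with a cell with the largest address. -/
def LastOK : List (Sym ℕ) → Prop
  | .cell _ _ _ :: α => OnesOK α
  | _ => False

/-- A cell of this kind, with the letter `b` after the step, and followed by the word `α`, agrees
with what is remembered. -/
def Memo.Matches (k : Kind) (b : ℕ) (α : List (Sym ℕ)) : Memo ℕ → Prop
  | .addr j e => CompOK j e α
  | .cont c h => c = b ∧ h = k.after

/-- The block at the start of the word has a cell that agrees with all that is remembered. -/
def Found (S : Set (Memo ℕ)) : List (Sym ℕ) → Prop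
  | [] => False
  | .bit _ _ :: α => Found S α
  | .mark :: _ => False
  | .cell k _ b :: α => Found S α ∨ ∀ I ∈ S, I.Matches k b α

/-- The next block, if any, has a cell that agrees with all that is remembered. -/
def FoundNext (S : Set (Memo ℕ)) : List (Sym ℕ) → Prop
  | [] => True
  | .bit _ _ :: α => FoundNext S α
  | .mark :: α => Found S α
  | .cell _ _ _ :: α => FoundNext S α

/-- The next block, if any, has a cell that agrees with all that is remembered and with the address
at the start of the word. -/
def ReadOK (S : Set (Memo ℕ)) : List (Sym ℕ) → Prop
  | [] => True
  | .bit b j :: α => ReadOK (insert (.addr j b) S) α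
  | .mark :: α => Found S α
  | .cell _ _ _ :: α => FoundNext S α

/-- No check can fail on this stack content. -/
def CheckOK (n : ℕ) : List (Sym ℕ) → Prop
  | [] => True
  | .bit _ _ :: α => CheckOK n α
  | .mark :: α => CheckOK n α ∧ LastOK α
  | .cell k a _ :: α => CheckOK n α ∧ IncrOK n false 0 α ∧ ReadOK {.cont a k.before} α

/-- The control states that generate the stack content. -/
def Ctl.isGen : Ctl ℕ → Bool
  | .init _ _ => true
  | .header _ => true
  | .select _ _ _ => true
  | .pre _ _ _ _ => true
  | .midL _ _ _ => true
  | .midR _ => true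
  | .post _ => true
  | _ => false

variable {T : ATM} {w : List (Fin T.nA)}

/-- The pop transitions. -/
def PopTrans (β : Base → ℕ) (s : Ctl ℕ) (g : Option (Sym ℕ)) (s' : Ctl ℕ) : Prop :=
  AddrPop β s g s' ∨ ContPop β s g s'

theorem mem_popList {β : Base → ℕ} {s s' : Ctl ℕ} {g : Option (Sym ℕ)} :
    (s, g, s') ∈ popList β ↔ PopTrans β s g s' :=
  List.mem_append.trans (or_congr ⟨addrPop_of_mem _, mem_of_addrPop⟩
    ⟨contPop_of_mem _, mem_of_contPop⟩)

theorem mem_intList {t : Ctl ℕ × Ctl ℕ} : t ∈ intList T ↔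
    (∃ q : Fin T.nQ, ∃ a : Fin T.nA, t = (.header q, .select (T.isUniv q) q a)) ∨
    (∃ q : Fin T.nQ, T.isAcc q = true ∧ t = (.header q, .chk)) ∨
    ∃ (q : Fin T.nQ) (a : Fin T.nA) (u : Bool) (r : Fin T.nQ × Fin T.nA × Move),
      (r = (T.δ q a).1 ∨ r = (T.δ q a).2) ∧
      t = (.select u q a, .pre (encMove r.2.2) r.1 a r.2.1) := by
  simp only [intList, tripleInts, List.mem_append, List.mem_flatMap, List.mem_finRange, true_and,
    List.mem_ite_nil_right, List.mem_cons, List.not_mem_nil, or_false, or_assoc]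
  refine or_congr Iff.rfl (or_congr Iff.rfl (exists_congr fun q => exists_congr fun a => ?_))
  constructor
  · rintro (rfl | rfl | rfl | rfl)
    exacts [⟨false, _, .inl rfl, rfl⟩, ⟨true, _, .inl rfl, rfl⟩, ⟨false, _, .inr rfl, rfl⟩,
      ⟨true, _, .inr rfl, rfl⟩]
  · rintro ⟨_ | _, _, rfl | rfl, rfl⟩ <;> simp

theorem isGen_of_mem_intList {s s' : Ctl ℕ} (h : (s, s') ∈ intList T) : s.isGen = true := by
  rcases mem_intList.1 h with ⟨q, a, h⟩ | ⟨q, -, h⟩ | ⟨q, a, u, r, -, h⟩ <;>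
    obtain ⟨rfl, rfl⟩ := Prod.mk.inj h <;> rfl

theorem mem_pushList {s s' : Ctl ℕ} {g : Sym ℕ} : (s, s', g) ∈ pushList T w ↔
    StaticPush (baseOf T w) s s' g ∨ ∃ k : Fin w.length, ∃ u : Bool, s = .init u k ∧
      s' = .init false (k + 1) ∧ g = .cell (if u = true then .arrive else .stay) (w.get k)
        (w.get k) := by
  rw [pushList, List.mem_append]
  refine or_congr ⟨staticPush_of_mem _, mem_of_staticPush⟩ ?_
  simp only [wordPush, List.mem_flatMap, List.mem_finRange, true_and, List.mem_cons,
    List.not_mem_nil, or_false, Prod.mk.injEq]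
  refine exists_congr fun k => ?_
  constructor
  · rintro (⟨rfl, rfl, rfl⟩ | ⟨rfl, rfl, rfl⟩)
    exacts [⟨true, rfl, rfl, rfl⟩, ⟨false, rfl, rfl, rfl⟩]
  · rintro ⟨_ | _, rfl, rfl, rfl⟩ <;> simp

theorem isGen_of_mem_pushList {s s' : Ctl ℕ} {g : Sym ℕ} (h : (s, s', g) ∈ pushList T w) :
    s.isGen = true := by
  rcases mem_pushList.1 h with h | ⟨k, u, rfl, -⟩
  · cases h <;> rfl
  · rfl

theorem isGen_of_popTrans {β : Base → ℕ} {s s' : Ctl ℕ} {g : Option (Sym ℕ)}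
    (h : PopTrans β s g s') : s.isGen = false ∧ s'.isGen = false := by
  rcases h with h | h <;> cases h <;> exact ⟨rfl, rfl⟩

theorem trans_iff_popTrans {s : Ctl ℕ} {α : List (Sym ℕ)} {p : Pos} (hs : s.isGen = false) :
    Trans T w (s, α) p ↔ ∃ s', PopTrans (baseOf T w) s α.head? s' ∧ p = (s', α.tail) := by
  constructor
  · intro h
    cases h with
    | int h => simp [isGen_of_mem_intList h] at hs
    | push h => simp [isGen_of_mem_pushList h] at hs
    | popBot h => exact ⟨_, mem_popList.1 h, rfl⟩
    | pop h => exact ⟨_, mem_popList.1 h, rfl⟩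
  · rintro ⟨s', h, rfl⟩
    cases α with
    | nil => exact .popBot (mem_popList.2 h)
    | cons g α => exact .pop (mem_popList.2 h)

variable (T w)

/-- The environment can enforce, within `m` moves, that no check fails. -/
inductive WinIn : ℕ → Pos → Prop
  | fin {m : ℕ} {q : ℕ} {α : List (Sym ℕ)} (h : Trans T w (.header q, α) (.chk, α))
      (hα : CheckOK w.length α) : WinIn m (.header q, α)
  | env {m : ℕ} {p p' : Pos} (hp : p.1.isGen = true) (he : p.1.isEnv = true) (h : Trans T w p p')
      (h' : WinIn m p') : WinIn (m + 1) p
  | all {m : ℕ} {q a : ℕ} {α : List (Sym ℕ)} (h : ∃ p', Trans T w (.select true q a, α) p')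
      (h' : ∀ p', Trans T w (.select true q a, α) p' → WinIn m p') :
      WinIn (m + 1) (.select true q a, α)

variable {T w}

theorem WinIn.mono {m m' : ℕ} {p : Pos} (h : WinIn T w m p) (hm : m ≤ m') : WinIn T w m' p := by
  induction h generalizing m' with
  | fin h hα => exact .fin h hα
  | env hp he h _ ih =>
    obtain ⟨m', rfl⟩ := Nat.exists_eq_add_of_le' (show 1 ≤ m' by omega)
    exact .env hp he h (ih (by omega))
  | all h _ ih =>
    obtain ⟨m', rfl⟩ := Nat.exists_eq_add_of_le' (show 1 ≤ m' by omega)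
    exact .all h fun p hp => ih p hp (by omega)

theorem WinIn.isGen {m : ℕ} {p : Pos} (h : WinIn T w m p) : p.1.isGen = true := by
  cases h with
  | fin => rfl
  | env hp => exact hp
  | all => rfl

/-! ### From a strategy tree to a winning position -/

theorem inRange_of_isNode {x : (game T w).Node} (h : (game T w).IsNode (game T w).init x) :
    InRange T w x.1 := by
  induction h with
  | root =>
    refine ⟨?_, by simp [game]⟩
    simp [game, Ctl.InRange, Ctl.st, Ctl.fst, Ctl.snd, Ctl.pos, Ctl.hidIdx, Ctl.hidLetter, baseOf]
  | child _ h ih => exact h.inRange ih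

theorem mk_eq_mk_iff {p p' : Pos} :
    (Quotient.mk (game T w).indist p = Quotient.mk (game T w).indist p') ↔
      p.1.vis = p'.1.vis ∧ p.2 = p'.2 :=
  Quotient.eq.trans (by rw [← Prod.mk.injEq]; rfl)

end PMC

namespace PMC

variable {T : ATM} {w : List (Fin T.nA)} {ST : Set (game T w).Node}

/-- Some node of the tree is at this position, and cannot avoid `good`. -/
def Safe (ST : Set (game T w).Node) (p : Pos) : Prop :=
  ∃ x ∈ ST, x.1 = p ∧ (game T w).Eventually ST x

theorem eventually_system (hST : (game T w).IsStrategyTree (game T w).init ST) {p p' : Pos}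
    {h : List Pos} (hx : ((p, h) : (game T w).Node) ∈ ST)
    (he : (game T w).Eventually ST ((p, h) : (game T w).Node)) (henv : p.1.isEnv = false)
    (hg : p.1 ≠ .good) (hp : Trans T w p p') :
    ((p', p :: h) : (game T w).Node) ∈ ST ∧
      (game T w).Eventually ST ((p', p :: h) : (game T w).Node) := by
  have h1 : ((p', p :: h) : (game T w).Node) ∈ ST :=
    hST.system p p' h hx (by change ¬ p.1.isEnv = true; simp [henv]) hp
  refine ⟨h1, ?_⟩
  cases he with
  | here h => exact absurd h.2 hg
  | step _ h => exact h _ ⟨hx, h1, rfl⟩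

theorem exists_child_of_eventually (hST : (game T w).IsStrategyTree (game T w).init ST) {p : Pos}
    {h : List Pos} (he : (game T w).Eventually ST ((p, h) : (game T w).Node)) (hg : p.1 ≠ .good) :
    ∃ p', Trans T w p p' ∧ ((p', p :: h) : (game T w).Node) ∈ ST ∧
      (game T w).Eventually ST ((p', p :: h) : (game T w).Node) := by
  cases he with
  | here h => exact absurd h.2 hg
  | step hc h =>
    obtain ⟨⟨p', l⟩, hy⟩ := hc
    obtain rfl : l = p :: _ := hy.2.2
    exact ⟨p', (hST.contained _ hy.2.1).of_cons.2, hy.2.1, h _ hy⟩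

theorem Safe.system (hST : (game T w).IsStrategyTree (game T w).init ST) {s : Ctl ℕ}
    {α : List (Sym ℕ)} (h : Safe ST (s, α)) (hgen : s.isGen = false) (henv : s.isEnv = false)
    (hg : s ≠ .good) :
    InRange T w (s, α) ∧ (∃ s', PopTrans (baseOf T w) s α.head? s') ∧
      ∀ s', PopTrans (baseOf T w) s α.head? s' → Safe ST (s', α.tail) := by
  obtain ⟨⟨p, l⟩, hx, e, he⟩ := h
  obtain rfl : p = (s, α) := e
  refine ⟨inRange_of_isNode (hST.contained _ hx), ?_, fun s' hs' => ?_⟩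
  · obtain ⟨p', hp', -⟩ := exists_child_of_eventually hST he hg
    obtain ⟨s', hs', -⟩ := (trans_iff_popTrans hgen).1 hp'
    exact ⟨s', hs'⟩
  · obtain ⟨h1, h2⟩ := eventually_system hST hx he henv hg
      ((trans_iff_popTrans hgen).2 ⟨s', hs', rfl⟩)
    exact ⟨_, h1, rfl, h2⟩

theorem not_safe_bad (hST : (game T w).IsStrategyTree (game T w).init ST) {α : List (Sym ℕ)} :
    ¬ Safe ST (.bad, α) := by
  intro h
  obtain ⟨-, ⟨s', h⟩, -⟩ := h.system hST rfl rfl (by simp)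
  rcases h with h | h <;> cases h

theorem compOK_of_safe (hST : (game T w).IsStrategyTree (game T w).init ST) {j : ℕ} {e : Bool}
    {α : List (Sym ℕ)} (h : Safe ST (.comp j e, α)) : CompOK j e α := by
  induction α with
  | nil => trivial
  | cons g α ih =>
    obtain ⟨hr, -, hc⟩ := h.system hST rfl rfl (by simp)
    have hj : j < w.length := hr.1.2.2.2.2.1 j rfl
    rcases g with ⟨b, i⟩ | _ | _
    · have hi : i < w.length := (hr.2 _ List.mem_cons_self).1 i rfl
      refine ⟨?_, ih (hc _ (.inl (.comp_bit hj hi)))⟩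
      rintro ⟨rfl, rfl⟩
      exact not_safe_bad hST (hc _ (.inl (.comp_bad hj)))
    · trivial
    · trivial

theorem skipOK_of_safe (hST : (game T w).IsStrategyTree (game T w).init ST) {j : ℕ} {e : Bool}
    {α : List (Sym ℕ)} (h : Safe ST (.skip j e, α)) : SkipOK j e α := by
  induction α with
  | nil => trivial
  | cons g α ih =>
    obtain ⟨hr, -, hc⟩ := h.system hST rfl rfl (by simp)
    have hj : j < w.length := hr.1.2.2.2.2.1 j rfl
    have hg := hr.2 _ List.mem_cons_self
    rcases g with ⟨b, i⟩ | _ | ⟨k, a, b⟩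
    · exact ih (hc _ (.inl (.skip_bit hj (hg.1 i rfl))))
    · trivial
    · exact compOK_of_safe hST (hc _ (.inl (.skip_cell hj (hg.2.1 a rfl) (hg.2.2 b rfl))))

theorem incrOK_of_safe (hST : (game T w).IsStrategyTree (game T w).init ST) {u : Bool} {j : ℕ}
    {α : List (Sym ℕ)} (h : Safe ST (.incr u j, α)) : IncrOK w.length u j α := by
  induction α generalizing u j with
  | nil =>
    obtain ⟨-, ⟨s', h⟩, -⟩ := h.system hST rfl rfl (by simp)
    rcases h with h | h <;> cases h
    exact ⟨rfl, rfl⟩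
  | cons g α ih =>
    obtain ⟨hr, ⟨s', h⟩, hc⟩ := h.system hST rfl rfl (by simp)
    rcases g with ⟨b, i⟩ | _ | ⟨k, a, b⟩
    · obtain ⟨rfl, hj⟩ : i = j ∧ j < w.length := by
        rcases h with h | h <;> cases h
        · exact ⟨rfl, by assumption⟩
        · exact ⟨rfl, by assumption⟩
      exact ⟨rfl, hj, ih (hc _ (.inl (.incr_bit hj))),
        skipOK_of_safe hST (hc _ (.inl (.incr_skip hj)))⟩
    · rcases h with h | h <;> cases h
      exact ⟨rfl, rfl⟩
    · rcases h with h | h <;> cases h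
      exact ⟨rfl, rfl⟩

theorem onesOK_of_safe (hST : (game T w).IsStrategyTree (game T w).init ST)
    {α : List (Sym ℕ)} (h : Safe ST (.ones, α)) : OnesOK α := by
  induction α with
  | nil => trivial
  | cons g α ih =>
    obtain ⟨hr, ⟨s', h⟩, hc⟩ := h.system hST rfl rfl (by simp)
    rcases g with ⟨b, i⟩ | _ | ⟨k, a, b⟩
    · obtain rfl : b = true := by
        rcases h with h | h <;> cases h
        rfl
      exact ⟨rfl, ih (hc _ (.inl (.ones_bit ((hr.2 _ List.mem_cons_self).1 i rfl))))⟩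
    · trivial
    · trivial

theorem lastOK_of_safe (hST : (game T w).IsStrategyTree (game T w).init ST)
    {α : List (Sym ℕ)} (h : Safe ST (.last, α)) : LastOK α := by
  obtain ⟨hr, ⟨s', h⟩, hc⟩ := h.system hST rfl rfl (by simp)
  rcases α with _ | ⟨⟨b, i⟩ | _ | ⟨k, a, b⟩, α⟩
  · rcases h with h | h <;> cases h
  · rcases h with h | h <;> cases h
  · rcases h with h | h <;> cases h
  · have hg := hr.2 _ List.mem_cons_self
    exact onesOK_of_safe hST (hc _ (.inl (.last_cell (hg.2.1 a rfl) (hg.2.2 b rfl))))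

/-- A node of the tree at this position, with this visible history, that cannot avoid `good`. -/
def SafeAt (ST : Set (game T w).Node) (V : List (Quotient (game T w).indist)) (p : Pos) : Prop :=
  ∃ h : List Pos, ((p, h) : (game T w).Node) ∈ ST ∧
    (game T w).Eventually ST ((p, h) : (game T w).Node) ∧ (game T w).visHist (p, h) = V

theorem SafeAt.safe {V : List (Quotient (game T w).indist)} {p : Pos} (h : SafeAt ST V p) :
    Safe ST p := by
  obtain ⟨l, h1, h2, -⟩ := h
  exact ⟨_, h1, rfl, h2⟩

theorem SafeAt.system (hST : (game T w).IsStrategyTree (game T w).init ST)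
    {V : List (Quotient (game T w).indist)} {s s' : Ctl ℕ} {α : List (Sym ℕ)}
    (h : SafeAt ST V (s, α)) (hgen : s.isGen = false) (henv : s.isEnv = false) (hg : s ≠ .good)
    (hs' : PopTrans (baseOf T w) s α.head? s') :
    SafeAt ST (Quotient.mk (game T w).indist (s', α.tail) :: V) (s', α.tail) := by
  obtain ⟨l, h1, h2, h3⟩ := h
  obtain ⟨h4, h5⟩ := eventually_system hST h1 h2 henv hg
    ((trans_iff_popTrans hgen).2 ⟨s', hs', rfl⟩)
  exact ⟨_, h4, h5, by rw [← h3]; rfl⟩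

theorem SafeAt.congr {V : List (Quotient (game T w).indist)} {v v' : Quotient (game T w).indist}
    {p : Pos} (h : SafeAt ST (v :: V) p) (hv : v = v') : SafeAt ST (v' :: V) p := hv ▸ h

/-- Since pruning is uniform, the environment stops its search at the same cell for all that may
be remembered, so that this cell agrees with all of it. -/
theorem found_of_safe (hST : (game T w).IsStrategyTree (game T w).init ST) {α : List (Sym ℕ)}
    {S : Set (Memo ℕ)} {V : List (Quotient (game T w).indist)} (hS : ∃ c h, Memo.cont c h ∈ S)
    (h : ∀ I ∈ S, SafeAt ST V (.search I, α)) : Found S α := by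
  induction α generalizing V with
  | nil =>
    obtain ⟨c, b, hI⟩ := hS
    obtain ⟨l, -, he, -⟩ := h _ hI
    obtain ⟨p', hp', -⟩ := exists_child_of_eventually hST he (by simp)
    obtain ⟨s', hs', -⟩ := (trans_iff_popTrans rfl).1 hp'
    rcases hs' with hs' | hs' <;> cases hs'
  | cons g α ih =>
    -- the visible history after one more symbol has been skipped
    set V' := Quotient.mk (game T w).indist (.search (.addr 0 false), α) :: V with hV'
    have hmk : ∀ I, Quotient.mk (game T w).indist (.search I, α) :: V = V' := by
      intro I
      exact congrArg (· :: V) (mk_eq_mk_iff.2 ⟨rfl, rfl⟩)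
    by_cases hk : ∃ y ∈ ST, (game T w).visHist y = V'
    · have hg : g ≠ .mark → Found S α := by
        intro hg
        refine ih (V := V') fun I hI => ?_
        obtain ⟨l, h1, h2, h3⟩ := h I hI
        have hr := inRange_of_isNode (hST.contained _ h1)
        have hI' : I.InRange (baseOf T w) := ⟨hr.1.2.2.2.2.1, hr.1.2.2.2.2.2⟩
        have hgr := hr.2 _ List.mem_cons_self
        have ht : Trans T w (.search I, g :: α) (.search I, α) := by
          refine (trans_iff_popTrans rfl).2 ⟨_, ?_, rfl⟩
          rcases g with ⟨b, i⟩ | _ | ⟨k, a, b⟩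
          · exact .inr (.search_bit hI' (hgr.1 i rfl))
          · exact absurd rfl hg
          · exact .inr (.search_cell hI' (hgr.2.1 a rfl) (hgr.2.2 b rfl))
        have hvis : (game T w).visHist ((.search I, α), (.search I, g :: α) :: l) = V' := by
          rw [← hmk I, ← h3]
          rfl
        have hmem : (((.search I, α), (.search I, g :: α) :: l) : (game T w).Node) ∈ ST := by
          obtain ⟨y, hy, e⟩ := hk
          exact (hST.uniform y _ (hST.contained _ hy) (.child (hST.contained _ h1) ht)
            (e.trans hvis.symm)).1 hy
        refine ⟨_, hmem, ?_, hvis⟩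
        cases h2 with
        | here h => exact absurd h.2 (by simp)
        | step _ h => exact h _ ⟨h1, hmem, rfl⟩
      rcases g with ⟨b, i⟩ | _ | ⟨k, a, b⟩
      · exact hg (by simp)
      · obtain ⟨c, b, hI⟩ := hS
        obtain ⟨l, -, he, -⟩ := h _ hI
        obtain ⟨p', hp', -⟩ := exists_child_of_eventually hST he (by simp)
        obtain ⟨s', hs', -⟩ := (trans_iff_popTrans rfl).1 hp'
        rcases hs' with hs' | hs' <;> cases hs'
      · exact .inl (hg (by simp))
    · have hend : ∀ I ∈ S, ∃ s', s' ≠ .search I ∧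
          PopTrans (baseOf T w) (.search I) (some g) s' ∧ Safe ST (s', α) := by
        intro I hI
        obtain ⟨l, h1, h2, h3⟩ := h I hI
        obtain ⟨p', hp', h4, h5⟩ := exists_child_of_eventually hST h2 (by simp)
        obtain ⟨s', hs', rfl⟩ := (trans_iff_popTrans rfl).1 hp'
        refine ⟨s', ?_, hs', _, h4, rfl, h5⟩
        rintro rfl
        refine hk ⟨_, h4, ?_⟩
        rw [← hmk I, ← h3]
        rfl
      rcases g with ⟨b, i⟩ | _ | ⟨k, a, b⟩
      · obtain ⟨c, b, hI⟩ := hS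
        obtain ⟨s', hne, hs', -⟩ := hend _ hI
        rcases hs' with hs' | hs' <;> cases hs'
        exact absurd rfl hne
      · obtain ⟨c, b, hI⟩ := hS
        obtain ⟨s', hne, hs', -⟩ := hend _ hI
        rcases hs' with hs' | hs' <;> cases hs'
      · refine .inr fun I hI => ?_
        obtain ⟨s', hne, hs', h4⟩ := hend _ hI
        rcases hs' with hs' | hs' <;> cases hs'
        · exact absurd rfl hne
        · exact compOK_of_safe hST h4
        · exact ⟨rfl, rfl⟩

theorem foundNext_of_safe (hST : (game T w).IsStrategyTree (game T w).init ST) {α : List (Sym ℕ)}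
    {S : Set (Memo ℕ)} {V : List (Quotient (game T w).indist)} (hS : ∃ c h, Memo.cont c h ∈ S)
    (h : ∀ I ∈ S, SafeAt ST V (.toMark I, α)) : FoundNext S α := by
  induction α generalizing V with
  | nil => trivial
  | cons g α ih =>
    have key : ∀ (f : Memo ℕ → Ctl ℕ), (∀ I J, (f I).vis = (f J).vis) →
        (∀ I ∈ S, I.InRange (baseOf T w) → g.InRange (baseOf T w) →
          PopTrans (baseOf T w) (.toMark I) (some g) (f I)) →
        ∀ I ∈ S, SafeAt ST (Quotient.mk (game T w).indist (f (.addr 0 false), α) :: V)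
          (f I, α) := by
      intro f hf ht I hI
      have hr := inRange_of_isNode (hST.contained _ (h I hI).choose_spec.1)
      have := (h I hI).system hST rfl rfl (by simp)
        (ht I hI ⟨hr.1.2.2.2.2.1, hr.1.2.2.2.2.2⟩ (hr.2 _ List.mem_cons_self))
      exact this.congr (mk_eq_mk_iff.2 ⟨hf _ _, rfl⟩)
    rcases g with ⟨b, i⟩ | _ | ⟨k, a, b⟩
    · exact ih (key .toMark (fun _ _ => rfl) fun I _ hI hg => .inr (.toMark_bit hI (hg.1 i rfl)))
    · exact found_of_safe hST hS (key .search (fun _ _ => rfl) fun I _ hI hg =>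
        .inr (.toMark_mark hI))
    · exact ih (key .toMark (fun _ _ => rfl) fun I _ hI hg =>
        .inr (.toMark_cell hI (hg.2.1 a rfl) (hg.2.2 b rfl)))

theorem readOK_of_safe (hST : (game T w).IsStrategyTree (game T w).init ST) {α : List (Sym ℕ)}
    {S : Set (Memo ℕ)} {V : List (Quotient (game T w).indist)} (hS : ∃ c h, Memo.cont c h ∈ S)
    (hu : SafeAt ST V (.undecided, α)) (h : ∀ I ∈ S, SafeAt ST V (.toMark I, α)) : ReadOK S α := by
  induction α generalizing V S with
  | nil => trivial
  | cons g α ih =>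
    rcases g with ⟨b, j⟩ | _ | ⟨k, a, b⟩
    · have hr := hu.safe.system hST rfl rfl (by simp)
      have hj : j < w.length := (hr.1.2 _ List.mem_cons_self).1 j rfl
      refine ih (V := Quotient.mk (game T w).indist (.undecided, α) :: V)
        (by obtain ⟨c, b, hI⟩ := hS; exact ⟨c, b, .inr hI⟩)
        (hu.system hST rfl rfl (by simp) (.inr (.und_bit hj))) ?_
      rintro I (rfl | hI)
      · exact (hu.system hST rfl rfl (by simp) (.inr (.und_addr hj))).congr
          (mk_eq_mk_iff.2 ⟨rfl, rfl⟩)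
      · have hI' := ((h I hI).safe.system hST rfl rfl (by simp)).1.1
        exact ((h I hI).system hST rfl rfl (by simp)
          (.inr (.toMark_bit ⟨hI'.2.2.2.2.1, hI'.2.2.2.2.2⟩ hj))).congr
          (mk_eq_mk_iff.2 ⟨rfl, rfl⟩)
    · exact foundNext_of_safe hST hS h
    · exact foundNext_of_safe (α := .cell k a b :: α) hST hS h

theorem checkOK_of_safe (hST : (game T w).IsStrategyTree (game T w).init ST) {α : List (Sym ℕ)}
    (h : Safe ST (.chk, α)) : CheckOK w.length α := by
  induction α with
  | nil => trivial
  | cons g α ih =>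
    obtain ⟨hr, -, hc⟩ := h.system hST rfl rfl (by simp)
    have hg := hr.2 _ List.mem_cons_self
    rcases g with ⟨b, j⟩ | _ | ⟨k, a, b⟩
    · exact ih (hc _ (.inl (.chk_bit (hg.1 j rfl))))
    · exact ⟨ih (hc _ (.inl .chk_mark)), lastOK_of_safe hST (hc _ (.inl .chk_last))⟩
    · have ha := hg.2.1 a rfl
      have hb := hg.2.2 b rfl
      refine ⟨ih (hc _ (.inl (.chk_cell ha hb))),
        incrOK_of_safe hST (hc _ (.inl (.chk_incr ha hb))), ?_⟩
      obtain ⟨⟨p, l⟩, hx, e, he⟩ := h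
      obtain rfl : p = (.chk, .cell k a b :: α) := e
      have hV : SafeAt ST _ (.chk, .cell k a b :: α) := ⟨l, hx, he, rfl⟩
      refine readOK_of_safe hST ⟨a, _, rfl⟩
        (hV.system hST rfl rfl (by simp) (.inl (.chk_undecided ha hb))) ?_
      rintro I rfl
      exact (hV.system hST rfl rfl (by simp) (.inr (.chk ha hb))).congr
        (mk_eq_mk_iff.2 ⟨rfl, rfl⟩)

theorem finite_trans (p : Pos) : {p' | Trans T w p p'}.Finite := by
  have h : {p' | Trans T w p p'} ⊆
      ((fun t : Ctl ℕ × Ctl ℕ => (t.2, p.2)) '' {t | t ∈ intList T}) ∪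
      ((fun t : Ctl ℕ × Ctl ℕ × Sym ℕ => (t.2.1, t.2.2 :: p.2)) '' {t | t ∈ pushList T w}) ∪
      ((fun t : Ctl ℕ × Option (Sym ℕ) × Ctl ℕ => (t.2.2, p.2.tail)) ''
        {t | t ∈ popList (baseOf T w)}) := by
    rintro p' (h | h | h | h)
    · exact .inl (.inl ⟨_, h, rfl⟩)
    · exact .inl (.inr ⟨_, h, rfl⟩)
    · exact .inr ⟨_, h, rfl⟩
    · exact .inr ⟨_, h, rfl⟩
  exact (((List.finite_toSet _).image _).union ((List.finite_toSet _).image _) |>.union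
    ((List.finite_toSet _).image _)).subset h

theorem trans_chk {p : Pos} {α : List (Sym ℕ)} (hp : p.1.isGen = true)
    (h : Trans T w p (.chk, α)) : ∃ q, p = (.header q, α) := by
  cases h with
  | int h =>
    rcases mem_intList.1 h with ⟨q, a, h⟩ | ⟨q, -, h⟩ | ⟨q, a, u, r, -, h⟩
    · cases (Prod.mk.inj h).2
    · obtain ⟨rfl, -⟩ := Prod.mk.inj h
      exact ⟨_, rfl⟩
    · cases (Prod.mk.inj h).2
  | push h =>
    rcases mem_pushList.1 h with h | ⟨k, u, -, h, -⟩
    · cases h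
    · cases h
  | popBot h => simp [(isGen_of_popTrans (mem_popList.1 h)).1] at hp
  | pop h => simp [(isGen_of_popTrans (mem_popList.1 h)).1] at hp

theorem trans_isGen {p p' : Pos} (hp : p.1.isGen = true) (h : Trans T w p p') :
    p'.1.isGen = true ∨ p'.1 = .chk := by
  cases h with
  | int h =>
    rcases mem_intList.1 h with ⟨q, a, h⟩ | ⟨q, -, h⟩ | ⟨q, a, u, r, -, h⟩ <;>
      obtain ⟨rfl, rfl⟩ := Prod.mk.inj h
    exacts [.inl rfl, .inr rfl, .inl rfl]
  | push h =>
    rcases mem_pushList.1 h with h | ⟨k, u, -, rfl, -⟩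
    · cases h <;> exact .inl rfl
    · exact .inl rfl
  | popBot h => simp [(isGen_of_popTrans (mem_popList.1 h)).1] at hp
  | pop h => simp [(isGen_of_popTrans (mem_popList.1 h)).1] at hp

theorem winIn_of_eventually (hST : (game T w).IsStrategyTree (game T w).init ST)
    {x : (game T w).Node} (hx : x ∈ ST) (he : (game T w).Eventually ST x)
    (hg : Ctl.isGen x.1.1 = true) : ∃ m, WinIn T w m x.1 := by
  induction he with
  | @here x h =>
    have : x.1.1 = Ctl.good := h.2
    rw [this] at hg
    cases hg
  | @step x hc he ih =>
    have hx' := he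
    obtain ⟨p, l⟩ := x
    have hchild : ∀ {p' : Pos}, ((p', p :: l) : (game T w).Node) ∈ ST → Trans T w p p' →
        (∃ q, p = (.header q, p'.2) ∧ p' = (.chk, p'.2) ∧ CheckOK w.length p'.2) ∨
          ∃ m, WinIn T w m p' := by
      intro p' hp' ht
      rcases trans_isGen hg ht with h | h
      · exact .inr (ih _ ⟨hx, hp', rfl⟩ hp' h)
      · obtain ⟨s', α⟩ := p'
        obtain rfl : s' = .chk := h
        obtain ⟨q, hq⟩ := trans_chk hg ht
        exact .inl ⟨q, hq, rfl, checkOK_of_safe hST ⟨_, hp', rfl, he _ ⟨hx, hp', rfl⟩⟩⟩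
    by_cases henv : p.1.isEnv = true
    · obtain ⟨⟨p', l'⟩, hy⟩ := hc
      obtain rfl : l' = p :: l := hy.2.2
      have ht := (hST.contained _ hy.2.1).of_cons.2
      rcases hchild hy.2.1 ht with ⟨q, h1, h2, h3⟩ | ⟨m, hm⟩
      · refine ⟨0, ?_⟩
        change WinIn T w 0 p
        rw [h1]
        exact .fin (by rw [← h1, ← h2]; exact ht) h3
      · exact ⟨m + 1, .env hg henv ht hm⟩
    · obtain ⟨s, α⟩ := p
      obtain ⟨q, a, rfl⟩ : ∃ q a, s = .select true q a := by
        change ¬ s.isEnv = true at henv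
        change s.isGen = true at hg
        rcases s with _ | _ | ⟨_ | _, q, a⟩ | _ | _ | _ | _ | _ | _ | _ | _ | _ | _ | _ | _ | _ |
          _ | _ <;> first | exact ⟨_, _, rfl⟩ | exact absurd rfl henv | cases hg
      have hall : ∀ p', Trans T w (.select true q a, α) p' → ∃ m, WinIn T w m p' := by
        intro p' ht
        rcases hchild (hST.system _ _ _ hx henv ht) ht with ⟨q, h, -⟩ | h
        · cases h
        · exact h
      obtain ⟨m, hm⟩ := ((Filter.eventually_all_finite
        (finite_trans (T := T) (w := w) (.select true q a, α))).2 (fun p' hp' => by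
          obtain ⟨m, hm⟩ := hall p' hp'
          exact Filter.eventually_atTop.2 ⟨m, fun m' h => hm.mono h⟩)).exists
      refine ⟨m + 1, .all ?_ hm⟩
      obtain ⟨⟨p', l'⟩, hy⟩ := hc
      obtain rfl : l' = _ :: l := hy.2.2
      exact ⟨p', (hST.contained _ hy.2.1).of_cons.2⟩

theorem winIn_of_wins (h : (game T w).Wins) : ∃ m, WinIn T w m (.init true 0, []) := by
  obtain ⟨ST, hST, he⟩ := h
  exact winIn_of_eventually hST hST.root_mem he rfl

end PMC

namespace PMC

/-! ### From a winning position to a strategy tree -/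

theorem tag_lt_of_isGen {s : Ctl ℕ} (h : s.isGen = true) : s.tag < 10 := by
  rcases s with ⟨_ | _, _⟩ | _ | ⟨_ | _, _, _⟩ | ⟨_ | _, _, _, _⟩ | _ | _ | _ | _ | _ | _ | _ | _ |
    _ | _ | _ | _ | _ | _ <;> first | (cases h; done) | simp [Ctl.tag]

/-- The states that generate the stack content, and the initial state of the checks, are visible. -/
theorem eq_of_vis_eq {s s' : Ctl ℕ} (h : s.isGen = true ∨ s = .chk) (e : s.vis = s'.vis) :
    s = s' := by
  have key : ∀ t : Ctl ℕ, t.tag < 11 → t.hidIdx = none ∧ t.hidLetter = none ∧ t.hidTag = 4 := by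
    intro t ht
    rcases t with _ | _ | _ | _ | _ | _ | _ | _ | ⟨_ | _, _⟩ | _ | _ | _ | _ | _ | _ | _ | _ | _ <;>
      first | exact ⟨rfl, rfl, rfl⟩ | simp [Ctl.tag] at ht
  have hs : s.tag < 11 := by
    rcases h with h | rfl
    · exact (tag_lt_of_isGen h).trans (by omega)
    · simp [Ctl.tag]
  simp only [Ctl.vis, Prod.mk.injEq] at e
  obtain ⟨e0, e1, e2, e3, e4⟩ := e
  obtain ⟨h1, h2, h3⟩ := key s hs
  obtain ⟨h1', h2', h3'⟩ := key s' (e0 ▸ hs)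
  exact Ctl.ext_fields e0 e1 e2 e3 e4 (h1.trans h1'.symm) (h2.trans h2'.symm) (h3.trans h3'.symm)

theorem eq_search_of_tag {s : Ctl ℕ} (h : s.tag = 18) : ∃ I, s = .search I := by
  rcases s with ⟨_ | _, _⟩ | _ | ⟨_ | _, _, _⟩ | ⟨_ | _, _, _, _⟩ | _ | _ | _ | _ | ⟨_ | _, _⟩ | _ |
    _ | _ | _ | _ | _ | I | _ | _ <;> first | exact ⟨_, rfl⟩ | simp [Ctl.tag] at h

theorem eq_of_tag_eq_seventeen {s : Ctl ℕ} (h : s.tag = 17) :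
    s = .undecided ∨ ∃ I, s = .toMark I := by
  rcases s with ⟨_ | _, _⟩ | _ | ⟨_ | _, _, _⟩ | ⟨_ | _, _, _, _⟩ | _ | _ | _ | _ | ⟨_ | _, _⟩ | _ |
    _ | _ | _ | _ | I | _ | _ | _ <;>
    first | exact .inl rfl | exact .inr ⟨_, rfl⟩ | simp [Ctl.tag] at h

variable (T : ATM) (w : List (Fin T.nA))

/-- A move that leads to checks that cannot fail, or to a position that is won faster. -/
def GoodMove (p p' : Pos) : Prop :=
  (p'.1 = .chk ∧ CheckOK w.length p'.2) ∨ ∃ k, WinIn T w k p' ∧ ∀ m, WinIn T w m p → k < m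

/-- The search stops at a node if the cell there agrees with all that may be remembered, given the
visible part of the history. -/
def Stops (x : (game T w).Node) : Prop :=
  ∃ k a b α, x.1.2 = Sym.cell k a b :: α ∧ ∀ y : (game T w).Node,
    (game T w).IsNode (game T w).init y → (game T w).visHist y = (game T w).visHist x →
      ∀ I, y.1.1 = Ctl.search I → I.Matches k b α

/-- The rules for the choices of the environment, at the node with history `l` and position `p`. -/
def Allowed (l : List Pos) (p p' : Pos) : Prop :=
  (p.1.isGen = true → p.1.isEnv = true → (∃ m, WinIn T w m p) → GoodMove T w p p') ∧
    (p.1.tag = 18 → (Stops T w (p, l) ↔ p'.1.tag ≠ 18))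

/-- All choices on the way to a node follow the rules. -/
def Kept : List Pos → Pos → Prop
  | [], _ => True
  | p :: l, p' => Allowed T w l p p' ∧ Kept l p

/-- The nodes that are reached if the environment follows the rules. -/
def strategyTree : Set (game T w).Node :=
  {x | (game T w).IsNode (game T w).init x ∧ Kept T w x.2 x.1}

variable {T w}

theorem stops_congr {x y : (game T w).Node} (h : (game T w).visHist x = (game T w).visHist y) :
    Stops T w x ↔ Stops T w y := by
  have e : Quotient.mk (game T w).indist x.1 = Quotient.mk (game T w).indist y.1 :=
    (List.cons.inj h).1
  rw [Stops, Stops, (mk_eq_mk_iff.1 e).2, h]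

theorem kept_congr {l l' : List Pos} {p p' : Pos}
    (hx : (game T w).IsNode (game T w).init (p, l))
    (hy : (game T w).IsNode (game T w).init (p', l'))
    (h : (game T w).visHist (p, l) = (game T w).visHist (p', l')) :
    Kept T w l p ↔ Kept T w l' p' := by
  induction l generalizing l' p p' with
  | nil =>
    cases l' with
    | nil => exact Iff.rfl
    | cons t l' => cases (List.cons.inj h).2
  | cons t l ih =>
    cases l' with
    | nil => cases (List.cons.inj h).2
    | cons t' l' =>
      obtain ⟨h1, h2⟩ := List.cons.inj h
      obtain ⟨hx1, hx2⟩ := hx.of_cons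
      obtain ⟨hy1, hy2⟩ := hy.of_cons
      obtain ⟨e1, e2⟩ := mk_eq_mk_iff.1 h1
      obtain ⟨e3, e4⟩ := mk_eq_mk_iff.1 (List.cons.inj h2).1
      refine and_congr (and_congr ?_ ?_) (ih hx1 hy1 h2)
      · by_cases hg : t.1.isGen = true
        · obtain rfl : t = t' := Prod.ext (eq_of_vis_eq (.inl hg) e3) e4
          obtain rfl : p = p' := Prod.ext (eq_of_vis_eq (trans_isGen hg hx2) e1) e2
          exact Iff.rfl
        · have hg' : ¬ t'.1.isGen = true := fun hg' =>
            hg (eq_of_vis_eq (.inl hg') e3.symm ▸ hg')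
          simp [hg, hg']
      · rw [stops_congr (T := T) (w := w) (x := (t, l)) (y := (t', l')) h2,
          show t.1.tag = t'.1.tag from (Prod.mk.inj e3).1,
          show p.1.tag = p'.1.tag from (Prod.mk.inj e1).1]

theorem exists_goodMove {p : Pos} (he : p.1.isEnv = true) (h : ∃ m, WinIn T w m p) :
    ∃ p', Trans T w p p' ∧ GoodMove T w p p' := by
  classical
  have hm := Nat.find_spec h
  generalize hk : Nat.find h = k at hm
  cases hm with
  | fin ht hα => exact ⟨_, ht, .inl ⟨rfl, hα⟩⟩
  | @env m _ p' hp _ ht hw =>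
    exact ⟨p', ht, .inr ⟨m, hw, fun m' hm' => by have := Nat.find_min' h hm'; omega⟩⟩
  | all => cases he

theorem isGen_or_search_of_isEnv {s : Ctl ℕ} (h : s.isEnv = true) :
    s.isGen = true ∨ ∃ I, s = .search I := by
  rcases s with ⟨_ | _, _⟩ | _ | ⟨_ | _, _, _⟩ | ⟨_ | _, _, _, _⟩ | _ | _ | _ | _ | ⟨_ | _, _⟩ | _ |
    _ | _ | _ | _ | _ | I | _ | _ <;> first | exact .inl rfl | exact .inr ⟨_, rfl⟩ | cases h

theorem isStrategyTree_strategyTree :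
    (game T w).IsStrategyTree (game T w).init (strategyTree T w) where
  root_mem := ⟨.root, trivial⟩
  contained := fun x hx => hx.1
  prefix_closed := fun t t' l hx => ⟨hx.1.of_cons.1, hx.2.2⟩
  system := by
    intro t t' l hx ht hR
    refine ⟨.child hx.1 hR, ⟨fun _ he => absurd he ht, fun htag => ?_⟩, hx.2⟩
    obtain ⟨I, hI⟩ := eq_search_of_tag htag
    refine absurd ?_ ht
    change Ctl.isEnv t.1 = true
    rw [hI]
    rfl
  environment := by
    rintro ⟨s, α⟩ l hx ht ⟨t', hR⟩
    change s.isEnv = true at ht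
    rcases isGen_or_search_of_isEnv ht with hg | ⟨I, rfl⟩
    · have htag : s.tag ≠ 18 := by have := tag_lt_of_isGen hg; omega
      by_cases h : ∃ m, WinIn T w m (s, α)
      · obtain ⟨p', hp', hgm⟩ := exists_goodMove ht h
        exact ⟨p', .child hx.1 hp', ⟨fun _ _ _ => hgm, fun h => absurd h htag⟩, hx.2⟩
      · exact ⟨t', .child hx.1 hR, ⟨fun _ _ h' => absurd h' h, fun h => absurd h htag⟩, hx.2⟩
    · have key : ∀ s', PopTrans (baseOf T w) (.search I) α.head? s' →
          (Stops T w ((.search I, α), l) ↔ s'.tag ≠ 18) →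
          ∃ t', ((t', (.search I, α) :: l) : (game T w).Node) ∈ strategyTree T w :=
        fun s' hs' h => ⟨(s', α.tail), .child hx.1 ((trans_iff_popTrans rfl).2 ⟨s', hs', rfl⟩),
          ⟨fun hg => (by cases hg), fun _ => h⟩, hx.2⟩
      have hr := inRange_of_isNode hx.1
      have hI : I.InRange (baseOf T w) := ⟨hr.1.2.2.2.2.1, hr.1.2.2.2.2.2⟩
      by_cases hs : Stops T w ((.search I, α), l)
      · obtain ⟨k, a, b, α', e, h⟩ := id hs
        obtain rfl : α = .cell k a b :: α' := e
        have hm := h _ hx.1 rfl I rfl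
        have hgr := hr.2 _ List.mem_cons_self
        have ha := hgr.2.1 a rfl
        have hb := hgr.2.2 b rfl
        rcases I with ⟨j, e⟩ | ⟨c, h'⟩
        · exact key _ (.inr (.search_addr (inRange_addr.1 hI) ha hb)) (by simp [hs, Ctl.tag])
        · obtain ⟨rfl, rfl⟩ := hm
          exact key _ (.inr (.search_cont ha hb)) (by simp [hs, Ctl.tag])
      · obtain ⟨s', hs', -⟩ := (trans_iff_popTrans rfl).1 hR
        refine key (.search I) ?_ (by simp [hs, Ctl.tag])
        rcases α with _ | ⟨g, α⟩
        · rcases hs' with hs' | hs' <;> cases hs'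
        · have hgr := hr.2 _ List.mem_cons_self
          rcases g with ⟨b, j⟩ | _ | ⟨k, a, b⟩
          · exact .inr (.search_bit hI (hgr.1 j rfl))
          · rcases hs' with hs' | hs' <;> cases hs'
          · exact .inr (.search_cell hI (hgr.2.1 a rfl) (hgr.2.2 b rfl))
  uniform := fun x₁ x₂ h₁ h₂ e => and_congr (iff_of_true h₁ h₂) (kept_congr h₁ h₂ e)

section eventually

variable {l : List Pos} {α : List (Sym ℕ)} {S : Set (Memo ℕ)}

theorem eventually_good : (game T w).Eventually (strategyTree T w)
    (((.good, α), l) : (game T w).Node) := .here ⟨rfl, rfl⟩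

theorem eventually_of_forall {p : Pos}
    (hx : ((p, l) : (game T w).Node) ∈ strategyTree T w) (hex : ∃ p', Trans T w p p')
    (hall : ∀ p', Trans T w p p' → ((p', p :: l) : (game T w).Node) ∈ strategyTree T w →
      (game T w).Eventually (strategyTree T w) ((p', p :: l) : (game T w).Node)) :
    (game T w).Eventually (strategyTree T w) ((p, l) : (game T w).Node) := by
  have hST := isStrategyTree_strategyTree (T := T) (w := w)
  refine .step ?_ ?_
  · by_cases he : p ∈ (game T w).env
    · obtain ⟨p', hp'⟩ := hST.environment p l hx he hex
      exact ⟨_, hx, hp', rfl⟩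
    · obtain ⟨p', hp'⟩ := hex
      exact ⟨_, hx, hST.system p p' l hx he hp', rfl⟩
  · rintro ⟨p', l'⟩ hy
    obtain rfl : l' = p :: l := hy.2.2
    exact hall p' (hST.contained _ hy.2.1).of_cons.2 hy.2.1

theorem eventually_of_popTrans {s : Ctl ℕ} (hs : s.isGen = false)
    (hx : (((s, α), l) : (game T w).Node) ∈ strategyTree T w)
    (hex : ∃ s', PopTrans (baseOf T w) s α.head? s')
    (hall : ∀ s', PopTrans (baseOf T w) s α.head? s' →
      (((s', α.tail), (s, α) :: l) : (game T w).Node) ∈ strategyTree T w →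
      (game T w).Eventually (strategyTree T w)
        (((s', α.tail), (s, α) :: l) : (game T w).Node)) :
    (game T w).Eventually (strategyTree T w) (((s, α), l) : (game T w).Node) := by
  refine eventually_of_forall hx ?_ fun p' hp' hm => ?_
  · obtain ⟨s', hs'⟩ := hex
    exact ⟨_, (trans_iff_popTrans hs).2 ⟨s', hs', rfl⟩⟩
  · obtain ⟨s', hs', rfl⟩ := (trans_iff_popTrans hs).1 hp'
    exact hall s' hs' hm

theorem inRange_of_mem {p : Pos} (hx : ((p, l) : (game T w).Node) ∈ strategyTree T w) :
    InRange T w p := inRange_of_isNode hx.1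

theorem eventually_comp {j : ℕ} {e : Bool} (h : CompOK j e α)
    (hx : (((.comp j e, α), l) : (game T w).Node) ∈ strategyTree T w) :
    (game T w).Eventually (strategyTree T w) (((.comp j e, α), l) : (game T w).Node) := by
  induction α generalizing l with
  | nil =>
    have hj : j < w.length := (inRange_of_mem hx).1.2.2.2.2.1 j rfl
    refine eventually_of_popTrans rfl hx ⟨_, .inl (.comp_bot hj)⟩ fun s' hs' hy => ?_
    rcases hs' with hs' | hs' <;> cases hs'
    exact eventually_good
  | cons g α ih =>
    have hr := inRange_of_mem hx
    have hj : j < w.length := hr.1.2.2.2.2.1 j rfl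
    have hg := hr.2 _ List.mem_cons_self
    rcases g with ⟨b, i⟩ | _ | ⟨k, a, b⟩
    · refine eventually_of_popTrans rfl hx ⟨_, .inl (.comp_bit hj (hg.1 i rfl))⟩
        fun s' hs' hy => ?_
      rcases hs' with hs' | hs' <;> cases hs'
      · exact ih h.2 hy
      · exact absurd ⟨rfl, rfl⟩ h.1
    · refine eventually_of_popTrans rfl hx ⟨_, .inl (.comp_mark hj)⟩ fun s' hs' hy => ?_
      rcases hs' with hs' | hs' <;> cases hs'
      exact eventually_good
    · refine eventually_of_popTrans rfl hx ⟨_, .inl (.comp_cell hj (hg.2.1 a rfl) (hg.2.2 b rfl))⟩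
        fun s' hs' hy => ?_
      rcases hs' with hs' | hs' <;> cases hs'
      exact eventually_good

theorem eventually_skip {j : ℕ} {e : Bool} (h : SkipOK j e α)
    (hx : (((.skip j e, α), l) : (game T w).Node) ∈ strategyTree T w) :
    (game T w).Eventually (strategyTree T w) (((.skip j e, α), l) : (game T w).Node) := by
  induction α generalizing l with
  | nil =>
    have hj : j < w.length := (inRange_of_mem hx).1.2.2.2.2.1 j rfl
    refine eventually_of_popTrans rfl hx ⟨_, .inl (.skip_bot hj)⟩ fun s' hs' hy => ?_
    rcases hs' with hs' | hs' <;> cases hs'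
    exact eventually_good
  | cons g α ih =>
    have hr := inRange_of_mem hx
    have hj : j < w.length := hr.1.2.2.2.2.1 j rfl
    have hg := hr.2 _ List.mem_cons_self
    rcases g with ⟨b, i⟩ | _ | ⟨k, a, b⟩
    · refine eventually_of_popTrans rfl hx ⟨_, .inl (.skip_bit hj (hg.1 i rfl))⟩
        fun s' hs' hy => ?_
      rcases hs' with hs' | hs' <;> cases hs'
      exact ih h hy
    · refine eventually_of_popTrans rfl hx ⟨_, .inl (.skip_mark hj)⟩ fun s' hs' hy => ?_
      rcases hs' with hs' | hs' <;> cases hs'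
      exact eventually_good
    · refine eventually_of_popTrans rfl hx ⟨_, .inl (.skip_cell hj (hg.2.1 a rfl) (hg.2.2 b rfl))⟩
        fun s' hs' hy => ?_
      rcases hs' with hs' | hs' <;> cases hs'
      exact eventually_comp h hy

theorem eventually_incr {u : Bool} {j : ℕ} (h : IncrOK w.length u j α)
    (hx : (((.incr u j, α), l) : (game T w).Node) ∈ strategyTree T w) :
    (game T w).Eventually (strategyTree T w) (((.incr u j, α), l) : (game T w).Node) := by
  induction α generalizing l u j with
  | nil =>
    obtain ⟨rfl, rfl⟩ := h
    refine eventually_of_popTrans rfl hx ⟨_, .inl .incr_bot⟩ fun s' hs' hy => ?_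
    rcases hs' with hs' | hs' <;> cases hs'
    exact eventually_good
  | cons g α ih =>
    have hr := inRange_of_mem hx
    have hg := hr.2 _ List.mem_cons_self
    rcases g with ⟨b, i⟩ | _ | ⟨k, a, b⟩
    · obtain ⟨rfl, hj, h1, h2⟩ := h
      refine eventually_of_popTrans rfl hx ⟨_, .inl (.incr_bit hj)⟩ fun s' hs' hy => ?_
      rcases hs' with hs' | hs' <;> cases hs'
      · exact ih h1 hy
      · exact eventually_skip h2 hy
    · obtain ⟨rfl, rfl⟩ := h
      refine eventually_of_popTrans rfl hx ⟨_, .inl .incr_mark⟩ fun s' hs' hy => ?_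
      rcases hs' with hs' | hs' <;> cases hs'
      exact eventually_good
    · obtain ⟨rfl, rfl⟩ := h
      refine eventually_of_popTrans rfl hx ⟨_, .inl (.incr_cell (hg.2.1 a rfl) (hg.2.2 b rfl))⟩
        fun s' hs' hy => ?_
      rcases hs' with hs' | hs' <;> cases hs'
      exact eventually_good

theorem eventually_ones (h : OnesOK α)
    (hx : (((.ones, α), l) : (game T w).Node) ∈ strategyTree T w) :
    (game T w).Eventually (strategyTree T w) (((.ones, α), l) : (game T w).Node) := by
  induction α generalizing l with
  | nil =>
    refine eventually_of_popTrans rfl hx ⟨_, .inl .ones_bot⟩ fun s' hs' hy => ?_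
    rcases hs' with hs' | hs' <;> cases hs'
    exact eventually_good
  | cons g α ih =>
    have hg := (inRange_of_mem hx).2 _ List.mem_cons_self
    rcases g with ⟨b, i⟩ | _ | ⟨k, a, b⟩
    · obtain ⟨rfl, h⟩ := h
      refine eventually_of_popTrans rfl hx ⟨_, .inl (.ones_bit (hg.1 i rfl))⟩ fun s' hs' hy => ?_
      rcases hs' with hs' | hs' <;> cases hs'
      exact ih h hy
    · refine eventually_of_popTrans rfl hx ⟨_, .inl .ones_mark⟩ fun s' hs' hy => ?_
      rcases hs' with hs' | hs' <;> cases hs'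
      exact eventually_good
    · refine eventually_of_popTrans rfl hx ⟨_, .inl (.ones_cell (hg.2.1 a rfl) (hg.2.2 b rfl))⟩
        fun s' hs' hy => ?_
      rcases hs' with hs' | hs' <;> cases hs'
      exact eventually_good

theorem eventually_last (h : LastOK α)
    (hx : (((.last, α), l) : (game T w).Node) ∈ strategyTree T w) :
    (game T w).Eventually (strategyTree T w) (((.last, α), l) : (game T w).Node) := by
  rcases α with _ | ⟨_ | _ | ⟨k, a, b⟩, α⟩
  · exact h.elim
  · exact h.elim
  · exact h.elim
  · have hg := (inRange_of_mem hx).2 _ List.mem_cons_self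
    refine eventually_of_popTrans rfl hx ⟨_, .inl (.last_cell (hg.2.1 a rfl) (hg.2.2 b rfl))⟩
      fun s' hs' hy => ?_
    rcases hs' with hs' | hs' <;> cases hs'
    exact eventually_ones h hy

/-- What holds for all nodes with the same visible history as a given one holds, after one more pop
transition, for all nodes with the same visible history as the child. -/
theorem forall_visHist_child {P Q : Ctl ℕ → Prop} {s s' : Ctl ℕ} {α : List (Sym ℕ)}
    (hs : s.isGen = false)
    (h : ∀ y : (game T w).Node, (game T w).IsNode (game T w).init y →
      (game T w).visHist y = (game T w).visHist (((s, α), l) : (game T w).Node) → P y.1.1)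
    (hPQ : ∀ t t', t.vis = s.vis → t'.vis = s'.vis → P t →
      PopTrans (baseOf T w) t α.head? t' → Q t')
    (y : (game T w).Node) (hy : (game T w).IsNode (game T w).init y)
    (e : (game T w).visHist y =
      (game T w).visHist (((s', α.tail), (s, α) :: l) : (game T w).Node)) : Q y.1.1 := by
  obtain ⟨⟨t', α'⟩, _ | ⟨⟨t, α''⟩, l'⟩⟩ := y
  · cases (List.cons.inj e).2
  · obtain ⟨e1, e2⟩ := List.cons.inj e
    obtain ⟨h1, h2⟩ := hy.of_cons
    obtain ⟨e3, e4⟩ := mk_eq_mk_iff.1 e1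
    obtain ⟨e5, e6⟩ := mk_eq_mk_iff.1 (List.cons.inj e2).1
    obtain rfl : α'' = α := e6
    have ht : t.isGen = false := by
      by_contra hg
      have hg : t.isGen = true := by simpa using hg
      have := eq_of_vis_eq (.inl hg) (show t.vis = s.vis from e5)
      rw [← this, hg] at hs
      cases hs
    obtain ⟨t'', h3, e7⟩ := (trans_iff_popTrans ht).1 h2
    obtain rfl : t' = t'' := congrArg Prod.fst e7
    exact hPQ t t' e5 e3 (h _ h1 e2) h3

theorem eventually_search {I : Memo ℕ} (h : Found S α)
    (hx : (((.search I, α), l) : (game T w).Node) ∈ strategyTree T w)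
    (H : ∀ y : (game T w).Node, (game T w).IsNode (game T w).init y →
      (game T w).visHist y = (game T w).visHist (((.search I, α), l) : (game T w).Node) →
        ∀ J, y.1.1 = .search J → J ∈ S) :
    (game T w).Eventually (strategyTree T w) (((.search I, α), l) : (game T w).Node) := by
  induction α generalizing l with
  | nil => exact h.elim
  | cons g α ih =>
    have hr := inRange_of_mem hx
    have hI : I.InRange (baseOf T w) := ⟨hr.1.2.2.2.2.1, hr.1.2.2.2.2.2⟩
    have hg := hr.2 _ List.mem_cons_self
    have H' : ∀ y : (game T w).Node, (game T w).IsNode (game T w).init y →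
        (game T w).visHist y = (game T w).visHist
          (((.search I, α), (.search I, g :: α) :: l) : (game T w).Node) →
          ∀ J, y.1.1 = .search J → J ∈ S := by
      refine forall_visHist_child (P := fun t => ∀ J, t = .search J → J ∈ S)
        (Q := fun t => ∀ J, t = .search J → J ∈ S) (α := g :: α) rfl H ?_
      rintro t t' e e' hP ht J rfl
      obtain ⟨K, rfl⟩ := eq_search_of_tag (congrArg Prod.fst e)
      rcases ht with ht | ht
      · cases ht
      · generalize (g :: α).head? = o at ht
        cases ht <;> exact hP _ rfl
    rcases g with ⟨b, i⟩ | _ | ⟨k, a, b⟩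
    · refine eventually_of_popTrans rfl hx ⟨_, .inr (.search_bit hI (hg.1 i rfl))⟩
        fun s' hs' hy => ?_
      rcases hs' with hs' | hs' <;> cases hs'
      exact ih h hy H'
    · exact h.elim
    · refine eventually_of_popTrans rfl hx
        ⟨_, .inr (.search_cell hI (hg.2.1 a rfl) (hg.2.2 b rfl))⟩ fun s' hs' hy => ?_
      have hallow := hy.2.1.2 rfl
      rcases hs' with hs' | hs' <;> cases hs'
      · refine ih (h.resolve_right fun hm => ?_) hy H'
        exact hallow.1 ⟨k, a, b, α, rfl, fun y hy e J hJ => hm J (H y hy e J hJ)⟩ rfl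
      · obtain ⟨k', a', b', α', e, hm⟩ := hallow.2 (by simp [Ctl.tag])
        cases e
        exact eventually_comp (hm _ hx.1 rfl _ rfl) hy
      · exact eventually_good

theorem eventually_toMark {I : Memo ℕ} (h : FoundNext S α)
    (hx : (((.toMark I, α), l) : (game T w).Node) ∈ strategyTree T w)
    (H : ∀ y : (game T w).Node, (game T w).IsNode (game T w).init y →
      (game T w).visHist y = (game T w).visHist (((.toMark I, α), l) : (game T w).Node) →
        ∃ J ∈ S, y.1.1 = .toMark J) :
    (game T w).Eventually (strategyTree T w) (((.toMark I, α), l) : (game T w).Node) := by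
  induction α generalizing l with
  | nil =>
    have hr := inRange_of_mem hx
    have hI : I.InRange (baseOf T w) := ⟨hr.1.2.2.2.2.1, hr.1.2.2.2.2.2⟩
    refine eventually_of_popTrans rfl hx ⟨_, .inr (.toMark_bot hI)⟩ fun s' hs' hy => ?_
    rcases hs' with hs' | hs' <;> cases hs'
    exact eventually_good
  | cons g α ih =>
    have hr := inRange_of_mem hx
    have hI : I.InRange (baseOf T w) := ⟨hr.1.2.2.2.2.1, hr.1.2.2.2.2.2⟩
    have hg := hr.2 _ List.mem_cons_self
    have H' : g ≠ .mark → ∀ y : (game T w).Node, (game T w).IsNode (game T w).init y →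
        (game T w).visHist y = (game T w).visHist
          (((.toMark I, α), (.toMark I, g :: α) :: l) : (game T w).Node) →
          ∃ J ∈ S, y.1.1 = .toMark J := by
      intro hne
      refine forall_visHist_child (P := fun t => ∃ J ∈ S, t = .toMark J)
        (Q := fun t => ∃ J ∈ S, t = .toMark J) (α := g :: α) rfl H ?_
      rintro t t' - - ⟨J, hJ, rfl⟩ ht
      rcases ht with ht | ht <;> cases ht
      exacts [⟨J, hJ, rfl⟩, ⟨J, hJ, rfl⟩, absurd rfl hne]
    rcases g with ⟨b, i⟩ | _ | ⟨k, a, b⟩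
    · refine eventually_of_popTrans rfl hx ⟨_, .inr (.toMark_bit hI (hg.1 i rfl))⟩
        fun s' hs' hy => ?_
      rcases hs' with hs' | hs' <;> cases hs'
      exact ih h hy (H' (by simp))
    · refine eventually_of_popTrans rfl hx ⟨_, .inr (.toMark_mark hI)⟩ fun s' hs' hy => ?_
      rcases hs' with hs' | hs' <;> cases hs'
      refine eventually_search h hy ?_
      refine forall_visHist_child (P := fun t => ∃ J ∈ S, t = .toMark J)
        (Q := fun t => ∀ J, t = .search J → J ∈ S) (α := Sym.mark :: α) rfl H ?_
      rintro t t' - - ⟨J, hJ, rfl⟩ ht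
      rcases ht with ht | ht <;> cases ht
      rintro K ⟨⟩
      exact hJ
    · refine eventually_of_popTrans rfl hx
        ⟨_, .inr (.toMark_cell hI (hg.2.1 a rfl) (hg.2.2 b rfl))⟩ fun s' hs' hy => ?_
      rcases hs' with hs' | hs' <;> cases hs'
      exact ih h hy (H' (by simp))

/-- While an address is read, everything that may be remembered is recorded in `S`; once the
address ends, the check has decided what to remember. -/
theorem eventually_read {s : Ctl ℕ} (h : ReadOK S α) (hs : s.tag = 17)
    (hx : (((s, α), l) : (game T w).Node) ∈ strategyTree T w)
    (H : ∀ y : (game T w).Node, (game T w).IsNode (game T w).init y →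
      (game T w).visHist y = (game T w).visHist (((s, α), l) : (game T w).Node) →
        y.1.1 = .undecided ∨ ∃ J ∈ S, y.1.1 = .toMark J) :
    (game T w).Eventually (strategyTree T w) (((s, α), l) : (game T w).Node) := by
  induction α generalizing l s S with
  | nil =>
    rcases eq_of_tag_eq_seventeen hs with rfl | ⟨I, rfl⟩
    · refine eventually_of_popTrans rfl hx ⟨_, .inr .und_bot⟩ fun s' hs' hy => ?_
      rcases hs' with hs' | hs' <;> cases hs'
      exact eventually_good
    · have hr := inRange_of_mem hx
      have hI : I.InRange (baseOf T w) := ⟨hr.1.2.2.2.2.1, hr.1.2.2.2.2.2⟩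
      refine eventually_of_popTrans rfl hx ⟨_, .inr (.toMark_bot hI)⟩ fun s' hs' hy => ?_
      rcases hs' with hs' | hs' <;> cases hs'
      exact eventually_good
  | cons g α ih =>
    have hr := inRange_of_mem hx
    have hI : ∀ I, s = .toMark I → I.InRange (baseOf T w) := by
      rintro I rfl
      exact ⟨hr.1.2.2.2.2.1, hr.1.2.2.2.2.2⟩
    have hg := hr.2 _ List.mem_cons_self
    have hgen : s.isGen = false := by
      rcases eq_of_tag_eq_seventeen hs with rfl | ⟨I, rfl⟩ <;> rfl
    rcases g with ⟨b, i⟩ | _ | ⟨k, a, b⟩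
    · have hS : ∀ s', (((s', α), (s, .bit b i :: α) :: l) : (game T w).Node) ∈ strategyTree T w →
          s'.tag = 17 → (game T w).Eventually (strategyTree T w)
            (((s', α), (s, .bit b i :: α) :: l) : (game T w).Node) := by
        intro s' hy hs'
        refine ih h hs' hy ?_
        refine forall_visHist_child (P := fun t => t = .undecided ∨ ∃ J ∈ S, t = .toMark J)
          (Q := fun t => t = .undecided ∨ ∃ J ∈ insert (Memo.addr i b) S, t = .toMark J)
          (α := .bit b i :: α) hgen H ?_
        rintro t t' - - (rfl | ⟨J, hJ, rfl⟩) ht <;> rcases ht with ht | ht <;> cases ht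
        exacts [.inl rfl, .inr ⟨_, .inl rfl, rfl⟩, .inr ⟨J, .inr hJ, rfl⟩]
      refine eventually_of_popTrans hgen hx ?_ fun s' hs' hy => hS s' hy ?_
      · rcases eq_of_tag_eq_seventeen hs with rfl | ⟨I, rfl⟩
        · exact ⟨_, .inr (.und_bit (hg.1 i rfl))⟩
        · exact ⟨_, .inr (.toMark_bit (hI I rfl) (hg.1 i rfl))⟩
      · rcases eq_of_tag_eq_seventeen hs with rfl | ⟨I, rfl⟩ <;>
          rcases hs' with hs' | hs' <;> cases hs' <;> rfl
    · rcases eq_of_tag_eq_seventeen hs with rfl | ⟨I, rfl⟩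
      · refine eventually_of_popTrans rfl hx ⟨_, .inr .und_mark⟩ fun s' hs' hy => ?_
        rcases hs' with hs' | hs' <;> cases hs'
        exact eventually_good
      · refine eventually_of_popTrans rfl hx ⟨_, .inr (.toMark_mark (hI I rfl))⟩
          fun s' hs' hy => ?_
        rcases hs' with hs' | hs' <;> cases hs'
        refine eventually_search h hy ?_
        refine forall_visHist_child (P := fun t => t = .undecided ∨ ∃ J ∈ S, t = .toMark J)
          (Q := fun t => ∀ J, t = .search J → J ∈ S) (α := Sym.mark :: α) rfl H ?_
        rintro t t' - - (rfl | ⟨J, hJ, rfl⟩) ht <;> rcases ht with ht | ht <;> cases ht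
        · rintro K ⟨⟩
        · rintro K ⟨⟩
          exact hJ
    · rcases eq_of_tag_eq_seventeen hs with rfl | ⟨I, rfl⟩
      · refine eventually_of_popTrans rfl hx ⟨_, .inr (.und_cell (hg.2.1 a rfl) (hg.2.2 b rfl))⟩
          fun s' hs' hy => ?_
        rcases hs' with hs' | hs' <;> cases hs'
        exact eventually_good
      · refine eventually_of_popTrans rfl hx
          ⟨_, .inr (.toMark_cell (hI I rfl) (hg.2.1 a rfl) (hg.2.2 b rfl))⟩ fun s' hs' hy => ?_
        rcases hs' with hs' | hs' <;> cases hs'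
        refine eventually_toMark h hy ?_
        intro y hy e
        have htag : y.1.1.tag = 17 := congrArg Prod.fst (mk_eq_mk_iff.1 (List.cons.inj e).1).1
        revert htag
        refine forall_visHist_child (P := fun t => t = .undecided ∨ ∃ J ∈ S, t = .toMark J)
          (Q := fun t => t.tag = 17 → ∃ J ∈ S, t = .toMark J) (α := Sym.cell k a b :: α) rfl H ?_
          y hy e
        rintro t t' - - (rfl | ⟨J, hJ, rfl⟩) ht htag <;> rcases ht with ht | ht <;> cases ht
        · simp [Ctl.tag] at htag
        · exact ⟨J, hJ, rfl⟩

theorem eventually_chk (h : CheckOK w.length α)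
    (hx : (((.chk, α), l) : (game T w).Node) ∈ strategyTree T w) :
    (game T w).Eventually (strategyTree T w) (((.chk, α), l) : (game T w).Node) := by
  induction α generalizing l with
  | nil =>
    refine eventually_of_popTrans rfl hx ⟨_, .inl .chk_bot⟩ fun s' hs' hy => ?_
    rcases hs' with hs' | hs' <;> cases hs'
    exact eventually_good
  | cons g α ih =>
    have hg := (inRange_of_mem hx).2 _ List.mem_cons_self
    rcases g with ⟨b, i⟩ | _ | ⟨k, a, b⟩
    · refine eventually_of_popTrans rfl hx ⟨_, .inl (.chk_bit (hg.1 i rfl))⟩ fun s' hs' hy => ?_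
      rcases hs' with hs' | hs' <;> cases hs'
      exact ih h hy
    · refine eventually_of_popTrans rfl hx ⟨_, .inl .chk_mark⟩ fun s' hs' hy => ?_
      rcases hs' with hs' | hs' <;> cases hs'
      · exact ih h.1 hy
      · exact eventually_last h.2 hy
    · obtain ⟨h1, h2, h3⟩ := h
      have key : ∀ s', (((s', α), (.chk, .cell k a b :: α) :: l) : (game T w).Node) ∈
          strategyTree T w → s'.tag = 17 → (game T w).Eventually (strategyTree T w)
            (((s', α), (.chk, .cell k a b :: α) :: l) : (game T w).Node) := by
        intro s' hy hs'
        refine eventually_read h3 hs' hy ?_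
        intro y hy e
        have htag : y.1.1.tag = 17 :=
          (congrArg Prod.fst (mk_eq_mk_iff.1 (List.cons.inj e).1).1).trans hs'
        revert htag
        refine forall_visHist_child (P := fun t => t = .chk)
          (Q := fun t => t.tag = 17 → t = .undecided ∨
            ∃ J ∈ ({.cont a k.before} : Set (Memo ℕ)), t = .toMark J)
          (s := .chk) (α := .cell k a b :: α) rfl (fun y _ e => ?_) ?_ y hy e
        · exact (eq_of_vis_eq (.inr rfl) (mk_eq_mk_iff.1 (List.cons.inj e).1).1.symm).symm
        · rintro t t' - - rfl ht htag
          rcases ht with ht | ht <;> cases ht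
          exacts [by simp [Ctl.tag] at htag, by simp [Ctl.tag] at htag, .inl rfl,
            .inr ⟨_, rfl, rfl⟩]
      refine eventually_of_popTrans rfl hx ⟨_, .inl (.chk_cell (hg.2.1 a rfl) (hg.2.2 b rfl))⟩
        fun s' hs' hy => ?_
      rcases hs' with hs' | hs' <;> cases hs'
      · exact ih h1 hy
      · exact eventually_incr h2 hy
      · exact key _ hy rfl
      · exact key _ hy rfl

end eventually

theorem eventually_of_winIn {m : ℕ} {p : Pos} {l : List Pos} (h : WinIn T w m p)
    (hx : ((p, l) : (game T w).Node) ∈ strategyTree T w) :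
    (game T w).Eventually (strategyTree T w) ((p, l) : (game T w).Node) := by
  induction m using Nat.strong_induction_on generalizing p l with
  | _ m ih =>
    by_cases he : p.1.isEnv = true
    · obtain ⟨p', hp', -⟩ := exists_goodMove he ⟨m, h⟩
      refine eventually_of_forall hx ⟨p', hp'⟩ fun p'' hp'' hy => ?_
      rcases hy.2.1.1 h.isGen he ⟨m, h⟩ with ⟨h1, h2⟩ | ⟨k, hk, hlt⟩
      · obtain ⟨s, α⟩ := p''
        obtain rfl : s = .chk := h1
        exact eventually_chk h2 hy
      · exact ih k (hlt m h) hk hy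
    · cases h with
      | fin => exact absurd rfl he
      | env _ he' => exact absurd he' he
      | all hex hall =>
        exact eventually_of_forall hx hex fun p' hp' hy =>
          ih _ (Nat.lt_succ_self _) (hall p' hp') hy

theorem wins_of_winIn {m : ℕ} (h : WinIn T w m (.init true 0, [])) : (game T w).Wins :=
  ⟨_, isStrategyTree_strategyTree, eventually_of_winIn h isStrategyTree_strategyTree.root_mem⟩

end PMC

namespace PMC

/-! ### Stack contents without errors -/

/-- Increasing a number by one flips the bit `i` iff all lower bits are `true`; here, this is
expressed in terms of the larger number. -/
theorem testBit_pred {x : ℕ} (hx : x ≠ 0) (i : ℕ) :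
    (x - 1).testBit i = (x.testBit i == decide (x % 2 ^ i ≠ 0)) := by
  have hp : 0 < 2 ^ i := Nat.two_pow_pos i
  have hd := Nat.div_add_mod x (2 ^ i)
  have hlt := Nat.mod_lt x hp
  rw [Nat.testBit_eq_decide_div_mod_eq, Nat.testBit_eq_decide_div_mod_eq]
  generalize x / 2 ^ i = q at hd ⊢
  generalize x % 2 ^ i = r at hd hlt ⊢
  generalize 2 ^ i = p at hp hd hlt ⊢
  by_cases hr : r = 0
  · subst hr
    obtain ⟨q, rfl⟩ : ∃ q', q = q' + 1 := ⟨q - 1, by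
      rcases q with _ | q
      · simp at hd
        omega
      · rfl⟩
    have : (x - 1) / p = q := by
      rw [Nat.div_eq_iff hp]
      have : p * (q + 1) = p * q + p := by ring
      have : q * p = p * q := by ring
      omega
    rw [this]
    rcases Nat.mod_two_eq_zero_or_one q with h | h
    · simp [h, Nat.add_mod]
    · simp [h, Nat.add_mod]
  · have : (x - 1) / p = q := by
      rw [Nat.div_eq_iff hp]
      have : q * p = p * q := by ring
      omega
    simp [this, hr]

/-- The bits of `x` at the positions `j, …, j + d - 1`. -/
def addrBits (j d x : ℕ) : List (Sym ℕ) := (List.range' j d).map fun i => .bit (x.testBit i) i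

/-- The cells `g (m - 1), …, g 0`, each with its address in `n` bits. -/
def blockW (n : ℕ) (g : ℕ → Kind × ℕ × ℕ) : ℕ → List (Sym ℕ)
  | 0 => []
  | m + 1 => .cell (g m).1 (g m).2.1 (g m).2.2 :: (addrBits 0 n m ++ blockW n g m)

/-- The stack content that describes a sequence of steps on `2 ^ n` cells, the last one first. -/
def stackW (n : ℕ) : List (ℕ → Kind × ℕ × ℕ) → List (Sym ℕ)
  | [] => []
  | g :: L => .mark :: (blockW n g (2 ^ n) ++ stackW n L)

/-- Each step starts with the tape and the head position with which the step before it ends. -/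
def Coherent (n : ℕ) : List (ℕ → Kind × ℕ × ℕ) → Prop
  | g :: g' :: L => Coherent n (g' :: L) ∧
      ∀ x < 2 ^ n, (g x).2.1 = (g' x).2.2 ∧ (g x).1.before = (g' x).1.after
  | _ => True

/-- The word does not start with a bit. -/
def NoBit : List (Sym ℕ) → Prop
  | .bit _ _ :: _ => False
  | _ => True

variable {n : ℕ} {β : List (Sym ℕ)} {g : ℕ → Kind × ℕ × ℕ} {L : List (ℕ → Kind × ℕ × ℕ)}

theorem addrBits_succ (j d x : ℕ) :
    addrBits j (d + 1) x = .bit (x.testBit j) j :: addrBits (j + 1) d x := rfl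

theorem noBit_stackW : NoBit (stackW n L) := by cases L <;> trivial

theorem noBit_blockW {m : ℕ} : NoBit (blockW n g m ++ stackW n L) := by
  cases m
  · exact noBit_stackW
  · trivial

theorem blockW_congr {g g' : ℕ → Kind × ℕ × ℕ} {m : ℕ} (h : ∀ x < m, g x = g' x) :
    blockW n g m = blockW n g' m := by
  induction m with
  | zero => rfl
  | succ m ih => rw [blockW, blockW, h m (by omega), ih fun x hx => h x (by omega)]

theorem compOK_addrBits {j e i d x} (hβ : NoBit β) :
    CompOK j e (addrBits i d x ++ β) ↔ (i ≤ j → j < i + d → x.testBit j = e) := by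
  induction d generalizing i with
  | zero =>
    refine iff_of_true ?_ (by omega)
    rcases β with _ | ⟨_ | _ | _, β⟩
    exacts [trivial, hβ.elim, trivial, trivial]
  | succ d ih =>
    rw [addrBits_succ, List.cons_append, CompOK, ih]
    constructor
    · rintro ⟨h1, h2⟩ h3 h4
      rcases Nat.eq_or_lt_of_le h3 with rfl | h3
      · cases h : x.testBit i <;> cases e <;> simp_all
      · exact h2 h3 (by omega)
    · intro h
      refine ⟨?_, fun h1 h2 => h (by omega) (by omega)⟩
      rintro ⟨rfl, h'⟩
      rw [h le_rfl (by omega)] at h'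
      cases e <;> cases h'

theorem skipOK_addrBits {j e i d x} : SkipOK j e (addrBits i d x ++ β) ↔ SkipOK j e β := by
  induction d generalizing i with
  | zero => rfl
  | succ d ih => exact ih

theorem onesOK_addrBits {i d x} (hβ : NoBit β) :
    OnesOK (addrBits i d x ++ β) ↔ ∀ j, i ≤ j → j < i + d → x.testBit j = true := by
  induction d generalizing i with
  | zero =>
    refine iff_of_true ?_ (by omega)
    rcases β with _ | ⟨_ | _ | _, β⟩
    exacts [trivial, hβ.elim, trivial, trivial]
  | succ d ih =>
    rw [addrBits_succ, List.cons_append, OnesOK, ih]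
    constructor
    · rintro ⟨h1, h2⟩ j h3 h4
      rcases Nat.eq_or_lt_of_le h3 with rfl | h3
      · exact h1
      · exact h2 j h3 (by omega)
    · exact fun h => ⟨h i le_rfl (by omega), fun j h1 h2 => h j (by omega) (by omega)⟩

theorem incrOK_addrBits {j d x} (h : j + d = n) :
    IncrOK n (decide (x % 2 ^ j ≠ 0)) j (addrBits j d x ++ β) ↔
      IncrOK n (decide (x % 2 ^ n ≠ 0)) n β ∧
        ∀ i, j ≤ i → i < n → SkipOK i (x.testBit i == decide (x % 2 ^ i ≠ 0)) β := by
  induction d generalizing j with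
  | zero =>
    obtain rfl : j = n := h
    exact ⟨fun h => ⟨h, fun i h1 h2 => absurd h1 (by omega)⟩, fun h => h.1⟩
  | succ d ih =>
    have hu : (decide (x % 2 ^ j ≠ 0) || x.testBit j) = decide (x % 2 ^ (j + 1) ≠ 0) := by
      rw [Nat.mod_pow_succ, Nat.testBit_eq_decide_div_mod_eq]
      have := Nat.two_pow_pos j
      rcases Nat.mod_two_eq_zero_or_one (x / 2 ^ j) with h | h <;> simp [h]
    rw [addrBits_succ, List.cons_append, IncrOK, hu, ih (by omega), skipOK_addrBits]
    constructor
    · rintro ⟨-, -, ⟨h1, h2⟩, h3⟩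
      refine ⟨h1, fun i h4 h5 => ?_⟩
      rcases Nat.eq_or_lt_of_le h4 with rfl | h4
      · exact h3
      · exact h2 i h4 h5
    · rintro ⟨h1, h2⟩
      exact ⟨rfl, by omega, ⟨h1, fun i h3 h4 => h2 i (by omega) h4⟩, h2 j le_rfl (by omega)⟩

theorem incrOK_zero_addrBits {x} (hx : x < 2 ^ n) :
    IncrOK n false 0 (addrBits 0 n x ++ β) ↔ IncrOK n (decide (x ≠ 0)) n β ∧
      ∀ i < n, SkipOK i (x.testBit i == decide (x % 2 ^ i ≠ 0)) β := by
  have := incrOK_addrBits (β := β) (j := 0) (x := x) (Nat.zero_add n)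
  simpa only [pow_zero, Nat.mod_one, ne_eq, not_true_eq_false, decide_false, Nat.mod_eq_of_lt hx,
    Nat.zero_le, true_imp_iff] using this

theorem incrOK_blockW {x} (hx : x < 2 ^ n) :
    IncrOK n false 0 (addrBits 0 n x ++ (blockW n g x ++ stackW n L)) := by
  rw [incrOK_zero_addrBits hx]
  rcases x with _ | x
  · cases L
    · exact ⟨⟨rfl, rfl⟩, fun _ _ => trivial⟩
    · exact ⟨⟨rfl, rfl⟩, fun _ _ => trivial⟩
  · refine ⟨⟨rfl, rfl⟩, fun i _ => ?_⟩
    rw [← testBit_pred x.succ_ne_zero]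
    change CompOK _ _ (_ ++ _ ++ _)
    rw [List.append_assoc, compOK_addrBits noBit_blockW]
    exact fun _ _ => rfl

theorem exists_bits_of_incrOK {u : Bool} {j : ℕ} {α : List (Sym ℕ)} (h : IncrOK n u j α) :
    ∃ (f : ℕ → Bool) (β : List (Sym ℕ)),
      α = (List.range' j (n - j)).map (fun i => Sym.bit (f i) i) ++ β := by
  induction α generalizing u j with
  | nil => exact ⟨fun _ => false, [], by simp [h.2]⟩
  | cons s α ih =>
    rcases s with ⟨b, i⟩ | _ | _
    · obtain ⟨rfl, h1, h2, -⟩ := h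
      obtain ⟨f, β, rfl⟩ := ih h2
      refine ⟨fun k => if k = i then b else f k, β, ?_⟩
      rw [show n - i = (n - (i + 1)) + 1 by omega, List.range'_succ, List.map_cons,
        List.cons_append]
      simp only [if_true]
      refine congrArg (Sym.bit b i :: · ++ β) (List.map_congr_left fun k hk => ?_)
      rw [List.mem_range'_1] at hk
      rw [if_neg (by omega)]
    · exact ⟨fun _ => false, .mark :: α, by simp [h.2]⟩
    · exact ⟨fun _ => false, _ :: α, by rw [h.2, Nat.sub_self]; rfl⟩

theorem exists_testBit_eq (n : ℕ) (f : ℕ → Bool) : ∃ x < 2 ^ n, ∀ i < n, x.testBit i = f i :=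
  ⟨Nat.ofBits fun i : Fin n => f i, Nat.ofBits_lt_two_pow _, fun i hi =>
    Nat.testBit_ofBits_lt (fun i : Fin n => f i) i hi⟩

theorem eq_of_testBit_eq_lt {x y : ℕ} (hx : x < 2 ^ n) (hy : y < 2 ^ n)
    (h : ∀ i < n, x.testBit i = y.testBit i) : x = y := by
  refine Nat.eq_of_testBit_eq fun i => ?_
  by_cases hi : i < n
  · exact h i hi
  · have := Nat.pow_le_pow_right (n := 2) (by omega) (Nat.le_of_not_lt hi)
    rw [Nat.testBit_lt_two_pow (by omega), Nat.testBit_lt_two_pow (by omega)]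

/-- After a cell, the checks of the addresses determine the address that follows, and hence all
addresses in the block, from the last cell on. -/
theorem exists_blockW {δ : List (Sym ℕ)} (hm : .mark ∉ δ) (hb : NoBit δ)
    (h : CheckOK n (δ ++ stackW n L)) : ∃ g m, m ≤ 2 ^ n ∧ δ = blockW n g m := by
  induction hl : δ.length using Nat.strong_induction_on generalizing δ with
  | _ l ih =>
    rcases δ with _ | ⟨_ | _ | ⟨k, a, b⟩, δ⟩
    · exact ⟨fun _ => (.stay, 0, 0), 0, Nat.zero_le _, rfl⟩
    · exact hb.elim
    · exact absurd List.mem_cons_self hm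
    · obtain ⟨h1, h2, -⟩ := h
      obtain ⟨f, β, e⟩ := exists_bits_of_incrOK h2
      obtain ⟨x, hx, hxf⟩ := exists_testBit_eq n f
      have e' : δ ++ stackW n L = addrBits 0 n x ++ β := by
        refine e.trans (congrArg (· ++ β) (List.map_congr_left fun i hi => ?_))
        rw [List.mem_range'_1] at hi
        rw [hxf i (by omega)]
      obtain ⟨δ', rfl, rfl⟩ : ∃ δ', δ = addrBits 0 n x ++ δ' ∧ β = δ' ++ stackW n L := by
        rcases List.append_eq_append_iff.1 e' with ⟨c, hc, hc'⟩ | ⟨c, hc, hc'⟩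
        · have : c = [] := by
            rcases c with _ | ⟨s, c⟩
            · rfl
            · exfalso
              have hs : s ∈ addrBits 0 n x := by rw [hc]; simp
              obtain ⟨i, -, rfl⟩ := List.mem_map.1 hs
              have := noBit_stackW (n := n) (L := L)
              rw [hc'] at this
              exact this
          subst this
          exact ⟨[], by simpa using hc.symm, by simpa using hc'.symm⟩
        · exact ⟨c, hc, hc'⟩
      obtain ⟨h2, h3⟩ := (incrOK_zero_addrBits hx).1 (e' ▸ h2 :
        IncrOK n false 0 (addrBits 0 n x ++ (δ' ++ stackW n L)))
      have hm' : .mark ∉ δ' := fun hm' => hm (by simp [hm'])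
      have hcheck : ∀ l : List (Sym ℕ), CheckOK n (l ++ (δ' ++ stackW n L)) →
          CheckOK n (δ' ++ stackW n L) := by
        intro l hl
        induction l with
        | nil => exact hl
        | cons s l ih =>
          rcases s with _ | _ | _
          · exact ih hl
          · exact ih hl.1
          · exact ih hl.1
      have hb' : NoBit δ' := by
        rcases δ' with _ | ⟨_ | _ | _, δ'⟩
        · trivial
        · exact absurd h2.2.1 (lt_irrefl _)
        · trivial
        · trivial
      have h1 : CheckOK n (addrBits 0 n x ++ δ' ++ stackW n L) := h1
      rw [e'] at h1
      obtain ⟨g, m, hm, rfl⟩ := ih δ'.length (by rw [← hl]; simp) hm' hb' (hcheck _ h1) rfl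
      have hxm : x = m := by
        rcases m with _ | m
        · cases L <;> simpa using h2.1
        · have hx0 : x ≠ 0 := by simpa using h2.1
          refine (?_ : x = x - 1 + 1).trans
            (congrArg (· + 1) (eq_of_testBit_eq_lt (n := n) (by omega) (by omega) fun i hi => ?_))
          · omega
          · have := h3 i hi
            rw [← testBit_pred hx0] at this
            change CompOK _ _ (_ ++ _ ++ _) at this
            rw [List.append_assoc, compOK_addrBits noBit_blockW] at this
            exact (this (Nat.zero_le _) (by omega)).symm
      subst hxm
      refine ⟨Function.update g x (k, a, b), x + 1, hx, ?_⟩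
      rw [blockW, Function.update_self]
      refine congrArg (Sym.cell k a b :: addrBits 0 n x ++ ·) (blockW_congr fun y hy => ?_)
      rw [Function.update_of_ne hy.ne]

theorem exists_blockW_of_mark {δ : List (Sym ℕ)} (hm : .mark ∉ δ)
    (h : CheckOK n (.mark :: (δ ++ stackW n L))) : ∃ g, δ = blockW n g (2 ^ n) := by
  obtain ⟨h1, h2⟩ := h
  have hb : NoBit δ := by
    rcases δ with _ | ⟨_ | _ | _, δ⟩
    exacts [trivial, h2.elim, trivial, trivial]
  obtain ⟨g, m, hm, rfl⟩ := exists_blockW hm hb h1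
  refine ⟨g, congrArg _ ?_⟩
  rcases m with _ | m
  · cases L <;> exact h2.elim
  · change OnesOK (_ ++ _ ++ _) at h2
    rw [List.append_assoc, onesOK_addrBits noBit_blockW] at h2
    have := eq_of_testBit_eq_lt (n := n) (x := m) (y := 2 ^ n - 1) (by omega)
      (Nat.sub_lt (Nat.two_pow_pos n) one_pos) fun i hi => by
        rw [h2 i (Nat.zero_le _) (by omega), Nat.testBit_two_pow_sub_one]
        simp [hi]
    omega

theorem lastOK_blockW : LastOK (blockW n g (2 ^ n) ++ stackW n L) := by
  obtain ⟨m, hm⟩ : ∃ m, 2 ^ n = m + 1 := ⟨2 ^ n - 1, by have := Nat.two_pow_pos n; omega⟩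
  rw [hm]
  change OnesOK (_ ++ _ ++ _)
  rw [List.append_assoc, onesOK_addrBits noBit_blockW]
  intro i _ hi
  rw [show m = 2 ^ n - 1 by omega, Nat.testBit_two_pow_sub_one]
  simpa using hi

theorem checkOK_addrBits {i d x} : CheckOK n (addrBits i d x ++ β) ↔ CheckOK n β := by
  induction d generalizing i with
  | zero => rfl
  | succ d ih => exact ih

theorem readOK_addrBits {S : Set (Memo ℕ)} {i d x} (hβ : NoBit β) :
    ReadOK S (addrBits i d x ++ β) ↔
      FoundNext (S ∪ {I | ∃ j, i ≤ j ∧ j < i + d ∧ I = .addr j (x.testBit j)}) β := by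
  induction d generalizing i S with
  | zero =>
    have : S ∪ {I | ∃ j, i ≤ j ∧ j < i + 0 ∧ I = Memo.addr j (x.testBit j)} = S := by
      ext I
      simp only [Set.mem_union, Set.mem_ofPred_eq, or_iff_left_iff_imp]
      rintro ⟨j, h1, h2, -⟩
      omega
    rw [this]
    rcases β with _ | ⟨_ | _ | _, β⟩
    exacts [Iff.rfl, hβ.elim, Iff.rfl, Iff.rfl]
  | succ d ih =>
    rw [addrBits_succ, List.cons_append, ReadOK, ih]
    refine Iff.of_eq (congrArg (FoundNext · β) ?_)
    ext I
    simp only [Set.mem_union, Set.mem_insert_iff, Set.mem_ofPred_eq]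
    constructor
    · rintro ((rfl | h) | ⟨j, h1, h2, rfl⟩)
      exacts [.inr ⟨i, le_rfl, by omega, rfl⟩, .inl h, .inr ⟨j, by omega, by omega, rfl⟩]
    · rintro (h | ⟨j, h1, h2, rfl⟩)
      · exact .inl (.inr h)
      · rcases Nat.eq_or_lt_of_le h1 with rfl | h1
        · exact .inl (.inl rfl)
        · exact .inr ⟨j, h1, by omega, rfl⟩

theorem foundNext_addrBits {S : Set (Memo ℕ)} {i d x} :
    FoundNext S (addrBits i d x ++ β) ↔ FoundNext S β := by
  induction d generalizing i with
  | zero => rfl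
  | succ d ih => exact ih

theorem foundNext_blockW {S : Set (Memo ℕ)} {m} :
    FoundNext S (blockW n g m ++ β) ↔ FoundNext S β := by
  induction m with
  | zero => rfl
  | succ m ih =>
    change FoundNext S (_ ++ _ ++ _) ↔ _
    rw [List.append_assoc, foundNext_addrBits, ih]

theorem found_addrBits {S : Set (Memo ℕ)} {i d x} :
    Found S (addrBits i d x ++ β) ↔ Found S β := by
  induction d generalizing i with
  | zero => rfl
  | succ d ih => exact ih

theorem found_blockW {S : Set (Memo ℕ)} {m} : Found S (blockW n g m ++ stackW n L) ↔
    ∃ y < m, ∀ I ∈ S, I.Matches (g y).1 (g y).2.2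
      (addrBits 0 n y ++ (blockW n g y ++ stackW n L)) := by
  induction m with
  | zero =>
    refine iff_of_false ?_ (by simp)
    cases L <;> exact id
  | succ m ih =>
    change Found S (_ ++ _ ++ _) ∨ (∀ I ∈ S, I.Matches _ _ (_ ++ _ ++ _)) ↔ _
    rw [List.append_assoc, found_addrBits, ih]
    constructor
    · rintro (⟨y, hy, h⟩ | h)
      exacts [⟨y, by omega, h⟩, ⟨m, by omega, h⟩]
    · rintro ⟨y, hy, h⟩
      rcases Nat.lt_succ_iff_lt_or_eq.1 hy with hy | rfl
      exacts [.inl ⟨y, hy, h⟩, .inr h]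

/-- The only cell of the previous block that can agree with all that is remembered of a cell is the
one with the same address. -/
theorem readOK_blockW {g' : ℕ → Kind × ℕ × ℕ} {a x : ℕ} {h : Bool} (hx : x < 2 ^ n) :
    ReadOK {.cont a h} (addrBits 0 n x ++ (blockW n g x ++ stackW n (g' :: L))) ↔
      a = (g' x).2.2 ∧ h = (g' x).1.after := by
  rw [readOK_addrBits noBit_blockW, foundNext_blockW, stackW, FoundNext, found_blockW]
  constructor
  · rintro ⟨y, hy, hI⟩
    obtain rfl : x = y := by
      refine eq_of_testBit_eq_lt hx hy fun i hi => ?_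
      have := hI (.addr i (x.testBit i)) (.inr ⟨i, by omega, by omega, rfl⟩)
      exact ((compOK_addrBits noBit_blockW).1 this (Nat.zero_le _) (by omega)).symm
    exact hI (.cont a h) (.inl rfl)
  · intro hah
    refine ⟨x, hx, ?_⟩
    rintro I (rfl | ⟨i, h1, h2, rfl⟩)
    · exact hah
    · exact (compOK_addrBits noBit_blockW).2 fun _ _ => rfl

theorem checkOK_blockW {m} (hm : m ≤ 2 ^ n) : CheckOK n (blockW n g m ++ stackW n L) ↔
    CheckOK n (stackW n L) ∧ ∀ x < m, ReadOK {.cont (g x).2.1 (g x).1.before}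
      (addrBits 0 n x ++ (blockW n g x ++ stackW n L)) := by
  induction m with
  | zero => simp [blockW]
  | succ m ih =>
    rw [blockW, List.cons_append, List.append_assoc, CheckOK, checkOK_addrBits, ih (by omega)]
    constructor
    · rintro ⟨⟨h1, h2⟩, -, h3⟩
      refine ⟨h1, fun x hx => ?_⟩
      rcases Nat.lt_succ_iff_lt_or_eq.1 hx with hx | rfl
      exacts [h2 x hx, h3]
    · rintro ⟨h1, h2⟩
      exact ⟨⟨h1, fun x hx => h2 x (by omega)⟩, incrOK_blockW (by omega), h2 m (by omega)⟩

theorem checkOK_stackW : CheckOK n (stackW n L) ↔ Coherent n L := by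
  induction L with
  | nil => exact Iff.rfl
  | cons g L ih =>
    rw [stackW, CheckOK, and_iff_left lastOK_blockW, checkOK_blockW le_rfl, ih]
    rcases L with _ | ⟨g', L⟩
    · refine iff_of_true ⟨trivial, fun x hx => ?_⟩ trivial
      rw [readOK_addrBits noBit_blockW, foundNext_blockW]
      trivial
    · exact and_congr_right fun _ => forall₂_congr fun x hx => readOK_blockW hx

end PMC

namespace PMC

/-! ### Steps of the machine -/

variable (T : ATM) (w : List (Fin T.nA))

/-- The stack symbols that are pushed, the last one first, on the way from one control state to
another, without completing a block. -/
inductive Pushes (s : Ctl ℕ) : List (Sym ℕ) → Ctl ℕ → Prop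
  | nil : Pushes s [] s
  | cons {δ s' s'' x} (h : Pushes s δ s') (hx : (s', s'', x) ∈ pushList T w) (hm : x ≠ .mark) :
      Pushes s (x :: δ) s''

/-- The cells that are pushed on the way from one control state to another. -/
inductive CellPath (s : Ctl ℕ) (g : ℕ → Kind × ℕ × ℕ) : ℕ → Ctl ℕ → Prop
  | zero : CellPath s g 0 s
  | succ {m s' s''} (h : CellPath s g m s')
      (hx : (s', s'', .cell (g m).1 (g m).2.1 (g m).2.2) ∈ pushList T w) : CellPath s g (m + 1) s''

variable {T w}
variable {n : ℕ} {s s' s'' : Ctl ℕ} {g : ℕ → Kind × ℕ × ℕ} {α δ : List (Sym ℕ)}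

theorem push_bit_iff {b : Bool} {j : ℕ} : (s, s', .bit b j) ∈ pushList T w ↔
    s' = s ∧ (s, s, .bit b j) ∈ pushList T w := by
  refine ⟨fun h => ?_, by rintro ⟨rfl, h⟩; exact h⟩
  obtain rfl : s' = s := by
    rcases mem_pushList.1 h with h | ⟨k, u, -, -, h⟩
    · cases h <;> rfl
    · cases h
  exact ⟨rfl, h⟩

theorem push_bit_of_push_cell {k : Kind} {a c j : ℕ} {b : Bool}
    (h : (s, s', .cell k a c) ∈ pushList T w) (hj : j < w.length) :
    (s, s, .bit b j) ∈ pushList T w := by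
  rw [mem_pushList]
  refine .inl ?_
  rcases mem_pushList.1 h with h | ⟨k, u, rfl, -⟩
  · cases h <;> constructor <;> first | assumption | exact Nat.lt_succ_self _
  · exact .init_bit (Nat.lt_succ_of_lt k.2) hj

theorem Pushes.append_addrBits {i d x : ℕ} (hd : i + d ≤ w.length)
    (hb : ∀ b, ∀ j < w.length, (s', s', .bit b j) ∈ pushList T w) (h : Pushes T w s δ s') :
    Pushes T w s (addrBits i d x ++ δ) s' := by
  induction d generalizing i with
  | zero => exact h
  | succ d ih => exact .cons (ih (by omega)) (hb _ _ (by omega)) (by simp)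

theorem Pushes.of_append_addrBits {i d x : ℕ} (h : Pushes T w s (addrBits i d x ++ δ) s') :
    Pushes T w s δ s' := by
  induction d generalizing i with
  | zero => exact h
  | succ d ih =>
    rw [addrBits_succ, List.cons_append] at h
    cases h with
    | cons h hx hm =>
      obtain ⟨rfl, -⟩ := push_bit_iff.1 hx
      exact ih h

theorem pushes_blockW_iff {m : ℕ} : Pushes T w s (blockW w.length g m) s' ↔
    CellPath T w s g m s' := by
  induction m generalizing s' with
  | zero =>
    constructor
    · rintro ⟨⟩
      exact .zero
    · rintro ⟨⟩
      exact .nil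
  | succ m ih =>
    constructor
    · rintro (_ | ⟨h, hx, -⟩)
      exact .succ (ih.1 h.of_append_addrBits) hx
    · rintro (_ | ⟨h, hx⟩)
      exact .cons (.append_addrBits (by omega) (fun b j hj => push_bit_of_push_cell hx hj)
        (ih.2 h)) hx (by simp)

theorem Pushes.mark_notMem (h : Pushes T w s δ s') : Sym.mark ∉ δ := by
  induction h with
  | nil => simp
  | cons _ _ hm ih => simp [ih, hm.symm]

/-- The control states in which a push transition is chosen. -/
def Ctl.isPush : Ctl ℕ → Bool
  | .header _ => false
  | .select _ _ _ => false
  | s => s.isGen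

theorem isPush_of_mem_pushList {x : Sym ℕ} (h : (s, s', x) ∈ pushList T w) :
    s.isPush = true ∧ s.isEnv = true := by
  rcases mem_pushList.1 h with h | ⟨k, u, rfl, -⟩
  · cases h <;> exact ⟨rfl, rfl⟩
  · exact ⟨rfl, rfl⟩

theorem isPush_or_of_mem_pushList {x : Sym ℕ} (h : (s, s', x) ∈ pushList T w) :
    (s'.isPush = true ∧ x ≠ .mark) ∨
      x = .mark ∧ ((∃ q, s = .post q ∧ s' = .header q) ∨
        s = .init false w.length ∧ s' = .header T.q0) := by
  rcases mem_pushList.1 h with h | ⟨k, u, -, rfl, rfl⟩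
  · cases h
    case post_mark q hq => exact .inr ⟨rfl, .inl ⟨q, rfl, rfl⟩⟩
    case init_mark => exact .inr ⟨rfl, .inr ⟨rfl, rfl⟩⟩
    all_goals exact .inl ⟨rfl, by simp⟩
  · exact .inl ⟨rfl, by simp⟩

theorem trans_of_isPush {p : Pos} (hs : s.isPush = true) (h : Trans T w (s, α) p) :
    ∃ s' x, (s, s', x) ∈ pushList T w ∧ p = (s', x :: α) := by
  have hg : s.isGen = true := by
    rcases s with _ | _ | _ | _ | _ | _ | _ | _ | _ | _ | _ | _ | _ | _ | _ | _ | _ | _ <;>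
      first | rfl | cases hs
  cases h with
  | int h =>
    rcases mem_intList.1 h with ⟨q, a, h⟩ | ⟨q, -, h⟩ | ⟨q, a, u, r, -, h⟩ <;>
      obtain ⟨rfl, rfl⟩ := Prod.mk.inj h <;> cases hs
  | push h => exact ⟨_, _, h, rfl⟩
  | popBot h => simp [(isGen_of_popTrans (mem_popList.1 h)).1] at hg
  | pop h => simp [(isGen_of_popTrans (mem_popList.1 h)).1] at hg

/-- A winning environment completes the block. -/
theorem WinIn.exists_pushes {m : ℕ} (h : WinIn T w m (s', δ ++ α)) (hp : Pushes T w s δ s')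
    (hs' : s'.isPush = true) : ∃ δ t t', Pushes T w s δ t ∧ (t, t', .mark) ∈ pushList T w ∧
      ∃ k < m, WinIn T w k (t', .mark :: (δ ++ α)) := by
  induction m generalizing s' δ with
  | zero => cases h with
    | fin => cases hs'
  | succ m ih =>
    cases h with
    | fin => cases hs'
    | all => cases hs'
    | env _ _ h h' =>
      obtain ⟨t, x, hx, rfl⟩ := trans_of_isPush hs' h
      rcases isPush_or_of_mem_pushList hx with ⟨h1, h2⟩ | ⟨rfl, -⟩
      · obtain ⟨δ', t', t'', h3, h4, k, hk, h5⟩ := ih (δ := x :: δ) h' (.cons hp hx h2) h1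
        exact ⟨δ', t', t'', h3, h4, k, by omega, h5⟩
      · exact ⟨δ, s', t, hp, hx, m, Nat.lt_succ_self m, h'⟩

theorem WinIn.of_mem_pushList {m : ℕ} {x : Sym ℕ} (h : WinIn T w m (s', x :: α))
    (hx : (s, s', x) ∈ pushList T w) : WinIn T w (m + 1) (s, α) :=
  .env (isGen_of_mem_pushList hx) (isPush_of_mem_pushList hx).2 (.push hx) h

theorem WinIn.of_pushes {m : ℕ} (h : WinIn T w m (s', δ ++ α)) (hp : Pushes T w s δ s') :
    ∃ m, WinIn T w m (s, α) := by
  induction hp generalizing m with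
  | nil => exact ⟨m, h⟩
  | cons _ hx _ ih => exact ih (h.of_mem_pushList hx)

/-- A winning position has no error in its stack. -/
theorem WinIn.checkOK {m : ℕ} {p : Pos} (h : WinIn T w m p) : CheckOK w.length p.2 := by
  induction h with
  | fin _ hα => exact hα
  | @env m p p' hp he h _ ih =>
    obtain ⟨s, α⟩ := p
    cases h with
    | int => exact ih
    | @push _ _ x =>
      rcases x with _ | _ | _
      exacts [ih, ih.1, ih.1]
    | popBot h => simp [(isGen_of_popTrans (mem_popList.1 h)).1] at hp
    | pop h => simp [(isGen_of_popTrans (mem_popList.1 h)).1] at hp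
  | @all m q a α h _ ih =>
    obtain ⟨p', hp'⟩ := h
    have := ih p' hp'
    cases hp' with
    | int => exact this
    | push h => cases (isPush_of_mem_pushList h).1
    | popBot h => cases (isGen_of_popTrans (mem_popList.1 h)).1
    | pop h => cases (isGen_of_popTrans (mem_popList.1 h)).1

/-- The cells of a step of the machine that replaces `a` by `b` and moves the head from the cell
`i` to the cell `i'`. -/
structure IsStepBlock (N : ℕ) (g : ℕ → Kind × ℕ × ℕ) (a b i i' : ℕ) : Prop where
  lt : i < N
  lt' : i' < N
  depart : g i = (.depart, a, b)
  arrive : ∃ c, g i' = (.arrive, c, c)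
  stay : ∀ x < N, x ≠ i → x ≠ i' → ∃ c, g x = (.stay, c, c)

/-- The cell `i'` is the neighbour of the cell `i` in the given direction. -/
def IsMove (right : Bool) (i i' : ℕ) : Prop := if right = true then i' = i + 1 else i = i' + 1

theorem exists_isStepBlock {right : Bool} {q a b N q' : ℕ}
    (h : CellPath T w (.pre right q a b) g N (.post q')) :
    q' = q ∧ ∃ i i', IsMove right i i' ∧ IsStepBlock N g a b i i' := by
  have key : ∀ m s, CellPath T w (.pre right q a b) g m s →
      (s = .pre right q a b ∧ ∀ x < m, ∃ c, g x = (.stay, c, c)) ∨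
      (right = true ∧ s = .midR q ∧ ∃ h, m = h + 1 ∧ g h = (.depart, a, b) ∧
        ∀ x < h, ∃ c, g x = (.stay, c, c)) ∨
      (right = false ∧ s = .midL q a b ∧ ∃ h, m = h + 1 ∧ (∃ c, g h = (.arrive, c, c)) ∧
        ∀ x < h, ∃ c, g x = (.stay, c, c)) ∨
      (s = .post q ∧ ∃ i i', IsMove right i i' ∧ IsStepBlock m g a b i i') := by
    intro m s h
    have hlt : ∀ {m : ℕ} {k a b}, (g m).1 = k → (g m).2.1 = a → (g m).2.2 = b →
        g m = (k, a, b) := by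
      rintro m k a b rfl rfl rfl
      rfl
    induction h with
    | zero => exact .inl ⟨rfl, by simp⟩
    | @succ m s s' h hx ih =>
      have hx' : StaticPush (baseOf T w) s s' (.cell (g m).1 (g m).2.1 (g m).2.2) := by
        rcases mem_pushList.1 hx with hx | ⟨k, u, rfl, -⟩
        · exact hx
        · rcases ih with ⟨h, -⟩ | ⟨-, h, -⟩ | ⟨-, h, -⟩ | ⟨h, -⟩ <;> cases h
      have hsucc : (∀ x < m, ∃ c, g x = (.stay, c, c)) → (∃ c, g m = (.stay, c, c)) →
          ∀ x < m + 1, ∃ c, g x = (.stay, c, c) := by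
        intro h1 h2 x hx
        rcases Nat.lt_succ_iff_lt_or_eq.1 hx with hx | rfl
        exacts [h1 x hx, h2]
      generalize e1 : (g m).1 = k at hx'
      generalize e2 : (g m).2.1 = a' at hx'
      generalize e3 : (g m).2.2 = b' at hx'
      have e := hlt e1 e2 e3
      rcases ih with ⟨rfl, h1⟩ | ⟨rfl, rfl, i, rfl, h1, h2⟩ | ⟨rfl, rfl, i, rfl, h1, h2⟩ |
        ⟨rfl, i, i', h1, h2⟩
      · cases hx'
        · exact .inr (.inl ⟨rfl, rfl, m, rfl, e, h1⟩)
        · exact .inl ⟨rfl, hsucc h1 ⟨_, e⟩⟩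
        · exact .inr (.inr (.inl ⟨rfl, rfl, m, rfl, ⟨_, e⟩, h1⟩))
      · cases hx'
        refine .inr (.inr (.inr ⟨rfl, i, i + 1, by simp [IsMove], by omega, by omega, h1, ⟨_, e⟩,
          fun x h3 h4 h5 => h2 x (by omega)⟩))
      · cases hx'
        refine .inr (.inr (.inr ⟨rfl, i + 1, i, by simp [IsMove], by omega, by omega, e, h1,
          fun x h3 h4 h5 => h2 x (by omega)⟩))
      · cases hx'
        refine .inr (.inr (.inr ⟨rfl, i, i', h1, h2.lt.trans (Nat.lt_succ_self _),
          h2.lt'.trans (Nat.lt_succ_self _), h2.depart, h2.arrive, fun x h3 h4 h5 => ?_⟩))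
        rcases Nat.lt_succ_iff_lt_or_eq.1 h3 with h3 | rfl
        exacts [h2.stay x h3 h4 h5, ⟨_, e⟩]
  rcases key _ _ h with ⟨h, -⟩ | ⟨-, h, -⟩ | ⟨-, h, -⟩ | ⟨h, h'⟩
  · cases h
  · cases h
  · cases h
  · cases h
    exact ⟨rfl, h'⟩

theorem cellPath_of_isStepBlock {right : Bool} {q a b N i i' : ℕ} (hq : q < T.nQ) (ha : a < T.nA)
    (hb : b < T.nA) (hm : IsMove right i i') (h : IsStepBlock N g a b i i')
    (hg : ∀ x < N, (g x).2.1 < T.nA) : CellPath T w (.pre right q a b) g N (.post q) := by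
  obtain ⟨c, hc⟩ := h.arrive
  have hcA : c < T.nA := by have := hg i' h.lt'; rwa [hc] at this
  have hstay : ∀ x < N, x ≠ i → x ≠ i' → ∃ c < T.nA, g x = (.stay, c, c) := by
    intro x h1 h2 h3
    obtain ⟨c, hc⟩ := h.stay x h1 h2 h3
    have := hg x h1
    rw [hc] at this
    exact ⟨c, this, hc⟩
  have h1 : ∀ m, m ≤ i → m ≤ i' → CellPath T w (.pre right q a b) g m (.pre right q a b) := by
    intro m
    induction m with
    | zero => exact fun _ _ => .zero
    | succ m ih =>
      intro h1 h2
      refine .succ (ih (by omega) (by omega)) (mem_pushList.2 (.inl ?_))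
      obtain ⟨c, hc, e⟩ := hstay m (h1.trans h.lt.le) (by omega) (by omega)
      rw [e]
      exact .pre_stay hq ha hb hc
  have h2 : CellPath T w (.pre right q a b) g (max i i' + 1) (.post q) := by
    cases right with
    | true =>
      obtain rfl : i' = i + 1 := by simpa [IsMove] using hm
      rw [Nat.max_eq_right (by omega)]
      refine .succ (s' := .midR q) (.succ (h1 i le_rfl (by omega)) (mem_pushList.2 (.inl ?_)))
        (mem_pushList.2 (.inl ?_))
      · rw [h.depart]
        exact .pre_depart hq ha hb
      · rw [hc]
        exact .midR_arrive hq hcA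
    | false =>
      obtain rfl : i = i' + 1 := by simpa [IsMove] using hm
      rw [Nat.max_eq_left (by omega)]
      refine .succ (s' := .midL q a b) (.succ (h1 i' (by omega) le_rfl) (mem_pushList.2 (.inl ?_)))
        (mem_pushList.2 (.inl ?_))
      · rw [hc]
        exact .pre_arrive hq ha hb hcA
      · rw [h.depart]
        exact .midL_depart hq ha hb
  have h3 : ∀ m, max i i' < m → m ≤ N → CellPath T w (.pre right q a b) g m (.post q) := by
    intro m hm
    induction m, hm using Nat.le_induction with
    | base => exact fun _ => h2
    | succ m hm ih =>
      intro hN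
      refine .succ (ih (by omega)) (mem_pushList.2 (.inl ?_))
      obtain ⟨c, hc, e⟩ := hstay m hN (by omega) (by omega)
      rw [e]
      exact .post_stay hq hc
  exact h3 N (max_lt h.lt h.lt') le_rfl

/-- The cells of the initial configuration; the head arrives at the first one. -/
def initBlock (T : ATM) (w : List (Fin T.nA)) (x : ℕ) : Kind × ℕ × ℕ :=
  (if x = 0 then .arrive else .stay, w.getD x T.blank, w.getD x T.blank)

theorem cellPath_init_iff {N : ℕ} (hw : w ≠ []) :
    CellPath T w (.init true 0) g N s ↔
      s = .init (decide (N = 0)) (min N w.length) ∧ ∀ x < N, g x = initBlock T w x := by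
  have hw' := List.length_pos_iff.2 hw
  induction N generalizing s with
  | zero =>
    constructor
    · rintro ⟨⟩
      exact ⟨by simp, by simp⟩
    · rintro ⟨rfl, -⟩
      exact .zero
  | succ N ih =>
    have key : (.init (decide (N = 0)) (min N w.length), s,
        .cell (g N).1 (g N).2.1 (g N).2.2) ∈ pushList T w ↔
        s = .init false (min (N + 1) w.length) ∧ g N = initBlock T w N := by
      have hg : ∀ k a b, Sym.cell (g N).1 (g N).2.1 (g N).2.2 = .cell k a b ↔ g N = (k, a, b) := by
        intro k a b
        rw [Sym.cell.injEq, Prod.ext_iff, Prod.ext_iff]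
      rw [mem_pushList]
      by_cases hN : N < w.length
      · rw [Nat.min_eq_left hN.le, Nat.min_eq_left hN, initBlock, List.getD_eq_getElem _ _ hN]
        constructor
        · rintro (h | ⟨k, u, h1, h2, h3⟩)
          · generalize hx : Sym.cell (g N).1 (g N).2.1 (g N).2.2 = x at h
            generalize decide (N = 0) = u at h
            generalize ht : Ctl.init u N = t at h
            cases h <;> cases ht
            · cases hx
            · exact absurd hN (lt_irrefl _)
            · cases hx
          · obtain ⟨rfl, rfl⟩ := Ctl.init.inj h1
            rw [hg] at h3
            refine ⟨h2, h3.trans ?_⟩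
            by_cases hk : (k : ℕ) = 0 <;> simp [hk]
        · rintro ⟨rfl, h⟩
          refine .inr ⟨⟨N, hN⟩, _, rfl, rfl, (hg _ _ _).2 (h.trans ?_)⟩
          by_cases hk : N = 0 <;> simp [hk]
      · have hN0 : N ≠ 0 := by omega
        rw [Nat.min_eq_right (by omega), Nat.min_eq_right (by omega), initBlock, if_neg hN0,
          List.getD_eq_default _ _ (by omega), decide_eq_false hN0]
        constructor
        · rintro (h | ⟨k, u, h1, h2, h3⟩)
          · generalize hx : Sym.cell (g N).1 (g N).2.1 (g N).2.2 = x at h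
            generalize ht : Ctl.init false w.length = t at h
            cases h <;> cases ht
            · cases hx
            · exact ⟨rfl, (hg _ _ _).1 hx⟩
            · cases hx
          · have := (Ctl.init.inj h1).2
            have := k.2
            omega
        · rintro ⟨rfl, h⟩
          rw [(hg _ _ _).2 h]
          exact .inl .init_blank
    rw [decide_eq_false N.succ_ne_zero]
    constructor
    · rintro (_ | ⟨h, hx⟩)
      obtain ⟨rfl, h1⟩ := ih.1 h
      obtain ⟨rfl, h2⟩ := key.1 hx
      refine ⟨rfl, fun x hx => ?_⟩
      rcases Nat.lt_succ_iff_lt_or_eq.1 hx with hx | rfl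
      exacts [h1 x hx, h2]
    · rintro ⟨rfl, h⟩
      exact .succ (ih.2 ⟨rfl, fun x hx => h x (by omega)⟩) (key.2 ⟨rfl, h N (by omega)⟩)

end PMC

namespace PMC

/-! ### Winning positions and acceptance -/

variable {T : ATM} {w : List (Fin T.nA)} {N : ℕ} {g g' : ℕ → Kind × ℕ × ℕ}
  {L : List (ℕ → Kind × ℕ × ℕ)} {α : List (Sym ℕ)}

/-- The step that is described by these cells leads to the configuration `C`. -/
def Represents (g : ℕ → Kind × ℕ × ℕ) (C : T.Cfg N) : Prop :=
  ∀ x (hx : x < N), (g x).2.2 = C.tape ⟨x, hx⟩ ∧ (g x).1.after = decide (x = C.head)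

theorem moveHead_eq_some_iff {i i' : Fin N} {d : Move} :
    ATM.moveHead i d = some i' ↔ IsMove (encMove d) i i' := by
  have := i'.2
  cases d
  · simp only [ATM.moveHead, IsMove, encMove, Bool.false_eq_true, if_false,
      Option.ite_none_right_eq_some, Option.some.injEq, Fin.ext_iff]
    omega
  · simp only [ATM.moveHead, IsMove, encMove, if_true, Option.dite_none_right_eq_some,
      Option.some.injEq, Fin.ext_iff, exists_prop]
    omega

theorem exists_apply_eq_some {C : T.Cfg N} {r : Fin T.nQ × Fin T.nA × Move} {a i i' : ℕ}
    (hC : Represents g' C) (hm : IsMove (encMove r.2.2) i i') (h : IsStepBlock N g a r.2.1 i i')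
    (hg : ∀ x < N, (g x).2.1 = (g' x).2.2 ∧ (g x).1.before = (g' x).1.after) :
    a = C.tape C.head ∧ ∃ C', C.apply r = some C' ∧ Represents g C' := by
  obtain ⟨h1, h2⟩ := hg i h.lt
  obtain ⟨h3, h4⟩ := hC i h.lt
  have hne : i' ≠ i := by
    rintro rfl
    unfold IsMove at hm
    split at hm <;> omega
  rw [h.depart] at h1 h2
  have hi : i = C.head := by simpa [Kind.before, h4] using h2.symm
  have ha : a = C.tape C.head := by
    refine h1.trans (h3.trans ?_)
    congr 2
    exact Fin.ext hi
  refine ⟨ha, ⟨Function.update C.tape C.head r.2.1, ⟨i', h.lt'⟩, r.1⟩, ?_, fun x hx => ?_⟩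
  · rw [ATM.Cfg.apply, moveHead_eq_some_iff.2 (show IsMove _ _ (⟨i', h.lt'⟩ : Fin N) from hi ▸ hm)]
    rfl
  · obtain ⟨h5, -⟩ := hg x hx
    obtain ⟨h6, -⟩ := hC x hx
    by_cases hxi : x = i
    · subst hxi
      have : (⟨x, hx⟩ : Fin N) = C.head := Fin.ext hi
      simp only [h.depart, this, Function.update_self, true_and]
      exact (decide_eq_false hne.symm).symm
    · have : (⟨x, hx⟩ : Fin N) ≠ C.head := fun e => hxi (hi ▸ congrArg Fin.val e)
      simp only [Function.update_of_ne this]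
      rw [← h6, ← h5]
      by_cases hxi' : x = i'
      · subst hxi'
        obtain ⟨c, hc⟩ := h.arrive
        rw [hc]
        simp [Kind.after]
      · obtain ⟨c, hc⟩ := h.stay x hx hxi hxi'
        rw [hc]
        simp [Kind.after, hxi']

theorem exists_block_of_apply {C C' : T.Cfg N} {r : Fin T.nQ × Fin T.nA × Move}
    (hC : Represents g' C) (h : C.apply r = some C') :
    C'.state = r.1 ∧ IsMove (encMove r.2.2) C.head C'.head ∧
      ∃ g, IsStepBlock N g (C.tape C.head) r.2.1 C.head C'.head ∧ Represents g C' ∧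
        (∀ x < N, (g x).2.1 = (g' x).2.2 ∧ (g x).1.before = (g' x).1.after) ∧
        ∀ x < N, (g x).2.1 < T.nA := by
  obtain ⟨i', hi', rfl⟩ := Option.map_eq_some_iff.1 h
  have hm := moveHead_eq_some_iff.1 hi'
  have hne : (i' : ℕ) ≠ C.head := by
    intro e
    rw [e] at hm
    unfold IsMove at hm
    split at hm <;> omega
  refine ⟨rfl, hm, fun x => (if x = C.head then .depart else if x = i' then .arrive else .stay,
    (g' x).2.2, if x = C.head then r.2.1 else (g' x).2.2),
    ⟨C.head.2, i'.2, ?_, ⟨(g' i').2.2, ?_⟩, ?_⟩,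
    ?_, ?_, ?_⟩
  · simp [(hC C.head C.head.2).1]
  · simp only [if_neg hne, if_true]
  · intro x hx h1 h2
    simp only [if_neg h1, if_neg h2]
    exact ⟨_, rfl⟩
  · intro x hx
    by_cases h1 : x = C.head
    · subst h1
      simp [Kind.after, hne.symm]
    · have : (⟨x, hx⟩ : Fin N) ≠ C.head := fun e => h1 (congrArg Fin.val e)
      simp only [if_neg h1, Function.update_of_ne this, (hC x hx).1, true_and]
      by_cases h2 : x = i' <;> simp [h2, Kind.after]
  · intro x hx
    refine ⟨rfl, ?_⟩
    rw [(hC x hx).2]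
    by_cases h1 : x = C.head
    · simp [h1, Kind.before]
    · by_cases h2 : x = i' <;> simp [h1, h2, hne, Kind.before]
  · intro x hx
    simp only [(hC x hx).1]
    exact Fin.is_lt _

theorem trans_header_iff {q : Fin T.nQ} {p : Pos} : Trans T w (.header q, α) p ↔
    (∃ a : Fin T.nA, p = (.select (T.isUniv q) q a, α)) ∨ T.isAcc q = true ∧ p = (.chk, α) := by
  constructor
  · intro h
    cases h with
    | int h =>
      rcases mem_intList.1 h with ⟨q', a, h⟩ | ⟨q', hq', h⟩ | ⟨q', a, u, r, -, h⟩ <;>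
        obtain ⟨h1, rfl⟩ := Prod.mk.inj h
      · obtain rfl : q = q' := Fin.ext (Ctl.header.inj h1)
        exact .inl ⟨a, rfl⟩
      · obtain rfl : q = q' := Fin.ext (Ctl.header.inj h1)
        exact .inr ⟨hq', rfl⟩
      · cases h1
    | push h => cases (isPush_of_mem_pushList h).1
    | popBot h => cases (isGen_of_popTrans (mem_popList.1 h)).1
    | pop h => cases (isGen_of_popTrans (mem_popList.1 h)).1
  · rintro (⟨a, rfl⟩ | ⟨hq, rfl⟩)
    · exact .int (mem_intList.2 (.inl ⟨q, a, rfl⟩))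
    · exact .int (mem_intList.2 (.inr (.inl ⟨q, hq, rfl⟩)))

theorem trans_select_iff {u : Bool} {q : Fin T.nQ} {a : Fin T.nA} {p : Pos} :
    Trans T w (.select u q a, α) p ↔
      p = (.pre (encMove (T.δ q a).1.2.2) (T.δ q a).1.1 a (T.δ q a).1.2.1, α) ∨
      p = (.pre (encMove (T.δ q a).2.2.2) (T.δ q a).2.1 a (T.δ q a).2.2.1, α) := by
  constructor
  · intro h
    cases h with
    | int h =>
      rcases mem_intList.1 h with ⟨q', a, h⟩ | ⟨q', hq', h⟩ | ⟨q', a', u, r, hr, h⟩ <;>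
        obtain ⟨h1, rfl⟩ := Prod.mk.inj h
      · cases h1
      · cases h1
      · obtain ⟨-, h2, h3⟩ := Ctl.select.inj h1
        obtain rfl : q = q' := Fin.ext h2
        obtain rfl : a = a' := Fin.ext h3
        rcases hr with rfl | rfl
        exacts [.inl rfl, .inr rfl]
    | push h => cases (isPush_of_mem_pushList h).1
    | popBot h => cases (isGen_of_popTrans (mem_popList.1 h)).1
    | pop h => cases (isGen_of_popTrans (mem_popList.1 h)).1
  · rintro (rfl | rfl)
    · exact .int (mem_intList.2 (.inr (.inr ⟨q, a, u, _, .inl rfl, rfl⟩)))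
    · exact .int (mem_intList.2 (.inr (.inr ⟨q, a, u, _, .inr rfl, rfl⟩)))

theorem exists_init_of_cellPath {s : Ctl ℕ} {m : ℕ} {u : Bool} {i : ℕ}
    (h : CellPath T w s g m (.init u i)) : ∃ u' i', s = .init u' i' := by
  generalize ht : Ctl.init u i = t at h
  induction h generalizing u i with
  | zero => exact ⟨u, i, ht.symm⟩
  | succ _ hx ih =>
    subst ht
    rcases mem_pushList.1 hx with hx | ⟨k, u, rfl, -⟩
    · generalize Sym.cell _ _ _ = x at hx
      cases hx
      · exact ih rfl
      · exact ih rfl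
    · exact ih rfl

theorem exists_cellPath_of_winIn {m : ℕ} {s : Ctl ℕ} (hs : s.isPush = true)
    (h : WinIn T w m (s, stackW w.length L)) :
    ∃ g t t', CellPath T w s g (2 ^ w.length) t ∧ (t, t', .mark) ∈ pushList T w ∧
      ∃ k < m, WinIn T w k (t', stackW w.length (g :: L)) := by
  obtain ⟨δ, t, t', h1, h2, k, hk, h3⟩ := WinIn.exists_pushes (δ := []) h .nil hs
  obtain ⟨g, rfl⟩ := exists_blockW_of_mark h1.mark_notMem h3.checkOK
  exact ⟨g, t, t', pushes_blockW_iff.1 h1, h2, k, hk, h3⟩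

theorem accepting_of_winIn {m : ℕ} {C : T.Cfg (2 ^ w.length)}
    (h : WinIn T w m (.header C.state, stackW w.length (g :: L))) (hC : Represents g C) :
    C.Accepting := by
  induction m using Nat.strong_induction_on generalizing C g L with
  | _ m ih =>
    have step : ∀ k < m, ∀ (r : Fin T.nQ × Fin T.nA × Move) (a : Fin T.nA),
        WinIn T w k (.pre (encMove r.2.2) r.1 a r.2.1, stackW w.length (g :: L)) →
        a = C.tape C.head ∧ ∃ C', C.apply r = some C' ∧ C'.Accepting := by
      intro k hk r a h
      obtain ⟨g', t, t', h1, h2, k', hk', h3⟩ := exists_cellPath_of_winIn rfl h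
      rcases isPush_or_of_mem_pushList h2 with ⟨-, h4⟩ | ⟨-, ⟨q, rfl, rfl⟩ | ⟨rfl, -⟩⟩
      · exact absurd rfl h4
      · obtain ⟨rfl, i, i', h5, h6⟩ := exists_isStepBlock h1
        obtain ⟨h7, C', h8, h9⟩ := exists_apply_eq_some hC h5 h6 (checkOK_stackW.1 h3.checkOK).2
        refine ⟨Fin.ext h7, C', h8, ih k' (by omega) (C := C') (L := g :: L) ?_ h9⟩
        obtain ⟨h10, -⟩ := exists_block_of_apply hC h8
        rwa [h10]
      · obtain ⟨u, i, h⟩ := exists_init_of_cellPath h1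
        cases h
    cases h with
    | fin h =>
      rcases trans_header_iff.1 h with ⟨a, h⟩ | ⟨h, -⟩
      · cases h
      · exact .leaf h
    | @env m _ p' _ _ h h' =>
      rcases trans_header_iff.1 h with ⟨a, rfl⟩ | ⟨-, rfl⟩
      · rcases hu : T.isUniv C.state with _ | _ <;> rw [hu] at h'
        · cases h' with
          | @env k _ p' _ _ h h' =>
            rcases trans_select_iff.1 h with rfl | rfl
            · obtain ⟨rfl, C', h1, h2⟩ := step k (by omega) _ _ h'
              exact .exL hu h1 h2
            · obtain ⟨rfl, C', h1, h2⟩ := step k (by omega) _ _ h'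
              exact .exR hu h1 h2
        · cases h' with
          | env _ he => cases he
          | @all k _ _ _ _ h' =>
            obtain ⟨e, C₁, h1, h2⟩ := step k (by omega) _ _ (h' _ (trans_select_iff.2 (.inl rfl)))
            obtain ⟨-, C₂, h3, h4⟩ := step k (by omega) _ _ (h' _ (trans_select_iff.2 (.inr rfl)))
            subst e
            exact .univ hu h1 h3 h2 h4
      · cases h'.isGen

theorem exists_winIn_of_accepting {C : T.Cfg (2 ^ w.length)} (h : C.Accepting)
    (hC : Represents g C) (hL : Coherent w.length (g :: L)) :
    ∃ m, WinIn T w m (.header C.state, stackW w.length (g :: L)) := by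
  have step : ∀ {C C' : T.Cfg (2 ^ w.length)} {r : Fin T.nQ × Fin T.nA × Move}
      {g : ℕ → Kind × ℕ × ℕ} {L}, C.apply r = some C' → Represents g C →
      Coherent w.length (g :: L) →
      (∀ {g L}, Represents g C' → Coherent w.length (g :: L) →
        ∃ m, WinIn T w m (.header C'.state, stackW w.length (g :: L))) →
      ∃ m, WinIn T w m
        (.pre (encMove r.2.2) r.1 (C.tape C.head) r.2.1, stackW w.length (g :: L)) := by
    intro C C' r g L h hC hL ih
    obtain ⟨h1, h2, g', h3, h4, h5, h6⟩ := exists_block_of_apply hC h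
    obtain ⟨m, hm⟩ := ih h4 (L := g :: L) ⟨hL, h5⟩
    rw [h1] at hm
    refine WinIn.of_pushes (hm.of_mem_pushList (mem_pushList.2 (.inl (.post_mark r.1.2))))
      (pushes_blockW_iff.2 (cellPath_of_isStepBlock r.1.2 (Fin.is_lt _) (Fin.is_lt _) h2 h3 h6))
  induction h generalizing g L with
  | leaf h => exact ⟨0, .fin (trans_header_iff.2 (.inr ⟨h, rfl⟩)) (checkOK_stackW.2 hL)⟩
  | @exL C C' hu hs _ ih =>
    obtain ⟨m, hm⟩ := step hs hC hL ih
    refine ⟨m + 2, .env (m := m + 1) rfl rfl (trans_header_iff.2 (.inl ⟨C.tape C.head, rfl⟩)) ?_⟩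
    rw [hu]
    exact .env rfl rfl (trans_select_iff.2 (.inl rfl)) hm
  | @exR C C' hu hs _ ih =>
    obtain ⟨m, hm⟩ := step hs hC hL ih
    refine ⟨m + 2, .env (m := m + 1) rfl rfl (trans_header_iff.2 (.inl ⟨C.tape C.head, rfl⟩)) ?_⟩
    rw [hu]
    exact .env rfl rfl (trans_select_iff.2 (.inr rfl)) hm
  | @univ C C₁ C₂ hu h₁ h₂ _ _ ih₁ ih₂ =>
    obtain ⟨m₁, hm₁⟩ := step h₁ hC hL ih₁
    obtain ⟨m₂, hm₂⟩ := step h₂ hC hL ih₂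
    refine ⟨max m₁ m₂ + 2, .env (m := max m₁ m₂ + 1) rfl rfl
      (trans_header_iff.2 (.inl ⟨C.tape C.head, rfl⟩)) ?_⟩
    rw [hu]
    refine .all (m := max m₁ m₂) ⟨_, trans_select_iff.2 (.inl rfl)⟩ fun p' hp' => ?_
    rcases trans_select_iff.1 hp' with rfl | rfl
    exacts [hm₁.mono (le_max_left _ _), hm₂.mono (le_max_right _ _)]

theorem represents_initBlock : Represents (initBlock T w) (T.initCfg w) := by
  intro x hx
  refine ⟨rfl, ?_⟩
  by_cases h : x = 0 <;> simp [initBlock, ATM.initCfg, Kind.after, h]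

theorem exists_winIn_iff_accepts (hw : w ≠ []) :
    (∃ m, WinIn T w m (.init true 0, [])) ↔ T.Accepts w := by
  have hlt := Nat.lt_two_pow_self (n := w.length)
  constructor
  · rintro ⟨m, h⟩
    obtain ⟨g, t, t', h1, h2, k, -, h3⟩ := exists_cellPath_of_winIn (L := []) rfl h
    obtain ⟨rfl, h4⟩ := (cellPath_init_iff hw).1 h1
    obtain rfl : t' = .header T.q0 := by
      rcases isPush_or_of_mem_pushList h2 with ⟨-, h⟩ | ⟨-, ⟨q, h, -⟩ | ⟨-, h⟩⟩
      · exact absurd rfl h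
      · cases h
      · exact h
    refine accepting_of_winIn h3 fun x hx => ?_
    rw [h4 x hx]
    exact represents_initBlock x hx
  · intro h
    obtain ⟨m, hm⟩ := exists_winIn_of_accepting (L := []) h represents_initBlock trivial
    refine WinIn.of_pushes (hm.of_mem_pushList ?_)
      (pushes_blockW_iff.2 ((cellPath_init_iff hw).2 ⟨rfl, fun x _ => rfl⟩))
    rw [Nat.min_eq_right hlt.le, decide_eq_false (Nat.two_pow_pos _).ne']
    exact mem_pushList.2 (.inl .init_mark)

end PMC

theorem mainTheorem4 :
    ∃ φ : PMC.CTL, φ.IsACTL ∧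
      ∃ f : (Σ T : PMC.ATM, List (Fin T.nA)) → PMC.OPD,
        Nonempty (Turing.TM2ComputableInPolyTime PMC.encodeInput PMC.OPD.encode f) ∧
        ∀ (T : PMC.ATM) (w : List (Fin T.nA)), 1 < w.length →
          (f ⟨T, w⟩).VisibleStackContent ∧
          (∀ p ∈ φ.atoms, p ∈ (f ⟨T, w⟩).AP) ∧
          (T.Accepts w ↔ (f ⟨T, w⟩).ExistsStrategyTree φ) := by
  refine ⟨.AU .tt (.prop 1), ⟨trivial, trivial⟩, fun x => PMC.reduction x.1 x.2,
    PMC.reduction_computable, fun T w hw => ⟨rfl, ?_, ?_⟩⟩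
  · rintro p (⟨⟨⟩⟩ | rfl)
    exact List.mem_cons_of_mem _ List.mem_cons_self
  · rw [PMC.existsStrategyTree_iff_wins,
      ← PMC.exists_winIn_iff_accepts (List.ne_nil_of_length_pos (by omega))]
    exact ⟨fun ⟨_, h⟩ => PMC.wins_of_winIn h, PMC.winIn_of_wins⟩
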